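/- **Setup.** For a finite group $G$ let $\mathcal A_G$ be the Burnside category: objects are finite $G$-sets, morphisms are isomorphism classes of spans, composed by pullback. A $G$-Mackey functor is a product-preserving functor from $\mathcal A_G$ to sets whose values (commutative monoids by functoriality) are groups; in general one passes to abelian groups by group completion. The box product is the left Kan extension of the external product $M(S)\times N(T)$ along $(S,T)\mapsto S\times T$. A commutative Green functor is a commutative monoid for the box product. For a commutative ring $A$, viewed as the Green functor $T\mapsto A^T$ for the trivial group $e$, the norm $N_e^GA$ is the commutative $G$-Green functor obtained by left Kan extension along the coinduction functor $T\mapsto F(G,T)$, $\mathcal A_e\to\mathcal A_G$. Let $G=C_{m}\subset S^1$ with generator $g=e^{2\pi i/m}$. The twisted cyclic nerve $HC_e^{G}(A)_\bullet$ is the simplicial $G$-Mackey functor with $k$-simplices $(N_e^GA)^{\Box(k+1)}$; the faces $d_i$, $0\le i<k$, multiply the $i$-th and the $(i+1)$-st factor, the last face $d_k$ moves the last factor to the front, acts on it by $g$ and multiplies it with the factor $0$, and degeneracies insert units. Let $\underline{HH}_e^{G}(A)_k$ be the $k$-th homology Mackey functor of the normalized complex of $HC_e^{G}(A)_\bullet$.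 For a normal subgroup $N\subset G$ and a Mackey functor $M$, let $E\mathcal F_NM\subset M$ be the sub-Mackey functor generated by the values $M(G/H)$ with $N\not\subset H$, and $\Phi^NM=M/E\mathcal F_NM$, regarded as a $G/N$-Mackey functor. There is an isomorphism $\Phi^N HC_e^G(A)_\bullet\cong HC_e^{G/N}(A)_\bullet$, induced by the $G/N$-isomorphisms $F(G,T)^N\cong F(G/N,T)$. For $G=C_{p^{n+1}}$ and $N=C_p$, identify $C_{p^{n+1}}/C_p\cong C_{p^{n}}$ by the $p$-th power map (the root isomorphism $S^1/C_p\cong S^1$). Projecting to $\Phi^{C_p}$ gives the geometric fixed point maps $$R\colon \underline{HH}_e^{C_{p^{n+1}}}(A)_k(C_{p^{n+1}}/C_{p^{n+1}})\to \underline{HH}_e^{C_{p^{n}}}(A)_k(C_{p^{n}}/C_{p^{n}}),\qquad n\ge0,$$ and the algebraic $TR$ groups of $A$ are $tr_k(A;p)=\varprojlim_{R}\underline{HH}_e^{C_{p^{n}}}(A)_k(C_{p^{n}}/C_{p^{n}})$. **Proposition.** Let $p$ be a prime. 1. For all $n\ge0$ there is an isomorphism of $C_{p^n}$-Mackey functors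 $\underline{HH}_e^{C_{p^n}}(\mathbb F_p)_0\cong N_e^{C_{p^n}}\mathbb F_p$, and $\underline{HH}_e^{C_{p^n}}(\mathbb F_p)_k=0$ for all $k>0$. 2. There is an isomorphism of groups $tr_0(\mathbb F_p;p)\cong\mathbb Z_p$, the group of $p$-adic integers, and $tr_k(\mathbb F_p;p)=0$ for all $k>0$. -/

import Mathlib

open CategoryTheory

noncomputable section

namespace AlgebraicTR

universe u v

/-- Objects of the Burnside category of `G`: finite `G`-sets. -/
structure Burnside (G : Type) [Group G] : Type 1 where
  carrier : Type
  [finite : Finite carrier]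
  [action : MulAction G carrier]

namespace Burnside

variable {G : Type} [Group G]

instance : CoeSort (Burnside G) Type := ⟨carrier⟩

attribute [instance] finite action

/-- Equivariant maps. -/
abbrev Map (S T : Burnside G) : Type := S →[G] T

/-- A span `S ← U → T` of finite `G`-sets. -/
structure Span (S T : Burnside G) : Type 1 where
  apex : Burnside G
  fst : apex →[G] S
  snd : apex →[G] T

/-- Isomorphism of spans. -/
def Span.Rel {S T : Burnside G} (a b : Span S T) : Prop :=
  ∃ e : a.apex →[G] b.apex, Function.Bijective e ∧
    (∀ x, b.fst (e x) = a.fst x) ∧ ∀ x, b.snd (e x) = a.snd x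

instance Span.setoid (S T : Burnside G) : Setoid (Span S T) where
  r := Span.Rel
  iseqv :=
    { refl := fun a => ⟨MulActionHom.id G, Function.bijective_id, fun _ => rfl, fun _ => rfl⟩
      symm := by
        rintro a b ⟨e, he, h1, h2⟩
        obtain ⟨f, hf, hf'⟩ := Function.bijective_iff_has_inverse.1 he
        refine ⟨e.inverse f hf hf', ⟨hf'.injective, hf.surjective⟩, fun x => ?_, fun x => ?_⟩
        · have := h1 (f x); rw [hf' x] at this; exact this.symm
        · have := h2 (f x); rw [hf' x] at this; exact this.symm
      trans := by
        rintro a b c ⟨e, he, h1, h2⟩ ⟨e', he', h1', h2'⟩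
        refine ⟨e'.comp e, he'.comp he, fun x => ?_, fun x => ?_⟩
        · exact (h1' _).trans (h1 x)
        · exact (h2' _).trans (h2 x) }

/-- The pullback of finite `G`-sets. -/
def pullback {A B C : Burnside G} (f : A →[G] C) (g : B →[G] C) : Burnside G where
  carrier := {x : A × B // f x.1 = g x.2}
  action :=
    { smul := fun γ x => ⟨γ • x.1, by
        have := x.2
        simp only [Prod.smul_fst, Prod.smul_snd, map_smul, this]⟩
      one_smul := fun x => Subtype.ext (one_smul G x.1)
      mul_smul := fun γ δ x => Subtype.ext (mul_smul γ δ x.1) }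

/-- Composition of spans, by pullback. -/
def Span.comp {S T U : Burnside G} (a : Span S T) (b : Span T U) : Span S U where
  apex := pullback a.snd b.fst
  fst := ⟨fun x => a.fst x.1.1, fun γ x => a.fst.map_smul γ x.1.1⟩
  snd := ⟨fun x => b.snd x.1.2, fun γ x => b.snd.map_smul γ x.1.2⟩

theorem Span.comp_rel {S T U : Burnside G} {a a' : Span S T} {b b' : Span T U}
    (h : a ≈ a') (h' : b ≈ b') : a.comp b ≈ a'.comp b' := by
  obtain ⟨e, he, h1, h2⟩ := h
  obtain ⟨e', he', h1', h2'⟩ := h'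
  refine ⟨⟨fun x => ⟨(e x.1.1, e' x.1.2), (h2 _).trans (x.2.trans (h1' _).symm)⟩,
    fun γ x => Subtype.ext (Prod.ext (e.map_smul γ x.1.1) (e'.map_smul γ x.1.2))⟩,
    ⟨?_, ?_⟩, fun x => h1 _, fun x => h2' _⟩
  · rintro ⟨⟨x, y⟩, h⟩ ⟨⟨x', y'⟩, h'⟩ hxy
    have := congrArg Subtype.val hxy
    exact Subtype.ext (Prod.ext (he.1 (congrArg Prod.fst this)) (he'.1 (congrArg Prod.snd this)))
  · rintro ⟨⟨x, y⟩, h⟩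
    obtain ⟨x, rfl⟩ := he.2 x
    obtain ⟨y, rfl⟩ := he'.2 y
    exact ⟨⟨(x, y), (h2 x).symm.trans (h.trans (h1' y))⟩, rfl⟩

/-- The Burnside category: finite `G`-sets and isomorphism classes of spans. -/
instance : Category.{1} (Burnside G) where
  Hom S T := Quotient (Span.setoid S T)
  id S := Quotient.mk _ ⟨S, MulActionHom.id G, MulActionHom.id G⟩
  comp f g := Quotient.map₂ Span.comp (fun _ _ h _ _ h' => Span.comp_rel h h') f g
  id_comp := by
    rintro S T ⟨a⟩
    refine Quotient.sound ⟨⟨fun x => x.1.2, fun _ _ => rfl⟩, ⟨?_, ?_⟩, ?_, fun _ => rfl⟩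
    · rintro ⟨⟨x, y⟩, h⟩ ⟨⟨x', y'⟩, h'⟩ hxy
      change x = a.fst y at h; change x' = a.fst y' at h'; change y = y' at hxy
      subst h h' hxy; rfl
    · exact fun y => ⟨⟨(a.fst y, y), rfl⟩, rfl⟩
    · exact fun x => x.2.symm
  comp_id := by
    rintro S T ⟨a⟩
    refine Quotient.sound ⟨⟨fun x => x.1.1, fun _ _ => rfl⟩, ⟨?_, ?_⟩, fun _ => rfl, ?_⟩
    · rintro ⟨⟨x, y⟩, h⟩ ⟨⟨x', y'⟩, h'⟩ hxy
      change a.snd x = y at h; change a.snd x' = y' at h'; change x = x' at hxy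
      subst h h' hxy; rfl
    · exact fun y => ⟨⟨(y, a.snd y), rfl⟩, rfl⟩
    · exact fun x => x.2
  assoc := by
    rintro S T U V ⟨a⟩ ⟨b⟩ ⟨c⟩
    refine Quotient.sound ⟨⟨fun x => ⟨(x.1.1.1.1, ⟨(x.1.1.1.2, x.1.2), x.2⟩), x.1.1.2⟩,
      fun _ _ => rfl⟩, ⟨?_, ?_⟩, fun _ => rfl, fun _ => rfl⟩
    · rintro ⟨⟨⟨⟨x, y⟩, h⟩, z⟩, k⟩ ⟨⟨⟨⟨x', y'⟩, h'⟩, z'⟩, k'⟩ e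
      have e1 := congrArg (fun t => t.1.1) e
      have e2 := congrArg (fun t => t.1.2.1.1) e
      have e3 := congrArg (fun t => t.1.2.1.2) e
      change x = x' at e1; change y = y' at e2; change z = z' at e3
      subst e1 e2 e3; rfl
    · rintro ⟨⟨x, ⟨⟨y, z⟩, k⟩⟩, h⟩
      exact ⟨⟨(⟨(x, y), h⟩, z), k⟩, rfl⟩

/-- The morphism of the Burnside category represented by a span. -/
def Span.hom {S T : Burnside G} (a : Span S T) : S ⟶ T := Quotient.mk _ a

theorem exists_span {S T : Burnside G} (f : S ⟶ T) : ∃ a : Span S T, f = a.hom :=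
  (Quotient.exists_rep f).imp fun _ h => h.symm

theorem hom_comp {S T U : Burnside G} (a : Span S T) (b : Span T U) :
    a.hom ≫ b.hom = (a.comp b).hom := rfl

theorem hom_eq {S T : Burnside G} {a b : Span S T} (e : a.apex →[G] b.apex)
    (he : Function.Bijective e) (h1 : ∀ x, b.fst (e x) = a.fst x)
    (h2 : ∀ x, b.snd (e x) = a.snd x) : a.hom = b.hom :=
  Quotient.sound ⟨e, he, h1, h2⟩

/-- The covariant morphism (transfer) of an equivariant map. -/
def tr {S T : Burnside G} (f : S →[G] T) : S ⟶ T := Span.hom ⟨S, MulActionHom.id G, f⟩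

/-- The contravariant morphism (restriction) of an equivariant map. -/
def res {S T : Burnside G} (f : S →[G] T) : T ⟶ S := Span.hom ⟨S, f, MulActionHom.id G⟩

theorem tr_comp {S T U : Burnside G} (f : S →[G] T) (g : T →[G] U) :
    tr f ≫ tr g = tr (g.comp f) := by
  refine hom_eq (a := Span.comp _ _) ⟨fun x => x.1.1, fun _ _ => rfl⟩ ⟨?_, ?_⟩ (fun _ => rfl) ?_
  · rintro ⟨⟨x, y⟩, h⟩ ⟨⟨x', y'⟩, h'⟩ hxy
    change f x = y at h; change f x' = y' at h'; change x = x' at hxy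
    subst h h' hxy; rfl
  · exact fun y => ⟨⟨(y, f y), rfl⟩, rfl⟩
  · exact fun x => congrArg g x.2

theorem res_comp {S T U : Burnside G} (f : S →[G] T) (g : T →[G] U) :
    res g ≫ res f = res (g.comp f) := by
  refine hom_eq (a := Span.comp _ _) ⟨fun x => x.1.2, fun _ _ => rfl⟩ ⟨?_, ?_⟩ ?_ (fun _ => rfl)
  · rintro ⟨⟨x, y⟩, h⟩ ⟨⟨x', y'⟩, h'⟩ hxy
    change x = f y at h; change x' = f y' at h'; change y = y' at hxy
    subst h h' hxy; rfl
  · exact fun y => ⟨⟨(f y, y), rfl⟩, rfl⟩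
  · exact fun x => congrArg g x.2.symm

theorem res_tr {S T : Burnside G} (f : S →[G] T) (hf : Function.Bijective f) :
    res f ≫ tr f = 𝟙 T := by
  refine hom_eq (a := Span.comp _ _) ⟨fun x => f x.1.1, fun γ x => f.map_smul γ x.1.1⟩
    ⟨?_, ?_⟩ (fun _ => rfl) (fun x => congrArg f x.2)
  · rintro ⟨⟨x, y⟩, h⟩ ⟨⟨x', y'⟩, h'⟩ hxy
    change x = y at h; change x' = y' at h'; have := hf.1 hxy; change x = x' at this
    subst h h' this; rfl
  · intro y
    obtain ⟨x, rfl⟩ := hf.2 y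
    exact ⟨⟨(x, x), rfl⟩, rfl⟩

theorem tr_res {S T : Burnside G} (f : S →[G] T) (hf : Function.Injective f) :
    tr f ≫ res f = 𝟙 S := by
  refine hom_eq (a := Span.comp _ _) ⟨fun x => x.1.1, fun _ _ => rfl⟩
    ⟨?_, ?_⟩ (fun _ => rfl) (fun x => hf x.2)
  · rintro ⟨⟨x, y⟩, h⟩ ⟨⟨x', y'⟩, h'⟩ hxy
    have h := hf h; have h' := hf h'; change x = y at h; change x' = y' at h'
    change x = x' at hxy
    subst h h' hxy; rfl
  · exact fun y => ⟨⟨(y, y), rfl⟩, rfl⟩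

/-- Naturality square for a family of equivariant bijections. -/
theorem tr_comm {S T S' T' : Burnside G} (a : Span S T) (b : Span S' T') (s : S →[G] S')
    (t : T →[G] T') (e : a.apex →[G] b.apex) (hs : Function.Bijective s)
    (he : Function.Bijective e) (h1 : ∀ x, b.fst (e x) = s (a.fst x))
    (h2 : ∀ x, b.snd (e x) = t (a.snd x)) : a.hom ≫ tr t = tr s ≫ b.hom := by
  refine hom_eq (a := a.comp ⟨T, MulActionHom.id G, t⟩) (b := Span.comp ⟨S, MulActionHom.id G, s⟩ b)
    ⟨fun x => ⟨(a.fst x.1.1, e x.1.1), (h1 _).symm⟩, fun γ x => Subtype.ext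
      (Prod.ext (a.fst.map_smul γ x.1.1) (e.map_smul γ x.1.1))⟩ ⟨?_, ?_⟩ (fun _ => rfl) ?_
  · rintro ⟨⟨x, y⟩, h⟩ ⟨⟨x', y'⟩, h'⟩ hxy
    have e2 : e x = e x' := congrArg (fun t => t.1.2) hxy
    have := he.1 e2
    change a.snd x = y at h; change a.snd x' = y' at h'
    subst h h' this; rfl
  · rintro ⟨⟨x, y⟩, h⟩
    obtain ⟨y, rfl⟩ := he.2 y
    have : x = a.fst y := hs.1 (h.trans (h1 y))
    subst this
    exact ⟨⟨(y, a.snd y), rfl⟩, rfl⟩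
  · exact fun x => (h2 _).trans (congrArg t x.2)

/-- The sum of two morphisms of the Burnside category: disjoint union of spans. -/
def Span.add {S T : Burnside G} (a b : Span S T) : Span S T where
  apex := { carrier := a.apex ⊕ b.apex }
  fst := ⟨Sum.elim a.fst b.fst, by rintro γ (x | x) <;> exact map_smul _ γ x⟩
  snd := ⟨Sum.elim a.snd b.snd, by rintro γ (x | x) <;> exact map_smul _ γ x⟩

instance {S T : Burnside G} : Add (S ⟶ T) :=
  ⟨Quotient.map₂ Span.add (by
    rintro a a' ⟨e, he, h1, h2⟩ b b' ⟨e', he', h1', h2'⟩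
    refine ⟨⟨Sum.map e e', ?_⟩, he.sumMap he', ?_, ?_⟩
    · rintro γ (x | x)
      · exact congrArg Sum.inl (e.map_smul γ x)
      · exact congrArg Sum.inr (e'.map_smul γ x)
    · rintro (x | x); exacts [h1 x, h1' x]
    · rintro (x | x); exacts [h2 x, h2' x])⟩

theorem hom_add {S T : Burnside G} (a b : Span S T) : a.hom + b.hom = (a.add b).hom := rfl

theorem add_comp {S T U : Burnside G} (f f' : S ⟶ T) (g : T ⟶ U) :
    (f + f') ≫ g = f ≫ g + f' ≫ g := by
  obtain ⟨a, rfl⟩ := exists_span f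
  obtain ⟨a', rfl⟩ := exists_span f'
  obtain ⟨b, rfl⟩ := exists_span g
  refine hom_eq (a := (a.add a').comp b) (b := (a.comp b).add (a'.comp b))
    ⟨fun x => match x with
      | ⟨(Sum.inl x, y), h⟩ => Sum.inl ⟨(x, y), h⟩
      | ⟨(Sum.inr x, y), h⟩ => Sum.inr ⟨(x, y), h⟩, ?_⟩ ⟨?_, ?_⟩ ?_ ?_
  · rintro γ ⟨⟨x | x, y⟩, h⟩ <;> rfl
  · rintro ⟨⟨x | x, y⟩, h⟩ ⟨⟨x' | x', y'⟩, h'⟩ hxy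
    · have := Sum.inl_injective hxy
      have e1 := congrArg (fun t => t.1.1) this
      have e2 := congrArg (fun t => t.1.2) this
      change x = x' at e1; change y = y' at e2; subst e1 e2; rfl
    · exact absurd hxy Sum.inl_ne_inr
    · exact absurd hxy Sum.inr_ne_inl
    · have := Sum.inr_injective hxy
      have e1 := congrArg (fun t => t.1.1) this
      have e2 := congrArg (fun t => t.1.2) this
      change x = x' at e1; change y = y' at e2; subst e1 e2; rfl
  · rintro (⟨⟨x, y⟩, h⟩ | ⟨⟨x, y⟩, h⟩)
    · exact ⟨⟨(Sum.inl x, y), h⟩, rfl⟩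
    · exact ⟨⟨(Sum.inr x, y), h⟩, rfl⟩
  · rintro ⟨⟨x | x, y⟩, h⟩ <;> rfl
  · rintro ⟨⟨x | x, y⟩, h⟩ <;> rfl

/-- The one-point `G`-set `G/G`. -/
def pt (G : Type) [Group G] : Burnside G where
  carrier := Unit
  action := { smul := fun _ x => x, one_smul := fun _ => rfl, mul_smul := fun _ _ _ => rfl }

/-- Finite Cartesian products of finite `G`-sets. -/
def pi {I : Type} [Finite I] (S : I → Burnside G) : Burnside G where
  carrier := ∀ i, S i

def Span.pi {I : Type} [Finite I] {S T : I → Burnside G} (a : ∀ i, Span (S i) (T i)) :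
    Span (pi S) (pi T) where
  apex := Burnside.pi fun i => (a i).apex
  fst := ⟨fun x i => (a i).fst (x i), fun γ x => funext fun i => (a i).fst.map_smul γ (x i)⟩
  snd := ⟨fun x i => (a i).snd (x i), fun γ x => funext fun i => (a i).snd.map_smul γ (x i)⟩

/-- The product of equivariant maps. -/
def piHom {I : Type} [Finite I] {S T : I → Burnside G} (f : ∀ i, S i →[G] T i) :
    pi S →[G] pi T :=
  ⟨fun x i => f i (x i), fun γ x => funext fun i => (f i).map_smul γ (x i)⟩

theorem bij_pi {I : Type} {A B : I → Type} (f : ∀ i, A i → B i)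
    (hf : ∀ i, Function.Bijective (f i)) :
    Function.Bijective fun (x : ∀ i, A i) i => f i (x i) :=
  ⟨fun _ _ h => funext fun i => (hf i).1 (congrFun h i),
    fun y => ⟨fun i => ((hf i).2 (y i)).choose, funext fun i => ((hf i).2 (y i)).choose_spec⟩⟩

/-- The product of morphisms of the Burnside category. -/
def piMap {I : Type} [Finite I] {S T : I → Burnside G} (f : ∀ i, S i ⟶ T i) : pi S ⟶ pi T :=
  (Span.pi fun i => (exists_span (f i)).choose).hom

theorem piMap_hom {I : Type} [Finite I] {S T : I → Burnside G} (a : ∀ i, Span (S i) (T i)) :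
    piMap (fun i => (a i).hom) = (Span.pi a).hom := by
  have h : ∀ i, (exists_span (a i).hom).choose ≈ a i := fun i =>
    Quotient.exact (exists_span (a i).hom).choose_spec.symm
  choose e he h1 h2 using h
  exact hom_eq (a := Span.pi _) (b := Span.pi a) (piHom e) (bij_pi _ he)
    (fun x => funext fun i => h1 i (x i)) (fun x => funext fun i => h2 i (x i))

theorem exists_spans {I : Type} {S T : I → Burnside G} (f : ∀ i, S i ⟶ T i) :
    ∃ a : ∀ i, Span (S i) (T i), f = fun i => (a i).hom := by
  choose a ha using fun i => exists_span (f i)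
  exact ⟨a, funext ha⟩

theorem piMap_tr {I : Type} [Finite I] {S T : I → Burnside G} (f : ∀ i, S i →[G] T i) :
    piMap (fun i => tr (f i)) = tr (piHom f) := piMap_hom _

theorem piMap_res {I : Type} [Finite I] {S T : I → Burnside G} (f : ∀ i, S i →[G] T i) :
    piMap (fun i => res (f i)) = res (piHom f) := piMap_hom _

theorem piMap_id {I : Type} [Finite I] (S : I → Burnside G) :
    piMap (fun i => 𝟙 (S i)) = 𝟙 (pi S) := piMap_hom _

theorem piMap_comp {I : Type} [Finite I] {S T U : I → Burnside G} (f : ∀ i, S i ⟶ T i)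
    (g : ∀ i, T i ⟶ U i) : piMap (fun i => f i ≫ g i) = piMap f ≫ piMap g := by
  obtain ⟨a, rfl⟩ := exists_spans f
  obtain ⟨b, rfl⟩ := exists_spans g
  simp only [hom_comp, piMap_hom]
  refine hom_eq (a := Span.pi _) (b := Span.comp _ _)
    ⟨fun x => ⟨(fun i => (x i).1.1, fun i => (x i).1.2), funext fun i => (x i).2⟩,
      fun _ _ => rfl⟩ ⟨?_, ?_⟩ (fun _ => rfl) (fun _ => rfl)
  · intro x y h
    funext i
    have h1 := congrFun (congrArg (fun t => t.1.1) h) i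
    have h2 := congrFun (congrArg (fun t => t.1.2) h) i
    exact Subtype.ext (Prod.ext h1 h2)
  · rintro ⟨⟨x, y⟩, h⟩
    exact ⟨fun i => ⟨(x i, y i), congrFun h i⟩, rfl⟩

/-- The `I`-fold Cartesian product functor on Burnside categories. -/
def piFunctor (G : Type) [Group G] (I : Type) [Finite I] : (I → Burnside G) ⥤ Burnside G where
  obj S := pi S
  map f := piMap f
  map_id S := piMap_id S
  map_comp f g := piMap_comp f g

/-- Coinduction from the trivial group: `F(G, T)` with `(g f)(g') = f(g' g)`. -/
def coindObj (G : Type) [Group G] [Finite G] (T : Burnside Unit) : Burnside G where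
  carrier := G → T
  action :=
    { smul := fun γ f x => f (x * γ)
      one_smul := fun f => funext fun x => congrArg f (mul_one x)
      mul_smul := fun γ δ f => funext fun x => congrArg f (mul_assoc x γ δ).symm }

def coindHom (G : Type) [Group G] [Finite G] {S T : Burnside Unit} (f : Map S T) :
    coindObj G S →[G] coindObj G T :=
  ⟨fun x γ => f (x γ), fun _ _ => rfl⟩

def Span.coind (G : Type) [Group G] [Finite G] {S T : Burnside Unit} (a : Span S T) :
    Span (coindObj G S) (coindObj G T) where
  apex := coindObj G a.apex
  fst := coindHom G a.fst
  snd := coindHom G a.snd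

/-- The coinduction functor `F(G, -)` on Burnside categories. -/
def coind (G : Type) [Group G] [Finite G] : Burnside Unit ⥤ Burnside G where
  obj T := coindObj G T
  map f := Quotient.map (Span.coind G) (by
    rintro a b ⟨e, he, h1, h2⟩
    exact ⟨coindHom G e, bij_pi _ fun _ => he, fun x => funext fun γ => h1 (x γ),
      fun x => funext fun γ => h2 (x γ)⟩) f
  map_id _ := rfl
  map_comp f g := by
    obtain ⟨a, rfl⟩ := exists_span f
    obtain ⟨b, rfl⟩ := exists_span g
    refine hom_eq (a := Span.coind G (a.comp b)) (b := (Span.coind G a).comp (Span.coind G b))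
      ⟨fun x => ⟨(fun i => (x i).1.1, fun i => (x i).1.2),
        funext fun i => (x i).2⟩, fun _ _ => rfl⟩ ⟨?_, ?_⟩ (fun _ => rfl) (fun _ => rfl)
    · intro x y h
      funext i
      have h1 := congrFun (congrArg (fun t => t.1.1) h) i
      have h2 := congrFun (congrArg (fun t => t.1.2) h) i
      exact Subtype.ext (Prod.ext h1 h2)
    · rintro ⟨⟨x, y⟩, h⟩
      exact ⟨fun i => ⟨(x i, y i), congrFun h i⟩, rfl⟩

theorem coind_hom (G : Type) [Group G] [Finite G] {S T : Burnside Unit} (a : Span S T) :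
    (coind G).map a.hom =
      Span.hom (S := (coind G).obj S) (T := (coind G).obj T) (Span.coind G a) := rfl

theorem coind_tr (G : Type) [Group G] [Finite G] {S T : Burnside Unit} (f : Map S T) :
    (coind G).map (tr f) =
      tr (S := (coind G).obj S) (T := (coind G).obj T) (coindHom G f) := rfl

section Fixed

variable {Q : Type} [Group Q] (q : G →* Q) (hq : Function.Surjective q)

/-- The `ker q`-fixed points of a finite `G`-set, a finite set with an action of
`Q ≅ G / ker q`. -/
def fixObj (S : Burnside G) : Burnside Q where
  carrier := {x : S // ∀ n : G, q n = 1 → n • x = x}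
  action :=
    { smul := fun γ x => ⟨(hq γ).choose • x.1, fun n hn => by
        have h := x.2 ((hq γ).choose⁻¹ * n * (hq γ).choose) (by simp [hn])
        rw [mul_assoc, mul_smul, inv_smul_eq_iff, mul_smul] at h
        exact h⟩
      one_smul := fun x => Subtype.ext (x.2 _ (hq 1).choose_spec)
      mul_smul := fun γ δ x => Subtype.ext (by
        have h := x.2 (((hq γ).choose * (hq δ).choose)⁻¹ * (hq (γ * δ)).choose) (by
          rw [map_mul, map_inv, map_mul, (hq γ).choose_spec, (hq δ).choose_spec,
            (hq (γ * δ)).choose_spec, inv_mul_cancel])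
        rw [mul_smul, inv_smul_eq_iff, mul_smul] at h
        exact h) }

theorem fix_smul (S : Burnside G) (γ : G) (x : fixObj q hq S) : (q γ • x).1 = γ • x.1 := by
  have h := x.2 (γ⁻¹ * (hq (q γ)).choose) (by
    rw [map_mul, map_inv, (hq (q γ)).choose_spec, inv_mul_cancel])
  rw [mul_smul, inv_smul_eq_iff] at h
  exact h

def fixHom {S T : Burnside G} (f : S →[G] T) : fixObj q hq S →[Q] fixObj q hq T :=
  ⟨fun x => ⟨f x.1, fun n hn => (f.map_smul n x.1).symm.trans (congrArg f (x.2 n hn))⟩,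
    fun γ x => by
    obtain ⟨γ, rfl⟩ := hq γ
    refine Subtype.ext (((congrArg f (fix_smul q hq S γ x)).trans (f.map_smul γ x.1)).trans ?_)
    exact (fix_smul q hq T γ ⟨f x.1, _⟩).symm⟩

def Span.fix {S T : Burnside G} (a : Span S T) : Span (fixObj q hq S) (fixObj q hq T) where
  apex := fixObj q hq a.apex
  fst := fixHom q hq a.fst
  snd := fixHom q hq a.snd

theorem fixHom_bij {S T : Burnside G} (f : S →[G] T) (hf : Function.Bijective f) :
    Function.Bijective (fixHom q hq f) := by
  refine ⟨fun x y h => Subtype.ext (hf.1 (congrArg Subtype.val h)), fun y => ?_⟩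
  obtain ⟨x, hx⟩ := hf.2 y.1
  exact ⟨⟨x, fun n hn => hf.1 (by rw [map_smul, hx, y.2 n hn])⟩, Subtype.ext hx⟩

/-- The fixed point functor `X ↦ X^N`, `N = ker q`, on Burnside categories. -/
def fix : Burnside G ⥤ Burnside Q where
  obj S := fixObj q hq S
  map f := Quotient.map (Span.fix q hq) (by
    rintro a b ⟨e, he, h1, h2⟩
    exact ⟨fixHom q hq e, fixHom_bij q hq e he, fun x => Subtype.ext (h1 x.1),
      fun x => Subtype.ext (h2 x.1)⟩) f
  map_id _ := rfl
  map_comp f g := by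
    obtain ⟨a, rfl⟩ := exists_span f
    obtain ⟨b, rfl⟩ := exists_span g
    refine hom_eq (a := Span.fix q hq (a.comp b)) (b := (Span.fix q hq a).comp (Span.fix q hq b))
      ⟨fun x => ⟨(⟨x.1.1.1, fun n hn => congrArg (fun t => t.1.1) (x.2 n hn)⟩,
        ⟨x.1.1.2, fun n hn => congrArg (fun t => t.1.2) (x.2 n hn)⟩), Subtype.ext x.1.2⟩,
        fun _ _ => rfl⟩ ⟨?_, ?_⟩ (fun _ => rfl) (fun _ => rfl)
    · intro x y h
      have h1 := congrArg (fun t => t.1.1.1) h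
      have h2 := congrArg (fun t => t.1.2.1) h
      exact Subtype.ext (Subtype.ext (Prod.ext h1 h2))
    · rintro ⟨⟨⟨x, hx⟩, ⟨y, hy⟩⟩, h⟩
      exact ⟨⟨⟨(x, y), congrArg Subtype.val h⟩, fun n hn =>
        Subtype.ext (Prod.ext (hx n hn) (hy n hn))⟩, rfl⟩

theorem fix_hom {S T : Burnside G} (a : Span S T) :
    (fix q hq).map a.hom =
      Span.hom (S := (fix q hq).obj S) (T := (fix q hq).obj T) (Span.fix q hq a) := rfl

theorem fix_tr {S T : Burnside G} (f : Map S T) :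
    (fix q hq).map (tr f) =
      tr (S := (fix q hq).obj S) (T := (fix q hq).obj T) (fixHom q hq f) := rfl

theorem fix_res {S T : Burnside G} (f : Map S T) :
    (fix q hq).map (res f) =
      res (S := (fix q hq).obj S) (T := (fix q hq).obj T) (fixHom q hq f) := rfl

theorem fix_add {S T : Burnside G} (f g : S ⟶ T) :
    (fix q hq).map (f + g) = (fix q hq).map f + (fix q hq).map g := by
  obtain ⟨a, rfl⟩ := exists_span f
  obtain ⟨b, rfl⟩ := exists_span g
  refine hom_eq (a := Span.fix q hq (a.add b)) (b := (Span.fix q hq a).add (Span.fix q hq b))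
    ⟨fun x => match x with
      | ⟨Sum.inl x, h⟩ => Sum.inl ⟨x, fun n hn => Sum.inl_injective (h n hn)⟩
      | ⟨Sum.inr x, h⟩ => Sum.inr ⟨x, fun n hn => Sum.inr_injective (h n hn)⟩, ?_⟩
    ⟨?_, ?_⟩ ?_ ?_
  · rintro γ ⟨x | x, h⟩ <;> rfl
  · rintro ⟨x | x, h⟩ ⟨y | y, h'⟩ hxy
    · have := congrArg Subtype.val (Sum.inl_injective hxy)
      change x = y at this; subst this; rfl
    · exact absurd hxy Sum.inl_ne_inr
    · exact absurd hxy Sum.inr_ne_inl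
    · have := congrArg Subtype.val (Sum.inr_injective hxy)
      change x = y at this; subst this; rfl
  · rintro (⟨x, h⟩ | ⟨x, h⟩)
    · exact ⟨⟨Sum.inl x, fun n hn => congrArg Sum.inl (h n hn)⟩, rfl⟩
    · exact ⟨⟨Sum.inr x, fun n hn => congrArg Sum.inr (h n hn)⟩, rfl⟩
  · rintro ⟨x | x, h⟩ <;> rfl
  · rintro ⟨x | x, h⟩ <;> rfl

end Fixed

end Burnside


section Lan

universe v₁ v₂ u₁ u₂ w

variable {C : Type u₁} [Category.{v₁} C] {D : Type u₂} [Category.{v₂} D]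

/-- Generators of the coend `∫^c D(F c, d) × M c`. -/
structure LanGen (F : C ⥤ D) (M : C ⥤ Type w) (d : D) where
  src : C
  hom : F.obj src ⟶ d
  val : M.obj src

/-- Relations of the coend `∫^c D(F c, d) × M c`. -/
inductive LanRel (F : C ⥤ D) (M : C ⥤ Type w) (d : D) : LanGen F M d → LanGen F M d → Prop
  | glue {c c' : C} (a : c ⟶ c') (f : F.obj c' ⟶ d) (m : M.obj c) :
      LanRel F M d ⟨c', f, M.map a m⟩ ⟨c, F.map a ≫ f, m⟩

/-- The left Kan extension of the set-valued functor `M` along `F`, given by the coend formula. -/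
def lan (F : C ⥤ D) (M : C ⥤ Type w) : D ⥤ Type (max u₁ v₂ w) where
  obj d := Quot (LanRel F M d)
  map g := ↾(Quot.map (fun x => ⟨x.src, x.hom ≫ g, x.val⟩) (by
    rintro _ _ ⟨a, f, m⟩
    simp only [Category.assoc]
    exact LanRel.glue a (f ≫ g) m))
  map_id d := by
    ext x
    induction x using Quot.ind
    exact congrArg (Quot.mk _) (by simp)
  map_comp f g := by
    ext x
    induction x using Quot.ind
    exact congrArg (Quot.mk _) (by simp)

variable {F : C ⥤ D} {M : C ⥤ Type w}

/-- The class of a generator. -/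
def lanMk {d : D} (c : C) (f : F.obj c ⟶ d) (m : M.obj c) : (lan F M).obj d :=
  Quot.mk _ ⟨c, f, m⟩

theorem lanMk_glue {d : D} {c c' : C} (a : c ⟶ c') (f : F.obj c' ⟶ d) (m : M.obj c) :
    (lanMk c' f (M.map a m) : (lan F M).obj d) = lanMk c (F.map a ≫ f) m :=
  Quot.sound (LanRel.glue a f m)

theorem lan_map_mk {d d' : D} (g : d ⟶ d') (c : C) (f : F.obj c ⟶ d) (m : M.obj c) :
    (lan F M).map g (lanMk c f m) = lanMk c (f ≫ g) m := rfl

theorem lan_ind {d : D} {P : (lan F M).obj d → Prop} (h : ∀ c f m, P (lanMk c f m))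
    (x : (lan F M).obj d) : P x := by
  induction x using Quot.ind with | _ x => exact h x.src x.hom x.val

theorem lanRel_refl {d : D} (x : LanGen F M d) : LanRel F M d x x := by
  have h := LanRel.glue (M := M) (𝟙 x.src) x.hom x.val
  simpa using h

/-- The natural transformation out of a left Kan extension determined by a family of maps. -/
def lanDesc {H : D ⥤ Type v} (φ : ∀ c, M.obj c → H.obj (F.obj c))
    (hφ : ∀ {c c' : C} (a : c ⟶ c') (m : M.obj c), φ c' (M.map a m) = H.map (F.map a) (φ c m))
    (d : D) : (lan F M).obj d → H.obj d :=
  Quot.lift (fun x => H.map x.hom (φ x.src x.val)) (by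
    rintro _ _ ⟨a, f, m⟩
    simp [hφ])

theorem lanDesc_mk {H : D ⥤ Type v} (φ : ∀ c, M.obj c → H.obj (F.obj c))
    (hφ : ∀ {c c' : C} (a : c ⟶ c') (m : M.obj c), φ c' (M.map a m) = H.map (F.map a) (φ c m))
    {d : D} (c : C) (f : F.obj c ⟶ d) (m : M.obj c) :
    lanDesc φ hφ d (lanMk c f m) = H.map f (φ c m) := rfl

theorem lanDesc_natural {H : D ⥤ Type v} (φ : ∀ c, M.obj c → H.obj (F.obj c))
    (hφ : ∀ {c c' : C} (a : c ⟶ c') (m : M.obj c), φ c' (M.map a m) = H.map (F.map a) (φ c m))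
    {d d' : D} (g : d ⟶ d') (x : (lan F M).obj d) :
    lanDesc φ hφ d' ((lan F M).map g x) = H.map g (lanDesc φ hφ d x) := by
  induction x using lan_ind with | h c f m =>
  simp [lan_map_mk, lanDesc_mk]

end Lan

open Burnside

/-- The diagonal-type map `∏_i S i → ∏_j ∏_{k : K j} S (e j k)`. -/
def reshape {G : Type} [Group G] {I J : Type} [Finite I] [Finite J] {K : J → Type}
    [∀ j, Finite (K j)] (e : ∀ j, K j → I) (S : I → Burnside G) :
    Map (pi S) (pi fun j => pi fun k => S (e j k)) :=
  ⟨fun x j k => x (e j k), fun _ _ => rfl⟩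

/-- The constant map `X → ∏_{Unit} X`. -/
def unary {G : Type} [Group G] (X : Burnside G) : Map X (pi fun _ : Unit => X) :=
  ⟨fun x _ => x, fun _ _ => rfl⟩

theorem unary_bij {G : Type} [Group G] (X : Burnside G) : Function.Bijective (unary X) :=
  ⟨fun _ _ h => congrFun h (), fun y => ⟨y (), rfl⟩⟩

/-- A commutative Green functor in unbiased form: a functor on the Burnside category with
external products `∏ F(S i) → F(∏ S i)` for all finite families which are natural, unital and
associative under all regroupings (in particular symmetric); equivalently, a lax symmetric monoidal
functor, that is, a commutative monoid for the box product. -/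
structure CommGreen (G : Type) [Group G] : Type (max 2 (u + 1)) where
  F : Burnside G ⥤ Type u
  ext : ∀ {I : Type} [Finite I] (S : I → Burnside G), (∀ i, F.obj (S i)) → F.obj (pi S)
  ext_map : ∀ {I : Type} [Finite I] {S T : I → Burnside G} (f : ∀ i, S i ⟶ T i)
    (m : ∀ i, F.obj (S i)), ext T (fun i => F.map (f i) (m i)) = F.map (piMap f) (ext S m)
  ext_unary : ∀ (X : Burnside G) (m : F.obj X),
    ext (fun _ : Unit => X) (fun _ => m) = F.map (tr (unary X)) m
  ext_ext : ∀ {I J : Type} [Finite I] [Finite J] {K : J → Type} [∀ j, Finite (K j)]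
    (e : ∀ j, K j → I), (Function.Bijective fun x : Σ j, K j => e x.1 x.2) →
    ∀ (S : I → Burnside G) (m : ∀ i, F.obj (S i)),
    ext (fun j => pi fun k => S (e j k)) (fun j => ext (fun k => S (e j k)) fun k => m (e j k)) =
      F.map (tr (reshape e S)) (ext S m)

theorem reshape_bij {G : Type} [Group G] {I J : Type} [Finite I] [Finite J] {K : J → Type}
    [∀ j, Finite (K j)] (e : ∀ j, K j → I) (he : Function.Bijective fun x : Σ j, K j => e x.1 x.2)
    (S : I → Burnside G) : Function.Bijective (reshape e S) := by
  refine ⟨fun x y h => funext fun i => ?_, fun y => ?_⟩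
  · obtain ⟨⟨j, k⟩, rfl⟩ := he.2 i
    exact congrFun (congrFun h j) k
  · obtain ⟨g, hg⟩ : ∃ g : ∀ i, S i, ∀ x : Σ j, K j, g (e x.1 x.2) = y x.1 x.2 := by
      let E := Equiv.ofBijective _ he
      refine ⟨fun i => cast (congrArg (fun i => (S i : Type)) (E.apply_symm_apply i))
        (y (E.symm i).1 (E.symm i).2), fun x => ?_⟩
      have key : ∀ (z : Σ j, K j) (h : z = x) (h' : ((S (e z.1 z.2) : Burnside G) : Type) =
          (S (e x.1 x.2) : Type)), cast h' (y z.1 z.2) = y x.1 x.2 := by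
        rintro z rfl h'; rfl
      exact key _ (E.symm_apply_apply x) _
    exact ⟨g, funext fun j => funext fun k => hg ⟨j, k⟩⟩

/-- Naturality of `unary`. -/
theorem comp_unary {G : Type} [Group G] {X Y : Burnside G} (f : X ⟶ Y) :
    f ≫ tr (unary Y) = tr (unary X) ≫ piMap (fun _ : Unit => f) := by
  obtain ⟨a, rfl⟩ := exists_span f
  rw [piMap_hom]
  exact tr_comm a (Span.pi fun _ : Unit => a) _ _ (unary a.apex) (unary_bij _) (unary_bij _)
    (fun _ => rfl) (fun _ => rfl)

/-- Naturality of `reshape`. -/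
theorem piMap_reshape {G : Type} [Group G] {I J : Type} [Finite I] [Finite J] {K : J → Type}
    [∀ j, Finite (K j)] (e : ∀ j, K j → I) (he : Function.Bijective fun x : Σ j, K j => e x.1 x.2)
    {S T : I → Burnside G} (f : ∀ i, S i ⟶ T i) :
    piMap f ≫ tr (reshape e T) =
      tr (reshape e S) ≫ piMap (fun j => piMap fun k => f (e j k)) := by
  obtain ⟨a, rfl⟩ := exists_spans f
  simp only [piMap_hom]
  exact tr_comm (Span.pi a) (Span.pi fun j => Span.pi fun k => a (e j k)) _ _
    (reshape e fun i => (a i).apex) (reshape_bij e he _) (reshape_bij e he _)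
    (fun _ => rfl) (fun _ => rfl)

section Ring

/-- A commutative ring as a commutative Green functor for the trivial group: `T ↦ A^T`, with
restriction given by pullback, transfer by summation over fibres. -/
def ringMackey (A : Type) [CommRing A] : Burnside Unit ⥤ Type where
  obj T := T → A
  map {S T} f := ↾(fun (x : S → A) => Quotient.lift (fun (a : Span S T) (t : T) =>
    ∑ᶠ u : {u : a.apex // a.snd u = t}, x (a.fst u)) (by
      rintro a b ⟨e, he, h1, h2⟩
      funext t
      refine finsum_eq_of_bijective (fun u => ⟨e u.1, (h2 _).trans u.2⟩) ⟨?_, ?_⟩ ?_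
      · exact fun u v h => Subtype.ext (he.1 (congrArg Subtype.val h))
      · rintro ⟨v, hv⟩
        obtain ⟨u, rfl⟩ := he.2 v
        exact ⟨⟨u, (h2 u).symm.trans hv⟩, rfl⟩
      · exact fun u => congrArg x (h1 _).symm) f)
  map_id S := by
    ext x t
    let i : Unique {u : S // u = t} :=
      { default := ⟨t, rfl⟩, uniq := fun u => Subtype.ext u.2 }
    exact finsum_unique fun u : {u : S // u = t} => x u
  map_comp {S T U} f g := by
    obtain ⟨a, rfl⟩ := exists_span f
    obtain ⟨b, rfl⟩ := exists_span g
    ext x t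
    change ∑ᶠ w : {w : (a.comp b).apex // (a.comp b).snd w = t}, x ((a.comp b).fst w) =
      ∑ᶠ v : {v : b.apex // b.snd v = t}, ∑ᶠ u : {u : a.apex // a.snd u = b.fst v}, x (a.fst u)
    let := Fintype.ofFinite {w : (a.comp b).apex // (a.comp b).snd w = t}
    let := Fintype.ofFinite {v : b.apex // b.snd v = t}
    let : ∀ v : {v : b.apex // b.snd v = t}, Fintype {u : a.apex // a.snd u = b.fst v} :=
      fun v => Fintype.ofFinite _
    simp only [finsum_eq_sum_of_fintype]
    rw [← Fintype.sum_sigma']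
    refine Fintype.sum_bijective (fun w => ⟨⟨w.1.1.2, w.2⟩, ⟨w.1.1.1, w.1.2⟩⟩) ⟨?_, ?_⟩ _ _
      (fun _ => rfl)
    · rintro ⟨⟨⟨u, v⟩, h⟩, k⟩ ⟨⟨⟨u', v'⟩, h'⟩, k'⟩ e
      have e1 := congrArg (fun t => t.1.1) e
      have e2 := congrArg (fun t => t.2.1) e
      change v = v' at e1; change u = u' at e2; subst e1 e2; rfl
    · rintro ⟨⟨v, hv⟩, ⟨u, hu⟩⟩
      exact ⟨⟨⟨(u, v), hu⟩, hv⟩, rfl⟩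

theorem ringMackey_hom (A : Type) [CommRing A] {S T : Burnside Unit} (a : Span S T) (x : S → A)
    (t : T) : (ringMackey A).map a.hom x t = ∑ᶠ u : {u : a.apex // a.snd u = t}, x (a.fst u) :=
  rfl

theorem ringMackey_tr (A : Type) [CommRing A] {S T : Burnside Unit} (f : Map S T)
    (hf : Function.Injective f) (x : S → A) (s : S) : (ringMackey A).map (tr f) x (f s) = x s := by
  let i : Unique {u : S // f u = f s} :=
    { default := ⟨s, rfl⟩, uniq := fun u => Subtype.ext (hf u.2) }
  exact finsum_unique _

/-- The commutative Green functor for the trivial group defined by a commutative ring. -/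
def ringGreen (A : Type) [CommRing A] : CommGreen.{0} Unit where
  F := ringMackey A
  ext S m := fun x => ∏ᶠ i, m i (x i)
  ext_map {I _} S T f m := by
    obtain ⟨a, rfl⟩ := exists_spans f
    rw [piMap_hom]
    funext t
    change ∏ᶠ i, ∑ᶠ u : {u : (a i).apex // (a i).snd u = t i}, m i ((a i).fst u) =
      ∑ᶠ u : {u : (Span.pi a).apex // (Span.pi a).snd u = t}, ∏ᶠ i, m i ((a i).fst (u.1 i))
    let := Fintype.ofFinite I
    classical
    let : ∀ i, Fintype {u : (a i).apex // (a i).snd u = t i} := fun i => Fintype.ofFinite _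
    let : Fintype {u : (Span.pi a).apex // (Span.pi a).snd u = t} := Fintype.ofFinite _
    simp only [finsum_eq_sum_of_fintype, finprod_eq_prod_of_fintype]
    rw [Fintype.prod_sum]
    symm
    refine Fintype.sum_bijective (fun w i => ⟨w.1 i, congrFun w.2 i⟩) ⟨?_, ?_⟩ _ _ (fun _ => rfl)
    · exact fun w w' h => Subtype.ext (funext fun i => congrArg Subtype.val (congrFun h i))
    · exact fun w => ⟨⟨fun i => (w i).1, funext fun i => (w i).2⟩, rfl⟩
  ext_unary X m := by
    funext x
    obtain ⟨x, rfl⟩ := (unary_bij X).2 x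
    refine Eq.trans ?_ (ringMackey_tr A (unary X) (unary_bij X).1 m x).symm
    exact finprod_unique _
  ext_ext {I J _ _ K _} e he S m := by
    funext x
    obtain ⟨x, rfl⟩ := (reshape_bij e he S).2 x
    refine Eq.trans ?_ (ringMackey_tr A (reshape e S) (reshape_bij e he S).1 _ x).symm
    change ∏ᶠ j, ∏ᶠ k, m (e j k) (x (e j k)) = ∏ᶠ i, m i (x i)
    let := Fintype.ofFinite I
    let := Fintype.ofFinite J
    let : ∀ j, Fintype (K j) := fun j => Fintype.ofFinite _
    simp only [finprod_eq_prod_of_fintype]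
    rw [← Fintype.prod_sigma']
    exact Fintype.prod_bijective _ he _ _ fun _ => rfl

end Ring

section Norm

variable (G : Type) [Group G] [Finite G]

/-- `F(G, ∏ T i) ≅ ∏ F(G, T i)`. -/
def swap {I : Type} [Finite I] (T : I → Burnside Unit) :
    Map ((coind G).obj (pi T)) (pi fun i => (coind G).obj (T i)) :=
  ⟨fun x i γ => x γ i, fun _ _ => rfl⟩

theorem swap_bij {I : Type} [Finite I] (T : I → Burnside Unit) : Function.Bijective (swap G T) :=
  ⟨fun _ _ h => funext fun γ => funext fun i => congrFun (congrFun h i) γ,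
    fun y => ⟨fun γ i => y i γ, rfl⟩⟩

theorem swap_natural {I : Type} [Finite I] {S T : I → Burnside Unit} (f : ∀ i, S i ⟶ T i) :
    (coind G).map (piMap f) ≫ tr (swap G T) =
      tr (swap G S) ≫ piMap (fun i => (coind G).map (f i)) := by
  obtain ⟨a, rfl⟩ := exists_spans f
  simp only [piMap_hom, coind_hom]
  exact (tr_comm (Span.coind G (Span.pi a)) (Span.pi fun i => Span.coind G (a i)) (swap G S)
    (swap G T) (swap G fun i => (a i).apex) (swap_bij G _) (swap_bij G _) (fun _ => rfl)
    (fun _ => rfl)).trans (congrArg (fun t => tr (swap G S) ≫ t)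
      (piMap_hom fun i => Span.coind G (a i)).symm)

variable (R : CommGreen.{u} Unit)

/-- The norm `N_e^G` of a set-valued functor: left Kan extension along coinduction. -/
abbrev normFunctor : Burnside G ⥤ Type (max 1 u) := lan (coind G) R.F

/-- The external product of generators of the norm. -/
def normExtGen {I : Type} [Finite I] {S : I → Burnside G}
    (x : ∀ i, LanGen (coind G) R.F (S i)) : (normFunctor G R).obj (pi S) :=
  lanMk (pi fun i => (x i).src) (tr (swap G _) ≫ piMap fun i => (x i).hom)
    (R.ext _ fun i => (x i).val)

theorem normExtGen_eq {I : Type} [Finite I] {S : I → Burnside G}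
    (x y : ∀ i, LanGen (coind G) R.F (S i)) (h : ∀ i, LanRel (coind G) R.F (S i) (x i) (y i)) :
    normExtGen G R x = normExtGen G R y := by
  have h' : ∀ i, ∃ (c c' : Burnside Unit) (a : c ⟶ c') (f : (coind G).obj c' ⟶ S i)
      (m : R.F.obj c), x i = ⟨c', f, R.F.map a m⟩ ∧ y i = ⟨c, (coind G).map a ≫ f, m⟩ := by
    intro i
    generalize x i = p, y i = q, h i = r
    obtain ⟨a, f, m⟩ := r
    exact ⟨_, _, a, f, m, rfl, rfl⟩
  choose c c' a f m hx hy using h'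
  obtain rfl : x = _ := funext hx
  obtain rfl : y = _ := funext hy
  unfold normExtGen
  dsimp only
  rw [R.ext_map a m, lanMk_glue, ← Category.assoc, swap_natural G a, Category.assoc]
  exact congrArg (fun t => lanMk (pi c) (tr (swap G c) ≫ t) (R.ext c m))
    (piMap_comp (fun i => (coind G).map (a i)) f).symm

theorem quot_pi_lift {I : Type} [Finite I] {X : I → Type u} {r : ∀ i, X i → X i → Prop}
    (hr : ∀ i x, r i x x) {Y : Type v} (E : (∀ i, X i) → Y)
    (hE : ∀ x y, (∀ i, r i (x i) (y i)) → E x = E y) (x y : ∀ i, X i)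
    (h : ∀ i, Quot.mk (r i) (x i) = Quot.mk (r i) (y i)) : E x = E y := by
  classical
  let := Fintype.ofFinite I
  have step : ∀ (i : I) (z : ∀ i, X i) (p q : X i), Quot.mk (r i) p = Quot.mk (r i) q →
      E (Function.update z i p) = E (Function.update z i q) := by
    intro i z p q hpq
    rw [Quot.eq] at hpq
    induction hpq with
    | rel p q hpq =>
      refine hE _ _ fun j => ?_
      by_cases hj : j = i
      · subst hj; simpa using hpq
      · simpa [hj] using hr j _
    | refl => rfl
    | symm _ _ _ ih => exact ih.symm
    | trans _ _ _ _ _ ih ih' => exact ih.trans ih'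
  have key : ∀ s : Finset I, E x = E (s.piecewise y x) := by
    intro s
    induction s using Finset.induction_on with
    | empty => simp
    | insert i s hi ih =>
      rw [ih, Finset.piecewise_insert]
      have := step i (s.piecewise y x) (x i) (y i) (h i)
      rw [← this]
      congr 1
      rw [eq_comm, Function.update_eq_self_iff]
      simp [hi]
  simpa using key Finset.univ

theorem exists_lanMk {C : Type*} [Category C] {D : Type*} [Category D] {F : C ⥤ D}
    {M : C ⥤ Type u} {d : D} (x : (lan F M).obj d) :
    ∃ p : LanGen F M d, x = lanMk p.src p.hom p.val := by
  induction x using lan_ind with | h c f m => exact ⟨⟨c, f, m⟩, rfl⟩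

/-- The external product on the norm: the product of the classes of `f i : F(G, T i) → S i`,
`m i ∈ R(T i)` is the class of `F(G, ∏ T i) ≅ ∏ F(G, T i) → ∏ S i` and the external product of the
`m i`. -/
def normExt {I : Type} [Finite I] (S : I → Burnside G) (m : ∀ i, (normFunctor G R).obj (S i)) :
    (normFunctor G R).obj (pi S) :=
  normExtGen G R fun i => (exists_lanMk (m i)).choose

theorem normExt_mk {I : Type} [Finite I] (S : I → Burnside G) (T : I → Burnside Unit)
    (f : ∀ i, (coind G).obj (T i) ⟶ S i) (m : ∀ i, R.F.obj (T i)) :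
    normExt G R S (fun i => lanMk (T i) (f i) (m i)) =
      lanMk (pi T) (tr (swap G T) ≫ piMap f) (R.ext T m) :=
  quot_pi_lift (r := fun i => LanRel (coind G) R.F (S i)) (fun _ => lanRel_refl) (normExtGen G R)
    (normExtGen_eq G R) _ (fun i => ⟨T i, f i, m i⟩)
    fun i => (exists_lanMk (lanMk (T i) (f i) (m i))).choose_spec.symm

theorem exists_lanMks {C : Type*} [Category C] {D : Type*} [Category D] {F : C ⥤ D}
    {M : C ⥤ Type u} {I : Type} {d : I → D} (x : ∀ i, (lan F M).obj (d i)) :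
    ∃ (c : I → C) (f : ∀ i, F.obj (c i) ⟶ d i) (m : ∀ i, M.obj (c i)),
      x = fun i => lanMk (c i) (f i) (m i) := by
  choose p hp using fun i => exists_lanMk (x i)
  exact ⟨fun i => (p i).src, fun i => (p i).hom, fun i => (p i).val, funext hp⟩

/-- The norm `N_e^G` of a commutative Green functor for the trivial group. -/
def norm : CommGreen.{max 1 u} G where
  F := normFunctor G R
  ext S m := normExt G R S m
  ext_map {I _} S T f m := by
    obtain ⟨c, g, m, rfl⟩ := exists_lanMks m
    simp only [lan_map_mk]
    rw [normExt_mk, normExt_mk, lan_map_mk, piMap_comp, Category.assoc]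
  ext_unary X m := by
    induction m using lan_ind with | h c f m =>
    rw [normExt_mk, lan_map_mk, R.ext_unary, lanMk_glue, coind_tr, comp_unary, ← Category.assoc]
    congr 2
    exact tr_comp (S := (coind G).obj c) (T := (coind G).obj (pi fun _ => c)) _ _
  ext_ext {I J _ _ K _} e he S m := by
    obtain ⟨c, g, m, rfl⟩ := exists_lanMks m
    simp only [normExt_mk]
    rw [R.ext_ext e he, lanMk_glue, lan_map_mk, Category.assoc, piMap_reshape e he, coind_tr]
    have h1 := piMap_comp (fun j => tr (swap G fun k => c (e j k)))
      (fun j => piMap fun k => g (e j k))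
    have h2 := piMap_tr fun j => swap G fun k => c (e j k)
    refine congrArg (fun t => lanMk (pi c) t (R.ext c m)) ?_
    refine (congrArg (fun t => tr (S := (coind G).obj (pi c)) _ ≫ tr (swap G _) ≫ t)
      (h1.trans (congrArg (fun t => t ≫ _) h2))).trans ?_
    simp only [← Category.assoc]
    refine congrArg (fun t => t ≫ _) ?_
    rw [tr_comp]
    refine (congrArg (fun t => t ≫ _) (tr_comp (S := (coind G).obj (pi c)) _ _)).trans ?_
    exact tr_comp (S := (coind G).obj (pi c)) _ _

end Norm

section BoxPower

variable {G : Type} [Group G]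

/-- The functor `(S_i) ↦ ∏ M(S_i)`. -/
def extPower (I : Type) (M : Burnside G ⥤ Type u) : (I → Burnside G) ⥤ Type u where
  obj S := ∀ i, M.obj (S i)
  map f := ↾(fun m i => M.map (f i) (m i))

/-- The `I`-fold box power of `M`: the left Kan extension of `(S_i) ↦ ∏ M(S_i)` along the Cartesian
product of finite `G`-sets. -/
def boxPow (I : Type) [Finite I] (M : Burnside G ⥤ Type u) : Burnside G ⥤ Type (max 1 u) :=
  lan (piFunctor G I) (extPower I M)

variable {I J K : Type} [Finite I] [Finite J] [Finite K]

/-- The class of `s : ∏ S i ⟶ X` and `m i ∈ M (S i)` in the box power. -/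
def boxMk {M : Burnside G ⥤ Type u} {X : Burnside G} (S : I → Burnside G) (s : pi S ⟶ X)
    (m : ∀ i, M.obj (S i)) : (boxPow I M).obj X :=
  lanMk (F := piFunctor G I) (M := extPower I M) S s m

theorem boxMk_glue {M : Burnside G ⥤ Type u} {X : Burnside G} {S T : I → Burnside G}
    (f : ∀ i, S i ⟶ T i) (s : pi T ⟶ X) (m : ∀ i, M.obj (S i)) :
    boxMk T s (fun i => M.map (f i) (m i)) = boxMk S (piMap f ≫ s) m :=
  lanMk_glue (F := piFunctor G I) (M := extPower I M) f s m

theorem box_map_mk {M : Burnside G ⥤ Type u} {X Y : Burnside G} (g : X ⟶ Y)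
    (S : I → Burnside G) (s : pi S ⟶ X) (m : ∀ i, M.obj (S i)) :
    (boxPow I M).map g (boxMk S s m) = boxMk S (s ≫ g) m := rfl

theorem box_ind {M : Burnside G ⥤ Type u} {X : Burnside G} {P : (boxPow I M).obj X → Prop}
    (h : ∀ S s m, P (boxMk S s m)) (x : (boxPow I M).obj X) : P x :=
  lan_ind h x

/-- `∏_{i ∈ φ⁻¹(j)} S i`. -/
abbrev fib (φ : I → J) (S : I → Burnside G) (j : J) : Burnside G := pi fun i : {i // φ i = j} => S i

/-- `∏_i S i ≅ ∏_j ∏_{i ∈ φ⁻¹(j)} S i`. -/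
def unfib (φ : I → J) (S : I → Burnside G) : Map (pi S) (pi (fib φ S)) :=
  reshape (fun j (i : {i // φ i = j}) => i.1) S

theorem sigma_fib_bij {I J : Type} (φ : I → J) :
    Function.Bijective fun x : Σ j, {i // φ i = j} => x.2.1 :=
  ⟨by rintro ⟨j, i, rfl⟩ ⟨j', i', rfl⟩ h; cases h; rfl, fun i => ⟨⟨φ i, i, rfl⟩, rfl⟩⟩

theorem unfib_bij (φ : I → J) (S : I → Burnside G) : Function.Bijective (unfib φ S) :=
  reshape_bij _ (sigma_fib_bij φ) S

/-- Moving an isomorphism across. -/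
theorem res_eq {S T : Burnside G} (f : Map S T) (hf : Function.Bijective f) {X : Burnside G}
    (g : S ⟶ X) (h : T ⟶ X) (e : g = tr f ≫ h) : res f ≫ g = h := by
  rw [e, ← Category.assoc, res_tr f hf, Category.id_comp]

theorem eq_res {S T : Burnside G} (f : Map S T) (hf : Function.Bijective f) {X : Burnside G}
    (g : X ⟶ S) (h : X ⟶ T) (e : g ≫ tr f = h) : h ≫ res f = g := by
  rw [← e, Category.assoc, tr_res f hf.1, Category.comp_id]

theorem unfib_natural (φ : I → J) {S T : I → Burnside G} (f : ∀ i, S i ⟶ T i) :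
    res (unfib φ S) ≫ piMap f =
      piMap (fun j => (piMap fun i => f i.1 : fib φ S j ⟶ fib φ T j)) ≫ res (unfib φ T) := by
  refine res_eq _ (unfib_bij φ S) _ _ ?_
  refine ((Category.assoc _ _ _).symm.trans ?_).symm
  exact eq_res _ (unfib_bij φ T) _ _ (piMap_reshape _ (sigma_fib_bij φ) f)

end BoxPower

section Nerve

variable {G : Type} [CommGroup G]

/-- The translation by an element of the abelian group `G`, an endomorphism of every finite
`G`-set. -/
def trans (γ : G) (S : Burnside G) : Map S S := ⟨fun x => γ • x, fun δ x => smul_comm γ δ x⟩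

theorem trans_bij (γ : G) (S : Burnside G) : Function.Bijective (trans γ S) := MulAction.bijective γ

theorem trans_natural (γ : G) {S T : Burnside G} (f : S ⟶ T) :
    f ≫ tr (trans γ T) = tr (trans γ S) ≫ f := by
  obtain ⟨a, rfl⟩ := exists_span f
  exact tr_comm a a _ _ (trans γ a.apex) (trans_bij γ _) (trans_bij γ _)
    (fun x => a.fst.map_smul γ x) (fun x => a.snd.map_smul γ x)

/-- The action of an element of the abelian group `G` on the values of a functor on the Burnside
category (on `M(G/H)` this is the Weyl action). -/
def act {M : Burnside G ⥤ Type u} {S : Burnside G} (γ : G) (m : M.obj S) : M.obj S :=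
  M.map (tr (trans γ S)) m

theorem act_map {M : Burnside G ⥤ Type u} {S T : Burnside G} (γ : G) (f : S ⟶ T) (m : M.obj S) :
    act γ (M.map f m) = M.map f (act γ m) := by
  simp only [act, ← Functor.map_comp_apply, trans_natural]

theorem act_act {M : Burnside G ⥤ Type u} {S : Burnside G} (γ δ : G) (m : M.obj S) :
    act γ (act δ m) = act (γ * δ) m := by
  simp only [act, ← Functor.map_comp_apply, tr_comp]
  congr 4
  ext x
  exact (mul_smul γ δ x).symm

theorem act_one {M : Burnside G ⥤ Type u} {S : Burnside G} (m : M.obj S) : act 1 m = m := by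
  have : trans 1 S = MulActionHom.id G := by ext x; exact one_smul G x
  rw [act, this]
  exact M.map_id_apply S m

variable (R : CommGreen.{u} G) {I J K : Type} [Finite I] [Finite J] [Finite K]

theorem act_ext (γ : G) (S : I → Burnside G) (m : ∀ i, R.F.obj (S i)) :
    act γ (R.ext S m) = R.ext S fun i => act γ (m i) := by
  unfold act
  rw [R.ext_map, piMap_tr]
  rfl

/-- The map of box powers induced by a map `φ` of finite sets and by elements `τ i ∈ G`:
`m ↦ (∏_{i ∈ φ⁻¹(j)} τ i • m i)_j`. -/
def pushApp (φ : I → J) (τ : I → G) (X : Burnside G) :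
    (boxPow I R.F).obj X → (boxPow J R.F).obj X :=
  lanDesc (F := piFunctor G I) (M := extPower I R.F) (H := boxPow J R.F)
    (fun S m => boxMk (fib φ S) (res (unfib φ S))
      fun j => R.ext (fun i : {i // φ i = j} => S i) fun i => act (τ i.1) (m i.1))
    (by
      intro S T f m
      change boxMk (fib φ T) (res (unfib φ T)) (fun j => R.ext (fun i : {i // φ i = j} => T i)
          fun i => act (τ i.1) (R.F.map (f i.1) (m i.1))) =
        (boxPow J R.F).map (piMap f) (boxMk (fib φ S) (res (unfib φ S)) _)
      rw [box_map_mk, unfib_natural, ← boxMk_glue]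
      simp only [act_map, R.ext_map])
    X

theorem pushApp_mk (φ : I → J) (τ : I → G) {X : Burnside G} (S : I → Burnside G) (s : pi S ⟶ X)
    (m : ∀ i, R.F.obj (S i)) :
    pushApp R φ τ X (boxMk S s m) = boxMk (fib φ S) (res (unfib φ S) ≫ s)
      fun j => R.ext (fun i : {i // φ i = j} => S i) fun i => act (τ i.1) (m i.1) := rfl

/-- `pushApp` as a natural transformation. -/
def push (φ : I → J) (τ : I → G) : boxPow I R.F ⟶ boxPow J R.F where
  app X := ↾(pushApp R φ τ X)
  naturality X Y f := by
    ext x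
    induction x using box_ind with | h S s m =>
    change pushApp R φ τ Y (boxMk S (s ≫ f) m) = (boxPow J R.F).map f (pushApp R φ τ X (boxMk S s m))
    rw [pushApp_mk, pushApp_mk, box_map_mk, Category.assoc]

theorem push_id : push R (id : I → I) (fun _ => (1 : G)) = 𝟙 _ := by
  ext X x
  induction x using box_ind with | h S s m =>
  change pushApp R id (fun _ => 1) X (boxMk S s m) = boxMk S s m
  rw [pushApp_mk]
  let e : ∀ i : I, Unit → Unit → {k : I // id k = i} := fun i _ _ => ⟨i, rfl⟩
  have he : ∀ i, Function.Bijective fun x : Σ _ : Unit, Unit => e i x.1 x.2 := fun i =>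
    ⟨by rintro ⟨⟨⟩, ⟨⟩⟩ ⟨⟨⟩, ⟨⟩⟩ _; rfl, by rintro ⟨k, rfl⟩; exact ⟨⟨(), ()⟩, rfl⟩⟩
  let a : ∀ i, S i ⟶ fib id S i := fun i =>
    tr ((unary _).comp (unary (S i))) ≫ res (reshape (e i) fun k => S k.1)
  have key : ∀ i, R.ext (fun k : {k // id k = i} => S k.1) (fun k => act (1 : G) (m k.1)) =
      R.F.map (a i) (m i) := by
    intro i
    simp only [act_one]
    have h1 := R.ext_ext (e i) (he i) (fun k => S k.1) (fun k => m k.1)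
    have h2 := congrArg (R.F.map (res (reshape (e i) fun k => S k.1))) h1
    rw [← Functor.map_comp_apply, tr_res _ (reshape_bij _ (he i) _).1,
      Functor.map_id_apply] at h2
    have h0 : R.ext (fun _ : Unit => pi fun _ : Unit => S i)
        (fun _ => R.ext (fun _ : Unit => S i) fun _ => m i) =
        R.F.map (tr ((unary _).comp (unary (S i)))) (m i) := by
      rw [R.ext_unary, R.ext_unary, ← Functor.map_comp_apply, tr_comp]
    refine h2.symm.trans ((congrArg _ h0).trans ?_)
    exact (Functor.map_comp_apply _ _ _ _).symm
  refine (congrArg (boxMk (fib id S) (res (unfib id S) ≫ s)) (funext key)).trans ?_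
  rw [boxMk_glue, ← Category.assoc]
  have h3 : piMap a ≫ res (unfib id S) = 𝟙 (pi S) := by
    refine (congrArg (fun t => t ≫ _) ((piMap_comp _ _).trans
      (congrArg₂ (fun t t' => t ≫ t') (piMap_tr _) (piMap_res _)))).trans ?_
    rw [Category.assoc, res_comp]
    exact tr_res _ (bij_pi _ fun i => (unary_bij _).comp (unary_bij _)).1
  rw [h3, Category.id_comp]

theorem push_comp (φ : I → J) (τ : I → G) (ψ : J → K) (σ : J → G) :
    push R φ τ ≫ push R ψ σ = push R (ψ ∘ φ) (fun i => σ (φ i) * τ i) := by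
  ext X x
  induction x using box_ind with | h S s m =>
  change pushApp R ψ σ X (pushApp R φ τ X (boxMk S s m)) =
    pushApp R (ψ ∘ φ) (fun i => σ (φ i) * τ i) X (boxMk S s m)
  rw [pushApp_mk, pushApp_mk, pushApp_mk]
  let e : ∀ (k : K) (j : {j // ψ j = k}) (i : {i // φ i = j.1}), {i // (ψ ∘ φ) i = k} :=
    fun k j i => ⟨i.1, (congrArg ψ i.2).trans j.2⟩
  have he : ∀ k, Function.Bijective fun x : Σ j : {j // ψ j = k}, {i // φ i = j.1} =>
      e k x.1 x.2 := by
    refine fun k => ⟨?_, ?_⟩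
    · rintro ⟨⟨j, hj⟩, ⟨i, hi⟩⟩ ⟨⟨j', hj'⟩, ⟨i', hi'⟩⟩ h
      have := congrArg Subtype.val h
      change i = i' at this
      change φ i = j at hi
      change φ i' = j' at hi'
      subst this hi hi'
      rfl
    · rintro ⟨i, rfl⟩
      exact ⟨⟨⟨φ i, rfl⟩, ⟨i, rfl⟩⟩, rfl⟩
  have key : ∀ k : K,
      R.ext (fun j : {j // ψ j = k} => fib φ S j.1) (fun j => act (σ j.1)
        (R.ext (fun i : {i // φ i = j.1} => S i.1) fun i => act (τ i.1) (m i.1))) =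
      R.F.map (tr (reshape (e k) fun i => S i.1)) (R.ext (fun i : {i // (ψ ∘ φ) i = k} => S i.1)
        fun i => act (σ (φ i.1) * τ i.1) (m i.1)) := by
    intro k
    rw [← R.ext_ext (e k) (he k)]
    congr 1
    funext j
    rw [act_ext]
    congr 1
    funext i
    rw [act_act]
    change act (σ j.1 * τ i.1) (m i.1) = act (σ (φ i.1) * τ i.1) (m i.1)
    rw [i.2]
  refine (congrArg (boxMk (fib ψ (fib φ S)) (res (unfib ψ (fib φ S)) ≫ res (unfib φ S) ≫ s))
    (funext key)).trans ?_
  rw [boxMk_glue, piMap_tr]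
  refine congrArg (fun t => boxMk (fib (ψ ∘ φ) S) t _) ?_
  simp only [← Category.assoc]
  refine congrArg (fun t => t ≫ s) ?_
  rw [Category.assoc, res_comp]
  refine (congrArg (fun t => _ ≫ t) (res_comp (unfib (ψ ∘ φ) S)
    (piHom fun k => reshape (e k) fun i => S i.1)).symm).trans ?_
  rw [← Category.assoc, tr_res _ (bij_pi _ fun k => reshape_bij _ (he k) _).1, Category.id_comp]

end Nerve

section Simplicial

variable {G : Type} [CommGroup G]

/-- The map on positions of box factors induced by a simplicial operator `θ : [l] → [k]`:
the factor in position `i` moves to position `#{j | θ j < i}`, read cyclically modulo `l + 1`. -/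
def pos {l k : SimplexCategory} (θ : l ⟶ k) (i : Fin (k.len + 1)) : Fin (l.len + 1) :=
  Fin.ofNat (l.len + 1) (Finset.univ.filter fun j => θ.toOrderHom j < i).card

/-- The factors that are moved around the circle are acted on by `γ`. -/
def twist (γ : G) {l k : SimplexCategory} (θ : l ⟶ k) (i : Fin (k.len + 1)) : G :=
  if (Finset.univ.filter fun j => θ.toOrderHom j < i).card = l.len + 1 then γ else 1

theorem card_le {l k : SimplexCategory} (θ : l ⟶ k) (i : Fin (k.len + 1)) :
    (Finset.univ.filter fun j => θ.toOrderHom j < i).card ≤ l.len + 1 :=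
  (Finset.card_filter_le _ _).trans (by simp)

theorem card_lt_iff {l k : SimplexCategory} (θ : l ⟶ k) (i : Fin (k.len + 1))
    (j : Fin (l.len + 1)) :
    θ.toOrderHom j < i ↔ j.1 < (Finset.univ.filter fun j => θ.toOrderHom j < i).card := by
  constructor
  · intro h
    have : Finset.Iic j ⊆ Finset.univ.filter fun j => θ.toOrderHom j < i := fun x hx => by
      simp only [Finset.mem_filter, Finset.mem_univ, true_and]
      exact lt_of_le_of_lt (θ.toOrderHom.monotone (Finset.mem_Iic.1 hx)) h
    have := Finset.card_le_card this
    rw [Fin.card_Iic] at this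
    omega
  · intro h
    by_contra h'
    have : (Finset.univ.filter fun j => θ.toOrderHom j < i) ⊆ Finset.Iio j := fun x hx => by
      simp only [Finset.mem_filter, Finset.mem_univ, true_and] at hx
      refine Finset.mem_Iio.2 (lt_of_not_ge fun hjx => h' ?_)
      exact lt_of_le_of_lt (θ.toOrderHom.monotone hjx) hx
    have := Finset.card_le_card this
    rw [Fin.card_Iio] at this
    omega

theorem pos_id (k : SimplexCategory) : pos (𝟙 k) = id := by
  funext i
  have : (Finset.univ.filter fun j => (𝟙 k : k ⟶ k).toOrderHom j < i) = Finset.Iio i := by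
    ext j; simp
  unfold pos
  rw [this, Fin.card_Iio]
  simp

theorem twist_id (γ : G) (k : SimplexCategory) : twist γ (𝟙 k) = fun _ => 1 := by
  funext i
  have : (Finset.univ.filter fun j => (𝟙 k : k ⟶ k).toOrderHom j < i) = Finset.Iio i := by
    ext j; simp
  unfold twist
  rw [this, Fin.card_Iio, if_neg i.2.ne]

theorem pos_twist_comp (γ : G) {m l k : SimplexCategory} (ψ : m ⟶ l) (θ : l ⟶ k)
    (i : Fin (k.len + 1)) : pos (ψ ≫ θ) i = pos ψ (pos θ i) ∧
      twist γ (ψ ≫ θ) i = twist γ ψ (pos θ i) * twist γ θ i := by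
  set c := (Finset.univ.filter fun j => θ.toOrderHom j < i).card with hc
  have h1 : (Finset.univ.filter fun j => (ψ ≫ θ).toOrderHom j < i) =
      Finset.univ.filter fun j => (ψ.toOrderHom j).1 < c := by
    ext j
    simp only [Finset.mem_filter, Finset.mem_univ, true_and]
    exact card_lt_iff θ i _
  rcases (card_le θ i).lt_or_eq with h | h
  · have hp : (pos θ i).1 = c := Nat.mod_eq_of_lt h
    have h2 : (Finset.univ.filter fun j => (ψ ≫ θ).toOrderHom j < i) =
        Finset.univ.filter fun j => ψ.toOrderHom j < pos θ i := by
      rw [h1]; ext j; simp only [Finset.mem_filter, Finset.mem_univ, true_and]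
      rw [Fin.lt_def, hp]
    have h3 : twist γ θ i = 1 := if_neg h.ne
    rw [h3, mul_one]
    unfold pos twist at *
    rw [h2]
    exact ⟨rfl, rfl⟩
  · have h2 : (Finset.univ.filter fun j => (ψ ≫ θ).toOrderHom j < i) = Finset.univ := by
      rw [h1, hc, h]; ext j; simp only [Finset.mem_filter, Finset.mem_univ, true_and, iff_true]
      exact Fin.is_lt _
    have hp : pos θ i = 0 := by
      refine Fin.ext ?_
      change (Finset.univ.filter fun j => θ.toOrderHom j < i).card % (l.len + 1) = 0
      rw [h, Nat.mod_self]
    have h3 : (Finset.univ.filter fun j => ψ.toOrderHom j < 0) = ∅ := by ext j; simp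
    rw [hp]
    unfold pos twist
    rw [h2, h3]
    refine ⟨?_, ?_⟩
    · refine Fin.ext ?_
      change (Finset.univ : Finset (Fin (m.len + 1))).card % (m.len + 1) = 0 % (m.len + 1)
      simp
    · rw [if_pos (by simp), if_neg (by simp), if_pos h, one_mul]

/-- The twisted cyclic nerve of a commutative Green functor `R` for the abelian group `G`, twisted
by `γ ∈ G`. Its `k`-simplices are the box power `R^{□(k+1)}`, with factors in positions `0, …, k`.
The face `d_i`, `i < k`, multiplies the factors in positions `i` and `i + 1`; the face `d_k` acts by
`γ` on the factor in position `k` and multiplies it into the factor in position `0`; degeneracies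
insert units. -/
def twistedNerve (R : CommGreen.{1} G) (γ : G) : SimplicialObject (Burnside G ⥤ Type 1) where
  obj k := boxPow (Fin (k.unop.len + 1)) R.F
  map θ := push R (pos θ.unop) (twist γ θ.unop)
  map_id k := by
    rw [unop_id, pos_id, twist_id]
    exact push_id R
  map_comp θ ψ := by
    rw [push_comp, unop_comp]
    congr 1
    · funext i; exact (pos_twist_comp γ _ _ i).1
    · funext i; exact (pos_twist_comp γ _ _ i).2

end Simplicial

section Additivization

variable {G : Type} [Group G]

/-- The relations `(s + t)_* z = s_* z + t_* z`. -/
def addRel (M : Burnside G ⥤ Type 1) (X : Burnside G) : AddSubgroup (FreeAbelianGroup (M.obj X)) :=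
  AddSubgroup.closure {x | ∃ (Z : Burnside G) (s t : Z ⟶ X) (z : M.obj Z),
    x = FreeAbelianGroup.of (M.map (s + t) z) -
      (FreeAbelianGroup.of (M.map s z) + FreeAbelianGroup.of (M.map t z))}

/-- The value of the additivization. -/
abbrev addObj (M : Burnside G ⥤ Type 1) (X : Burnside G) : Type 1 :=
  FreeAbelianGroup (M.obj X) ⧸ addRel M X

/-- Additive extension of maps compatible with sums of Burnside morphisms. -/
def addMap {Q : Type} [Group Q] {M : Burnside G ⥤ Type 1} {M' : Burnside Q ⥤ Type 1}
    {X : Burnside G} {Y : Burnside Q} (f : M.obj X → M'.obj Y)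
    (hf : ∀ (Z : Burnside G) (s t : Z ⟶ X) (z : M.obj Z), ∃ (Z' : Burnside Q) (s' t' : Z' ⟶ Y)
      (z' : M'.obj Z'), f (M.map (s + t) z) = M'.map (s' + t') z' ∧
        f (M.map s z) = M'.map s' z' ∧ f (M.map t z) = M'.map t' z') :
    addObj M X →+ addObj M' Y :=
  QuotientAddGroup.map _ _ (FreeAbelianGroup.map f) (by
    rw [addRel, AddSubgroup.closure_le]
    rintro _ ⟨Z, s, t, z, rfl⟩
    obtain ⟨Z', s', t', z', h1, h2, h3⟩ := hf Z s t z
    refine AddSubgroup.subset_closure ⟨Z', s', t', z', ?_⟩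
    simp only [map_sub, map_add, FreeAbelianGroup.map_of_apply, h1, h2, h3])

theorem addMap_mk {Q : Type} [Group Q] {M : Burnside G ⥤ Type 1} {M' : Burnside Q ⥤ Type 1}
    {X : Burnside G} {Y : Burnside Q} (f : M.obj X → M'.obj Y) (hf) (m : M.obj X) :
    addMap f hf (QuotientAddGroup.mk (FreeAbelianGroup.of m)) =
      QuotientAddGroup.mk (FreeAbelianGroup.of (f m)) := rfl

theorem addObj_hom_ext {M : Burnside G ⥤ Type 1} {X : Burnside G} {A : Type 1} [AddCommGroup A]
    {f g : addObj M X →+ A} (h : ∀ m : M.obj X, f (QuotientAddGroup.mk (FreeAbelianGroup.of m)) =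
      g (QuotientAddGroup.mk (FreeAbelianGroup.of m))) : f = g :=
  QuotientAddGroup.addMonoidHom_ext _ (FreeAbelianGroup.lift_ext _ _ h)

/-- The additivization of a set-valued functor `M` on the Burnside category: the universal functor
to abelian groups under `M` which is additive on morphisms. If `M` preserves finite products, the
values of `M` are commutative monoids by functoriality, and this is their group completion. In
particular, if `M` is a (set-valued) Mackey functor, then this is `M`, with the abelian group
structures on its values that it has by functoriality. -/
def additivization (G : Type) [Group G] :
    (Burnside G ⥤ Type 1) ⥤ (Burnside G ⥤ AddCommGrpCat.{1}) where
  obj M :=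
    { obj X := AddCommGrpCat.of (addObj M X)
      map {X Y} f := AddCommGrpCat.ofHom (addMap (M := M) (M' := M) (M.map f) fun Z s t z =>
        ⟨Z, s ≫ f, t ≫ f, z, by simp [← add_comp], by simp, by simp⟩)
      map_id X := by
        ext1
        exact addObj_hom_ext fun m => by simp [addMap_mk]
      map_comp f g := by
        ext1
        exact addObj_hom_ext fun m => by simp [addMap_mk] }
  map {M M'} φ :=
    { app X := AddCommGrpCat.ofHom (addMap (φ.app X) fun Z s t z =>
        ⟨Z, s, t, φ.app Z z, by simp [NatTrans.naturality_apply],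
          by simp [NatTrans.naturality_apply], by simp [NatTrans.naturality_apply]⟩)
      naturality X Y f := by
        ext1
        exact addObj_hom_ext fun m => by simp [addMap_mk, NatTrans.naturality_apply] }
  map_id M := by
    ext X : 3
    exact addObj_hom_ext fun m => by simp [addMap_mk]
  map_comp φ ψ := by
    ext X : 3
    exact addObj_hom_ext fun m => by simp [addMap_mk]

end Additivization

section Geometric

variable {G Q : Type} [Group G] [Group Q] (q : G →* Q) (hq : Function.Surjective q)

/-- `F(G/N, T) ≅ F(G, T)^N`. -/
def coindFix [Finite G] [Finite Q] (T : Burnside Unit) :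
    Map ((coind Q).obj T) ((fix q hq).obj ((coind G).obj T)) :=
  ⟨fun x => ⟨fun γ => x (q γ), fun n hn => funext fun γ => congrArg x (by
    rw [map_mul, hn, mul_one])⟩, fun γ x => by
    obtain ⟨γ, rfl⟩ := hq γ
    refine Subtype.ext ((funext fun δ => ?_ : _ = _).trans
      (fix_smul q hq ((coind G).obj T) γ _).symm)
    exact congrArg x (map_mul q δ γ).symm⟩

theorem coindFix_bij [Finite G] [Finite Q] (T : Burnside Unit) :
    Function.Bijective (coindFix q hq T) := by
  refine ⟨fun x y h => funext fun γ => ?_, fun y => ?_⟩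
  · obtain ⟨γ, rfl⟩ := hq γ
    exact congrFun (congrArg Subtype.val h) γ
  · refine ⟨fun γ => y.1 (hq γ).choose, Subtype.ext (funext fun γ => ?_)⟩
    have h := congrFun (y.2 (γ⁻¹ * (hq (q γ)).choose) (by
      rw [map_mul, map_inv, (hq (q γ)).choose_spec, inv_mul_cancel])) γ
    change y.1 (γ * (γ⁻¹ * (hq (q γ)).choose)) = y.1 γ at h
    rwa [mul_inv_cancel_left] at h

theorem coindFix_natural [Finite G] [Finite Q] {S T : Burnside Unit} (f : S ⟶ T) :
    (coind Q).map f ≫ tr (coindFix q hq T) =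
      tr (coindFix q hq S) ≫ (fix q hq).map ((coind G).map f) := by
  obtain ⟨a, rfl⟩ := exists_span f
  exact tr_comm (Span.coind Q a) (Span.fix q hq (Span.coind G a)) (coindFix q hq S)
    (coindFix q hq T) (coindFix q hq a.apex) (coindFix_bij q hq _) (coindFix_bij q hq _)
    (fun _ => rfl) (fun _ => rfl)

/-- `∏ (S i)^N ≅ (∏ S i)^N`. -/
def piFix {I : Type} [Finite I] (S : I → Burnside G) :
    Map (pi fun i => (fix q hq).obj (S i)) ((fix q hq).obj (pi S)) :=
  ⟨fun x => ⟨fun i => (x i).1, fun n hn => funext fun i => (x i).2 n hn⟩, fun γ x => by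
    obtain ⟨γ, rfl⟩ := hq γ
    refine Subtype.ext ((funext fun i => ?_ : _ = _).trans (fix_smul q hq (pi S) γ _).symm)
    exact fix_smul q hq (S i) γ (x i)⟩

theorem piFix_bij {I : Type} [Finite I] (S : I → Burnside G) :
    Function.Bijective (piFix q hq S) :=
  ⟨fun _ _ h => funext fun i => Subtype.ext (congrFun (congrArg Subtype.val h) i),
    fun y => ⟨fun i => ⟨y.1 i, fun n hn => congrFun (y.2 n hn) i⟩, rfl⟩⟩

theorem piFix_natural {I : Type} [Finite I] {S T : I → Burnside G} (f : ∀ i, S i ⟶ T i) :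
    piMap (fun i => (fix q hq).map (f i)) ≫ tr (piFix q hq T) =
      tr (piFix q hq S) ≫ (fix q hq).map (piMap f) := by
  obtain ⟨a, rfl⟩ := exists_spans f
  rw [piMap_hom]
  refine (congrArg (fun t => t ≫ _) (piMap_hom fun i => Span.fix q hq (a i))).trans ?_
  exact tr_comm (Span.pi fun i => Span.fix q hq (a i)) (Span.fix q hq (Span.pi a))
    (piFix q hq S) (piFix q hq T) (piFix q hq fun i => (a i).apex) (piFix_bij q hq _)
    (piFix_bij q hq _) (fun _ => rfl) (fun _ => rfl)

section NormFix

variable [Finite G] [Finite Q] (R : CommGreen.{u} Unit)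

/-- The geometric fixed point map `(N_e^G R)(X) → (N_e^{G/N} R)(X^N)`: the class of
`f : F(G, T) → X` and `m ∈ R(T)` is sent to the class of `f^N : F(G/N, T) ≅ F(G, T)^N → X^N` and
`m`. -/
def normFix (X : Burnside G) : (norm G R).F.obj X → (norm Q R).F.obj ((fix q hq).obj X) :=
  lanDesc (F := coind G) (M := R.F) (H := fix q hq ⋙ (norm Q R).F)
    (fun T m => lanMk (F := coind Q) (M := R.F) T (tr (coindFix q hq T)) m)
    (by
      intro S T f m
      rw [lanMk_glue, coindFix_natural]
      rfl) X

theorem normFix_mk {X : Burnside G} (T : Burnside Unit) (f : (coind G).obj T ⟶ X)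
    (m : R.F.obj T) : normFix q hq R X (lanMk (F := coind G) (M := R.F) T f m) =
      lanMk (F := coind Q) (M := R.F) T (tr (coindFix q hq T) ≫ (fix q hq).map f) m := rfl

theorem normFix_map {X Y : Burnside G} (f : X ⟶ Y) (m : (norm G R).F.obj X) :
    normFix q hq R Y ((norm G R).F.map f m) =
      (norm Q R).F.map ((fix q hq).map f) (normFix q hq R X m) := by
  induction m using lan_ind with | h T g m =>
  change normFix q hq R Y (lanMk (F := coind G) (M := R.F) T (g ≫ f) m) =
    lanMk (F := coind Q) (M := R.F) T ((tr (coindFix q hq T) ≫ (fix q hq).map g) ≫ _) m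
  rw [normFix_mk, Functor.map_comp, Category.assoc]

theorem normFix_ext {I : Type} [Finite I] (S : I → Burnside G) (m : ∀ i, (norm G R).F.obj (S i)) :
    normFix q hq R (pi S) ((norm G R).ext S m) =
      (norm Q R).F.map (tr (piFix q hq S)) ((norm Q R).ext (fun i => (fix q hq).obj (S i))
        fun i => normFix q hq R (S i) (m i)) := by
  obtain ⟨c, f, m, rfl⟩ := exists_lanMks (F := coind G) (M := R.F) m
  have h1 := normExt_mk G R S c f m
  have h2 := normExt_mk Q R (fun i => (fix q hq).obj (S i)) c
    (fun i => tr (coindFix q hq (c i)) ≫ (fix q hq).map (f i)) m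
  refine (congrArg (normFix q hq R (pi S)) h1).trans
    (Eq.trans ?_ (congrArg ((norm Q R).F.map (tr (piFix q hq S))) h2).symm)
  rw [normFix_mk]
  refine congrArg (fun t => lanMk (F := coind Q) (M := R.F) (pi c) t (R.ext c m)) ?_
  rw [Functor.map_comp, Category.assoc]
  have h3 := piMap_comp (fun i => tr (coindFix q hq (c i))) (fun i => (fix q hq).map (f i))
  have h4 := piMap_tr fun i => coindFix q hq (c i)
  refine Eq.trans ?_ (congrArg (fun t => tr (swap Q c) ≫ t ≫ tr (piFix q hq S))
    (h3.trans (congrArg (fun t => t ≫ _) h4)).symm)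
  rw [Category.assoc, piFix_natural, fix_tr]
  simp only [← Category.assoc]
  refine congrArg (fun t => t ≫ _) ?_
  refine (tr_comp (coindFix q hq (pi c)) (fixHom q hq (swap G c))).trans ?_
  refine Eq.trans ?_ (congrArg (fun t => t ≫ tr (piFix q hq fun i => (coind G).obj (c i)))
    (tr_comp (swap Q c) (piHom fun i => coindFix q hq (c i)))).symm
  exact (tr_comp ((piHom fun i => coindFix q hq (c i)).comp (swap Q c))
    (piFix q hq fun i => (coind G).obj (c i))).symm

end NormFix

end Geometric

section GeometricNerve

variable {G Q : Type} [CommGroup G] [CommGroup Q] (q : G →* Q) (hq : Function.Surjective q)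
variable [Finite G] [Finite Q] (R : CommGreen.{u} Unit)

theorem normFix_act (γ : G) {X : Burnside G} (m : (norm G R).F.obj X) :
    normFix q hq R X (act γ m) = act (q γ) (normFix q hq R X m) := by
  unfold act
  rw [normFix_map, fix_tr]
  refine congrArg (fun f : Map ((fix q hq).obj X) ((fix q hq).obj X) =>
    (norm Q R).F.map (tr f) (normFix q hq R X m)) (MulActionHom.ext fun x => ?_)
  exact Subtype.ext (fix_smul q hq X γ x).symm

variable {I J : Type} [Finite I] [Finite J]

/-- The geometric fixed point map on box powers of norms, induced by `normFix`. -/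
def boxFix (I : Type) [Finite I] (X : Burnside G) : (boxPow I (norm G R).F).obj X →
    (boxPow I (norm Q R).F).obj ((fix q hq).obj X) :=
  lanDesc (F := piFunctor G I) (M := extPower I (norm G R).F)
    (H := fix q hq ⋙ boxPow I (norm Q R).F)
    (fun S m => boxMk (fun i => (fix q hq).obj (S i)) (tr (piFix q hq S))
      fun i => normFix q hq R (S i) (m i))
    (by
      intro S T f m
      change boxMk _ (tr (piFix q hq T)) (fun i => normFix q hq R (T i)
        ((norm G R).F.map (f i) (m i))) = boxMk _ (tr (piFix q hq S) ≫ (fix q hq).map (piMap f)) _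
      simp only [normFix_map]
      rw [boxMk_glue, piFix_natural]) X

theorem boxFix_mk {X : Burnside G} (S : I → Burnside G) (s : pi S ⟶ X)
    (m : ∀ i, (norm G R).F.obj (S i)) : boxFix q hq R I X (boxMk S s m) =
      boxMk (fun i => (fix q hq).obj (S i)) (tr (piFix q hq S) ≫ (fix q hq).map s)
        fun i => normFix q hq R (S i) (m i) := rfl

theorem boxFix_map {X Y : Burnside G} (f : X ⟶ Y) (x : (boxPow I (norm G R).F).obj X) :
    boxFix q hq R I Y ((boxPow I (norm G R).F).map f x) =
      (boxPow I (norm Q R).F).map ((fix q hq).map f) (boxFix q hq R I X x) := by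
  induction x using box_ind with | h S s m =>
  rw [box_map_mk, boxFix_mk, boxFix_mk, box_map_mk, Functor.map_comp, Category.assoc]

theorem boxFix_push (φ : I → J) (τ : I → G) {X : Burnside G}
    (x : (boxPow I (norm G R).F).obj X) :
    boxFix q hq R J X (pushApp (norm G R) φ τ X x) =
      pushApp (norm Q R) φ (fun i => q (τ i)) _ (boxFix q hq R I X x) := by
  induction x using box_ind with | h S s m =>
  rw [pushApp_mk, boxFix_mk, boxFix_mk, pushApp_mk]
  simp only [normFix_ext, normFix_act]
  rw [boxMk_glue]
  refine congrArg (fun t => boxMk (fib φ fun i => (fix q hq).obj (S i)) t _) ?_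
  rw [Functor.map_comp, fix_res]
  simp only [← Category.assoc]
  refine congrArg (fun t => t ≫ _) ?_
  symm
  refine res_eq (unfib φ fun i => (fix q hq).obj (S i)) (unfib_bij φ _) _ _ ?_
  refine ((Category.assoc _ _ _).symm.trans ?_).symm
  refine eq_res _ (fixHom_bij q hq _ (unfib_bij φ S)) _ _ ?_
  refine (tr_comp (piFix q hq S) (fixHom q hq (unfib φ S))).trans ?_
  rw [piMap_tr]
  refine Eq.trans ?_ (congrArg (fun t => tr (unfib φ fun i => (fix q hq).obj (S i)) ≫ t)
    (tr_comp (piHom fun j => piFix q hq fun i : {i // φ i = j} => S i.1)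
      (piFix q hq (fib φ S))).symm)
  exact (tr_comp (unfib φ fun i => (fix q hq).obj (S i))
    ((piFix q hq (fib φ S)).comp (piHom fun j => piFix q hq fun i : {i // φ i = j} => S i.1))).symm

end GeometricNerve

section Hochschild

/-- The `G`-twisted cyclic nerve relative to the trivial group of a commutative ring `A`, as a
simplicial Mackey functor: the twisted cyclic nerve of the Green functor `N_e^G A`. -/
def relativeNerve (G : Type) [CommGroup G] [Finite G] (γ : G) (A : Type) [CommRing A] :
    SimplicialObject (Burnside G ⥤ AddCommGrpCat.{1}) :=
  ((SimplicialObject.whiskering _ _).obj (additivization G)).obj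
    (twistedNerve (norm G (ringGreen A)) γ)

/-- The simplicial abelian group of values at `X` of a simplicial Mackey functor, as a functor
of `X`. -/
def evalNerve {G : Type} [Group G] (M : SimplicialObject (Burnside G ⥤ AddCommGrpCat.{1})) :
    Burnside G ⥤ SimplicialObject AddCommGrpCat.{1} :=
  Functor.flip M

/-- The homology functor of simplicial abelian groups: homology of the normalized complex. -/
def simplicialHomology (k : ℕ) : SimplicialObject AddCommGrpCat.{1} ⥤ AddCommGrpCat.{1} :=
  AlgebraicTopology.normalizedMooreComplex AddCommGrpCat.{1} ⋙
    HomologicalComplex.homologyFunctor _ _ k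

/-- The `G`-twisted Hochschild homology Mackey functor `HH_e^G(A)_k`. -/
def HH (G : Type) [CommGroup G] [Finite G] (γ : G) (A : Type) [CommRing A] (k : ℕ) :
    Burnside G ⥤ AddCommGrpCat.{1} :=
  evalNerve (relativeNerve G γ A) ⋙ simplicialHomology k

/-- The Mackey functor norm `N_e^G A`. -/
def normMackey (G : Type) [CommGroup G] [Finite G] (A : Type) [CommRing A] :
    Burnside G ⥤ AddCommGrpCat.{1} :=
  (additivization G).obj (norm G (ringGreen A)).F

section

variable {G Q : Type} [CommGroup G] [CommGroup Q] [Finite G] [Finite Q] (q : G →* Q)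
  (hq : Function.Surjective q) (A : Type) [CommRing A]

/-- The unique map from the fixed points of the one-point set to the one-point set. -/
def ptFix : Map ((fix q hq).obj (pt G)) (pt Q) := ⟨fun _ => (), fun _ _ => rfl⟩

/-- The map `HC_e^G(A)_k (G/G) → HC_e^{G/N}(A)_k ((G/N)/(G/N))` given on generators by passage to
`N`-fixed points. -/
def fixApp (k : SimplexCategoryᵒᵖ) :
    addObj (boxPow (Fin (k.unop.len + 1)) (norm G (ringGreen A)).F) (pt G) →+
      addObj (boxPow (Fin (k.unop.len + 1)) (norm Q (ringGreen A)).F) (pt Q) :=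
  addMap (fun x => (boxPow _ (norm Q (ringGreen A)).F).map (tr (ptFix q hq))
      (boxFix q hq (ringGreen A) _ (pt G) x)) fun Z s t z =>
    ⟨(fix q hq).obj Z, (fix q hq).map s ≫ tr (ptFix q hq), (fix q hq).map t ≫ tr (ptFix q hq),
      boxFix q hq (ringGreen A) _ Z z, by
        rw [boxFix_map, fix_add, ← add_comp, Functor.map_comp_apply], by
        rw [boxFix_map, Functor.map_comp_apply], by
        rw [boxFix_map, Functor.map_comp_apply]⟩

/-- The value at `X` of the sub-Mackey functor `EF_N M` of `M` generated by the values of `M` on the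
orbits `G/H` with `N ⊄ H`, that is, on the finite `G`-sets without `N`-fixed points. -/
def EF (M : Burnside G ⥤ Type 1) (X : Burnside G) : AddSubgroup (addObj M X) :=
  AddSubgroup.closure {x | ∃ (Y : Burnside G) (f : Y ⟶ X) (m : M.obj Y),
    IsEmpty ((fix q hq).obj Y) ∧ x = QuotientAddGroup.mk (FreeAbelianGroup.of (M.map f m))}

theorem of_eq_zero {Q : Type} [Group Q] {M : Burnside Q ⥤ Type 1} {X Y : Burnside Q} [IsEmpty Y]
    (f : Y ⟶ X) (m : M.obj Y) : (QuotientAddGroup.mk (FreeAbelianGroup.of (M.map f m)) : addObj M X) = 0 := by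
  have h : f + f = f := by
    obtain ⟨a, rfl⟩ := exists_span f
    have : IsEmpty a.apex := ⟨fun x => isEmptyElim (a.fst x)⟩
    have : IsEmpty (a.add a).apex := ⟨fun x => by rcases x with x | x <;> exact isEmptyElim x⟩
    exact hom_eq (a := a.add a) ⟨fun x => isEmptyElim x, fun _ x => isEmptyElim x⟩
      ⟨fun x => isEmptyElim x, fun x => isEmptyElim x⟩ (fun x => isEmptyElim x)
      (fun x => isEmptyElim x)
  have hrel : FreeAbelianGroup.of (M.map (f + f) m) -
      (FreeAbelianGroup.of (M.map f m) + FreeAbelianGroup.of (M.map f m)) ∈ addRel M X :=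
    AddSubgroup.subset_closure ⟨Y, f, f, m, rfl⟩
  rw [h, sub_add_cancel_left, neg_mem_iff] at hrel
  exact (QuotientAddGroup.eq_zero_iff _).2 hrel

/-- The `k`-simplices of the geometric fixed points at `(G/N)/(G/N)`: the quotient of
`M = HC_e^G(A)_k` at `G/G` by `EF_N M`. -/
abbrev GeomFixedPoints (k : SimplexCategoryᵒᵖ) : Type 1 :=
  addObj (boxPow (Fin (k.unop.len + 1)) (norm G (ringGreen A)).F) (pt G) ⧸
    EF q hq (boxPow (Fin (k.unop.len + 1)) (norm G (ringGreen A)).F) (pt G)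

/-- The cyclotomic identification of `Φ^N (HC_e^G(A)_k)` with `HC_e^{G/N}(A)_k` at the one-point
set. -/
def cyclotomic (k : SimplexCategoryᵒᵖ) : GeomFixedPoints q hq A k →+
    addObj (boxPow (Fin (k.unop.len + 1)) (norm Q (ringGreen A)).F) (pt Q) :=
  QuotientAddGroup.lift _ (fixApp q hq A k) (by
    change EF q hq _ (pt G) ≤ (fixApp q hq A k).ker
    rw [EF, AddSubgroup.closure_le]
    rintro _ ⟨Y, f, m, hY, rfl⟩
    change fixApp q hq A k _ = 0
    rw [fixApp, addMap_mk, boxFix_map, ← Functor.map_comp_apply]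
    exact of_eq_zero _ _)

/-- The geometric fixed point map on `k`-simplices: projection to the geometric fixed points,
followed by the cyclotomic identification. -/
def geomFixApp (k : SimplexCategoryᵒᵖ) :
    addObj (boxPow (Fin (k.unop.len + 1)) (norm G (ringGreen A)).F) (pt G) →+
      addObj (boxPow (Fin (k.unop.len + 1)) (norm Q (ringGreen A)).F) (pt Q) :=
  (cyclotomic q hq A k).comp (QuotientAddGroup.mk'
    (EF q hq (boxPow (Fin (k.unop.len + 1)) (norm G (ringGreen A)).F) (pt G)))

/-- The geometric fixed point map `HC_e^G(A)(G/G) → HC_e^{G/N}(A)((G/N)/(G/N))`, a map of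
simplicial abelian groups. -/
def geomFix (γ : G) (γ' : Q) (hγ : q γ = γ') :
    (evalNerve (relativeNerve G γ A)).obj (pt G) ⟶
      (evalNerve (relativeNerve Q γ' A)).obj (pt Q) where
  app k := AddCommGrpCat.ofHom (geomFixApp q hq A k)
  naturality k l θ := by
    subst hγ
    ext1
    refine addObj_hom_ext fun x => ?_
    change (QuotientAddGroup.mk (FreeAbelianGroup.of
        ((boxPow _ (norm Q (ringGreen A)).F).map (tr (ptFix q hq))
          (boxFix q hq (ringGreen A) _ (pt G)
            (pushApp (norm G (ringGreen A)) (pos θ.unop) (twist γ θ.unop) (pt G) x)))) :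
          addObj _ (pt Q)) =
      QuotientAddGroup.mk (FreeAbelianGroup.of
        ((push (norm Q (ringGreen A)) (pos θ.unop) (twist (q γ) θ.unop)).app (pt Q)
          ((boxPow _ (norm Q (ringGreen A)).F).map (tr (ptFix q hq))
            (boxFix q hq (ringGreen A) _ (pt G) x))))
    have h : (fun i => q (twist γ θ.unop i)) = twist (q γ) θ.unop := by
      funext i
      unfold twist
      split_ifs <;> simp
    have key := boxFix_push q hq (ringGreen A) (pos θ.unop) (twist γ θ.unop) (X := pt G) x
    rw [h] at key
    refine congrArg (fun t => (QuotientAddGroup.mk (FreeAbelianGroup.of t) :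
      addObj (boxPow (Fin (l.unop.len + 1)) (norm Q (ringGreen A)).F) (pt Q))) ?_
    refine (congrArg ((boxPow (Fin (l.unop.len + 1)) (norm Q (ringGreen A)).F).map
      (tr (ptFix q hq))) key).trans ?_
    exact (NatTrans.naturality_apply (push (norm Q (ringGreen A)) (pos θ.unop)
      (twist (q γ) θ.unop)) (tr (ptFix q hq)) (boxFix q hq (ringGreen A) _ (pt G) x)).symm

/-- The map on twisted Hochschild homology at the one-point set induced by `geomFix`. -/
def geomFixHH (γ : G) (γ' : Q) (hγ : q γ = γ') (k : ℕ) :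
    (HH G γ A k).obj (pt G) →+ (HH Q γ' A k).obj (pt Q) :=
  ((simplicialHomology k).map (geomFix q hq A γ γ' hγ)).hom

end

section TR

variable (p : ℕ)

/-- The cyclic group `C_{p^n}`, written multiplicatively: the residue class of `a` corresponds to
`e^{2 π i a / p^n}` in the circle group. -/
abbrev Cyc (n : ℕ) : Type := Multiplicative (ZMod (p ^ n))

instance [Fact p.Prime] (n : ℕ) : NeZero (p ^ n) := ⟨pow_ne_zero _ (Fact.out : p.Prime).ne_zero⟩

/-- The generator `e^{2 π i / p^n}` of `C_{p^n}`. -/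
def gen (n : ℕ) : Cyc p n := Multiplicative.ofAdd 1

/-- The projection `C_{p^(n+1)} → C_{p^(n+1)} / C_p ≅ C_{p^n}`, given by the `p`-th root isomorphism
`S^1 / C_p ≅ S^1`. -/
def proj (n : ℕ) : Cyc p (n + 1) →* Cyc p n :=
  AddMonoidHom.toMultiplicative
    (ZMod.castHom (pow_dvd_pow p n.le_succ) (ZMod (p ^ n))).toAddMonoidHom

theorem proj_surjective (n : ℕ) : Function.Surjective (proj p n) :=
  ZMod.castHom_surjective (pow_dvd_pow p n.le_succ)

theorem proj_gen (n : ℕ) : proj p n (gen p (n + 1)) = gen p n :=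
  congrArg Multiplicative.ofAdd (map_one (ZMod.castHom (pow_dvd_pow p n.le_succ) (ZMod (p ^ n))))

variable [Fact p.Prime]

/-- The Mackey functor `HH_e^{C_{p^n}}(A)_k`. -/
abbrev HHCyc (A : Type) [CommRing A] (k n : ℕ) : Burnside (Cyc p n) ⥤ AddCommGrpCat.{1} :=
  HH (Cyc p n) (gen p n) A k

/-- The geometric fixed point map
`HH_e^{C_{p^(n+1)}}(A)_k (C_{p^(n+1)}/C_{p^(n+1)}) → HH_e^{C_{p^n}}(A)_k (C_{p^n}/C_{p^n})`. -/
def trMap (A : Type) [CommRing A] (k n : ℕ) :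
    (HHCyc p A k (n + 1)).obj (pt _) →+ (HHCyc p A k n).obj (pt _) :=
  geomFixHH (proj p n) (proj_surjective p n) A (gen p (n + 1)) (gen p n) (proj_gen p n) k

/-- The algebraic `TR` group `tr_k(A; p)`: the limit of the groups
`HH_e^{C_{p^n}}(A)_k (C_{p^n}/C_{p^n})` over the geometric fixed point maps. -/
def algTR (A : Type) [CommRing A] (k : ℕ) :
    AddSubgroup (∀ n, (HHCyc p A k n).obj (pt (Cyc p n))) where
  carrier := {x | ∀ n, trMap p A k n (x (n + 1)) = x n}
  zero_mem' _ := map_zero _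
  add_mem' hx hy n := (map_add _ _ _).trans (congrArg₂ _ (hx n) (hy n))
  neg_mem' hx n := (map_neg _ _).trans (congrArg _ (hx n))

end TR

end Hochschild
end AlgebraicTR

end

open CategoryTheory

noncomputable section

namespace AlgebraicTR

open Burnside

/-! ### Additivity of composition in the second variable, and one-point `G`-sets -/

namespace Burnside

variable {G : Type} [Group G]

/-! Everything follows from the fact that every element of the field with `p` elements is a sum of
ones. A function from a finite set `T` to this field is thus the transfer, along a finite cover of
`T`, of the constant function 1 (`exists_coverHom`). The coend relations carry this over to the
norm, each of whose elements is `f_* 1` for a morphism `f` out of the one-point set `F(G, pt)`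
(`exists_normOne_map`), and to its box powers, whose elements have the form `f_* (1 ⊗ ⋯ ⊗ 1)`
(`exists_boxOne`).

All structure maps of the twisted cyclic nerve preserve these unit classes. The Weyl action on the
unit is trivial, so the twist is invisible, and a product of units is the unit. Hence two maps of
box powers in opposite directions, induced by any maps of nonempty index sets, are inverse to each
other (`pushApp_pushApp`). The nerve is therefore constant up to isomorphism, its normalized complex
is concentrated in degree zero, and its homology there is the box power with one factor, which
multiplication identifies with the norm (`boxMul_bijective`).

For the limit, the value of the norm at the one-point set must be computed for `G` cyclic of order
`p ^ n`; it is `ZMod (p ^ (n + 1))`. The invariant is a weighted number of points (`normCardHom`):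
the residues are lifted to integers, multiplied over `G` and summed over the apex of the span.
Independence of the lifts modulo `p ^ (n + 1)` comes from the orbits (`pow_dvd_card_mul_sub`): on an
orbit of length `p ^ a` with stabilizers of order `p ^ k`, `a + k = n`, the product is a `p ^ k`-th
power, so it is well defined modulo `p ^ (k + 1)`, and the orbit contributes a further factor `p ^
a`.

The class of a `G`-set `Y` goes to its cardinality, which gives surjectivity. For injectivity the
value is filtered by the lengths of orbits. The norm cannot distinguish a cover of a transitive `Y`
having `p` points over one chosen point from the cover with that fibre removed. The latter has no
sections over the orbit; among the sections of the former, the constant ones form `p` copies of `Y`,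
and all others lie in longer orbits. So `p` times the class of `Y` moves one step down the
filtration (`smul_gsetClass_mem_orbitFiltration`). As a cyclic group has at most one transitive set
of each cardinality up to isomorphism, divisibility of the cardinality then pushes an element of the
kernel through all steps of the filtration, to zero (`eq_zero_of_normCardHom_eq_zero`).

Finally, the geometric fixed point maps preserve the unit, which generates these cyclic groups. They
are thus the reductions `ZMod (p ^ (n + 2)) → ZMod (p ^ (n + 1))`, and the limit is the group of
`p`-adic integers. -/

theorem comp_add {S T U : Burnside G} (f : S ⟶ T) (g g' : T ⟶ U) :
    f ≫ (g + g') = f ≫ g + f ≫ g' := by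
  obtain ⟨a, rfl⟩ := exists_span f
  obtain ⟨b, rfl⟩ := exists_span g
  obtain ⟨b', rfl⟩ := exists_span g'
  refine hom_eq (a := a.comp (b.add b')) (b := (a.comp b).add (a.comp b'))
    ⟨fun x => match x with
      | ⟨(x, Sum.inl y), h⟩ => Sum.inl ⟨(x, y), h⟩
      | ⟨(x, Sum.inr y), h⟩ => Sum.inr ⟨(x, y), h⟩, ?_⟩ ⟨?_, ?_⟩ ?_ ?_
  · rintro γ ⟨⟨x, y | y⟩, h⟩ <;> rfl
  · rintro ⟨⟨x, y | y⟩, h⟩ ⟨⟨x', y' | y'⟩, h'⟩ hxy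
    · have := Sum.inl_injective hxy
      have e1 := congrArg (fun t => t.1.1) this
      have e2 := congrArg (fun t => t.1.2) this
      change x = x' at e1; change y = y' at e2; subst e1 e2; rfl
    · exact absurd hxy Sum.inl_ne_inr
    · exact absurd hxy Sum.inr_ne_inl
    · have := Sum.inr_injective hxy
      have e1 := congrArg (fun t => t.1.1) this
      have e2 := congrArg (fun t => t.1.2) this
      change x = x' at e1; change y = y' at e2; subst e1 e2; rfl
  · rintro (⟨⟨x, y⟩, h⟩ | ⟨⟨x, y⟩, h⟩)
    · exact ⟨⟨(x, Sum.inl y), h⟩, rfl⟩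
    · exact ⟨⟨(x, Sum.inr y), h⟩, rfl⟩
  · rintro ⟨⟨x, y | y⟩, h⟩ <;> rfl
  · rintro ⟨⟨x, y | y⟩, h⟩ <;> rfl

/-- The only equivariant map to a one-point set. -/
def toUnique (S T : Burnside G) [Unique T] : S →[G] T :=
  ⟨fun _ => default, fun _ _ => Subsingleton.elim _ _⟩

theorem eq_toUnique {S T : Burnside G} [Unique T] (f : S →[G] T) : f = toUnique S T :=
  MulActionHom.ext fun _ => Subsingleton.elim _ _

theorem tr_id (S : Burnside G) : tr (MulActionHom.id G : S →[G] S) = 𝟙 S := rfl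

theorem toUnique_self (S : Burnside G) [Unique S] : tr (toUnique S S) = 𝟙 S := by
  rw [← eq_toUnique (MulActionHom.id G), tr_id]

/-- A map between one-point sets is bijective, so its span can be read in the other direction. This
turns the restrictions in `pushApp_mk` into transfers, which compose to the only possible map. -/
theorem res_eq_toUnique {S T : Burnside G} [Unique S] [Unique T] (f : S →[G] T) :
    res f = tr (toUnique T S) := by
  refine hom_eq (b := ⟨T, MulActionHom.id G, toUnique T S⟩) f ⟨fun x y _ => Subsingleton.elim _ _,
    fun y => ⟨default, Subsingleton.elim _ _⟩⟩ (fun _ => rfl) fun x => ?_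
  exact Subsingleton.elim (α := S) _ _

instance : Unique (pt G) := inferInstanceAs (Unique Unit)

instance {I : Type} [Finite I] (S : I → Burnside G) [∀ i, Unique (S i)] : Unique (pi S) :=
  inferInstanceAs (Unique (∀ i, S i))

instance [Finite G] (T : Burnside Unit) [Unique T] : Unique ((coind G).obj T) :=
  inferInstanceAs (Unique (G → T))

instance {Q : Type} [Group Q] (q : G →* Q) (hq : Function.Surjective q) (S : Burnside G)
    [Unique S] : Unique ((fix q hq).obj S) where
  default := ⟨default, fun _ _ => Subsingleton.elim _ _⟩
  uniq _ := Subtype.ext (Subsingleton.elim _ _)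

end Burnside

/-- Naturality of the evaluation isomorphism from a product with one factor to that factor. -/
theorem piMap_tr_eval {G : Type} [Group G] {I : Type} [Finite I] [Unique I]
    {X Y : Burnside G} (f : X ⟶ Y) :
    piMap (fun _ : I => f) ≫
      tr (⟨fun x => x default, fun _ _ => rfl⟩ : (pi fun _ : I => Y) →[G] Y) =
      tr (⟨fun x => x default, fun _ _ => rfl⟩ : (pi fun _ : I => X) →[G] X) ≫ f := by
  obtain ⟨a, rfl⟩ := exists_span f
  rw [piMap_hom]
  have hb : ∀ Z : Type, Function.Bijective fun x : I → Z => x default := fun Z =>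
    (Equiv.funUnique I Z).bijective
  exact tr_comm (Span.pi fun _ : I => a) a _ _ ⟨fun x => x default, fun _ _ => rfl⟩ (hb _) (hb _)
    (fun _ => rfl) (fun _ => rfl)

/-! ### The unit generates the norm and its box powers -/

section Unit

variable (p : ℕ)

/-- Finite covers of a finite set: a finite set over the underlying set of `T`, as a morphism from
the one-point set. -/
def coverHom (T : Burnside Unit) (U : Type) [Finite U] (π : U → T) : pt Unit ⟶ T :=
  let A : Burnside Unit :=
    { carrier := U
      action := { smul := fun _ x => x, one_smul := fun _ => rfl, mul_smul := fun _ _ _ => rfl } }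
  Span.hom ⟨A, toUnique A (pt Unit),
    @MulActionHom.mk Unit Unit id A A.action.toSMul T T.action.toSMul π
      fun _ u => (T.action.one_smul (π u)).symm⟩

theorem ringMackey_coverHom (A : Type) [CommRing A] (T : Burnside Unit) (U : Type) [Finite U]
    (π : U → T) (t : T) :
    (ringMackey A).map (coverHom T U π) (fun _ => 1) t = (Nat.card {u // π u = t} : A) := by
  change (∑ᶠ u : {u // π u = t}, (1 : A)) = (Nat.card {u // π u = t} : A)
  have := Fintype.ofFinite {u // π u = t}
  simp [finsum_eq_sum_of_fintype]

/-- The transfer of 1 along a cover counts the fibres modulo `p`, so it suffices to put over `t` as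
many points as the least residue of `m t`. -/
theorem exists_coverHom [NeZero p] (T : Burnside Unit) (m : T → ZMod p) :
    ∃ f : pt Unit ⟶ T, (ringMackey (ZMod p)).map f (fun _ => 1) = m := by
  refine ⟨coverHom T (Σ t : T, Fin (m t).val) Sigma.fst, funext fun t => ?_⟩
  rw [ringMackey_coverHom, Nat.card_congr (Equiv.sigmaSubtype t)]
  simp

variable (G : Type) [CommGroup G] [Finite G]

/-- `F(G, G/G)`, a one-point set. -/
abbrev coindPt : Burnside G := (coind G).obj (pt Unit)

/-- The norm of the field with `p` elements as a commutative Green functor. -/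
abbrev normZMod : CommGreen.{1} G := norm G (ringGreen (ZMod p))

/-- The unit of the norm. -/
def normOne : (normZMod p G).F.obj (coindPt G) :=
  lanMk (F := coind G) (M := ringMackey (ZMod p)) (pt Unit) (𝟙 _) (fun _ => 1)

variable {p G}

theorem normOne_map {X : Burnside G} (f : coindPt G ⟶ X) : (normZMod p G).F.map f (normOne p G) =
    lanMk (F := coind G) (M := ringMackey (ZMod p)) (pt Unit) f (fun _ => 1) := by
  refine (lan_map_mk (F := coind G) (M := ringMackey (ZMod p)) f _ _ _).trans ?_
  rw [Category.id_comp]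

/-- In a generator with coefficient `a_* 1`, the coend relation moves `a` from the coefficient to
the morphism, leaving the coefficient 1 on the one-point set. -/
theorem exists_normOne_map [NeZero p] {X : Burnside G} (x : (normZMod p G).F.obj X) :
    ∃ f : coindPt G ⟶ X, x = (normZMod p G).F.map f (normOne p G) := by
  induction x using lan_ind with | h T f m =>
  obtain ⟨a, rfl⟩ := exists_coverHom p T m
  exact ⟨(coind G).map a ≫ f, (lanMk_glue a f _).trans (normOne_map _).symm⟩

/-- A product of ones is one; all sets involved have one point, so the various identifications
combine to the only possible map. -/
theorem ext_normOne (I : Type) [Finite I] :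
    (normZMod p G).ext (fun _ : I => coindPt G) (fun _ => normOne p G) =
      (normZMod p G).F.map (tr (toUnique _ _)) (normOne p G) := by
  refine (normExt_mk G (ringGreen (ZMod p)) (fun _ : I => coindPt G) (fun _ => pt Unit)
    (fun _ => 𝟙 _) (fun _ _ => 1)).trans ?_
  have h1 : (ringGreen (ZMod p)).ext (fun _ : I => pt Unit) (fun _ _ => 1) =
      (ringMackey (ZMod p)).map (tr (toUnique (pt Unit) (pi fun _ : I => pt Unit)))
        (fun _ => 1) := by
    funext x
    refine finprod_one.trans ?_
    rw [Unique.eq_default x]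
    exact (ringMackey_tr (ZMod p) (toUnique (pt Unit) (pi fun _ : I => pt Unit))
      (Function.injective_of_subsingleton _) (fun _ => 1) ()).symm
  rw [h1, normOne_map]
  refine (lanMk_glue (F := coind G) (M := ringMackey (ZMod p)) _ _ _).trans ?_
  rw [piMap_id, Category.comp_id, coind_tr]
  refine congrArg (fun t => lanMk (F := coind G) (M := ringMackey (ZMod p)) (pt Unit) t _) ?_
  refine (tr_comp (S := coindPt G) _ _).trans ?_
  exact congrArg tr (eq_toUnique _)

/-- Translations of a one-point set are trivial. For this reason the twist of the nerve has no
effect. -/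
theorem act_normOne (γ : G) : act γ (normOne p G) = normOne p G := by
  unfold act
  rw [eq_toUnique (trans γ (coindPt G)), toUnique_self]
  exact (normZMod p G).F.map_id_apply _ _

/-- The classes `f_* (1 ⊗ ⋯ ⊗ 1)` in the box power of the norm. -/
def boxOne (p : ℕ) {I : Type} [Finite I] {X : Burnside G}
    (f : (pi fun _ : I => coindPt G) ⟶ X) : (boxPow I (normZMod p G).F).obj X :=
  boxMk (fun _ => coindPt G) f fun _ => normOne p G

variable {I J : Type} [Finite I] [Finite J] {X : Burnside G}

theorem boxOne_map {Y : Burnside G} (f : (pi fun _ : I => coindPt G) ⟶ X) (g : X ⟶ Y) :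
    (boxPow I (normZMod p G).F).map g (boxOne p f) = boxOne p (f ≫ g) := rfl

theorem boxMk_map_normOne {S : I → Burnside G} (f : ∀ i, coindPt G ⟶ S i) (s : pi S ⟶ X) :
    (boxMk S s fun i => (normZMod p G).F.map (f i) (normOne p G) :
      (boxPow I (normZMod p G).F).obj X) = boxOne p (piMap f ≫ s) :=
  boxMk_glue f s fun _ => normOne p G

/-- Each factor is a pushforward of the unit, and the coend relation of the box power collects these
pushforwards in a single morphism. -/
theorem exists_boxOne [NeZero p] (x : (boxPow I (normZMod p G).F).obj X) :
    ∃ f : (pi fun _ : I => coindPt G) ⟶ X, x = boxOne p f := by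
  induction x using box_ind with | h S s m =>
  choose f hf using fun i => exists_normOne_map (m i)
  obtain rfl : m = _ := funext hf
  exact ⟨_, boxMk_map_normOne f s⟩

/-- On unit classes the induced map depends neither on `φ` nor on `τ`: it only exchanges one
one-point source for another. -/
theorem pushApp_boxOne (φ : I → J) (τ : I → G) (f : (pi fun _ : I => coindPt G) ⟶ X) :
    pushApp (normZMod p G) φ τ X (boxOne p f) =
      boxOne p (tr (toUnique (pi fun _ : J => coindPt G) _) ≫ f) := by
  unfold boxOne
  rw [pushApp_mk]
  simp only [act_normOne, ext_normOne]
  refine (boxMk_map_normOne _ _).trans (congrArg (boxOne p) ?_)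
  rw [piMap_tr, res_eq_toUnique, ← Category.assoc, tr_comp, eq_toUnique (MulActionHom.comp _ _)]

theorem pushApp_pushApp [NeZero p] (φ : I → J) (τ : I → G) (ψ : J → I) (σ : J → G)
    (x : (boxPow I (normZMod p G).F).obj X) :
    pushApp (normZMod p G) ψ σ X (pushApp (normZMod p G) φ τ X x) = x := by
  obtain ⟨f, rfl⟩ := exists_boxOne x
  rw [pushApp_boxOne, pushApp_boxOne, ← Category.assoc, tr_comp,
    eq_toUnique (MulActionHom.comp _ _), toUnique_self, Category.id_comp]

theorem push_push [NeZero p] (φ : I → J) (τ : I → G) (ψ : J → I) (σ : J → G) :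
    push (normZMod p G) φ τ ≫ push (normZMod p G) ψ σ = 𝟙 _ :=
  NatTrans.ext (funext fun _ => ConcreteCategory.hom_ext _ _ fun x => pushApp_pushApp φ τ ψ σ x)

/-- Any map in the other direction induces the inverse; nonemptiness of `I` provides a constant one.
-/
theorem isIso_push [NeZero p] [Nonempty I] (φ : I → J) (τ : I → G) :
    IsIso (push (normZMod p G) φ τ) :=
  ⟨push (normZMod p G) (fun _ => Classical.arbitrary I) fun _ => 1, push_push .., push_push ..⟩

/-- The multiplication map from a box power of a commutative Green functor. -/
def boxMul (I : Type) [Finite I] (R : CommGreen.{1} G) : boxPow I R.F ⟶ R.F where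
  app X := ↾(lanDesc (F := piFunctor G I) (M := extPower I R.F) (H := R.F)
    (fun S m => R.ext S m) (fun f m => R.ext_map f m) X)
  naturality X Y f := by
    ext x
    exact lanDesc_natural (F := piFunctor G I) (M := extPower I R.F) (H := R.F)
      (fun S m => R.ext S m) (fun f m => R.ext_map f m) f x

theorem boxMul_boxOne (f : (pi fun _ : I => coindPt G) ⟶ X) :
    (boxMul I (normZMod p G)).app X (boxOne p f) =
      (normZMod p G).F.map (tr (toUnique _ _) ≫ f) (normOne p G) := by
  change (normZMod p G).F.map f ((normZMod p G).ext (fun _ : I => coindPt G) _) = _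
  rw [ext_normOne, Functor.map_comp_apply]

/-- The inverse places an element in the only factor. Both halves of the bijectivity are checked on
pushforwards of the unit. -/
theorem boxMul_bijective [NeZero p] [Unique I] (X : Burnside G) :
    Function.Bijective ((boxMul I (normZMod p G)).app X) := by
  refine ⟨Function.LeftInverse.injective (g := fun x => boxMk (fun _ => X)
    (tr ⟨fun x => x default, fun _ _ => rfl⟩) fun _ => x) fun x => ?_, fun x => ?_⟩
  · obtain ⟨f, rfl⟩ := exists_boxOne x
    rw [boxMul_boxOne]
    refine (boxMk_map_normOne _ _).trans (congrArg (boxOne p) ?_)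
    rw [piMap_tr_eval, ← Category.assoc, tr_comp, eq_toUnique (MulActionHom.comp _ _),
      toUnique_self, Category.id_comp]
  · obtain ⟨f, rfl⟩ := exists_normOne_map x
    refine ⟨boxOne p (tr (toUnique _ _) ≫ f), ?_⟩
    rw [boxMul_boxOne, ← Category.assoc, tr_comp, eq_toUnique (MulActionHom.comp _ _),
      toUnique_self, Category.id_comp]

/-- The box power of the norm indexed by a one-element set is the norm. -/
def boxMulIso (p : ℕ) [NeZero p] (I : Type) [Unique I] [Finite I] :
    boxPow I (normZMod p G).F ≅ (normZMod p G).F :=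
  NatIso.ofComponents (fun X => (Equiv.ofBijective _ (boxMul_bijective (I := I) X)).toIso)
    fun f => (boxMul I (normZMod p G)).naturality f

end Unit

/-! ### Geometric fixed points preserve the unit -/

section GeometricUnit

variable {p : ℕ} {G Q : Type} [CommGroup G] [CommGroup Q] [Finite G] [Finite Q]
  (q : G →* Q) (hq : Function.Surjective q) {I : Type} [Finite I] {X : Burnside G}

/-- The fixed points of a one-point set form a one-point set, and the coefficient 1 is left
unchanged. -/
theorem normFix_normOne : normFix q hq (ringGreen (ZMod p)) (coindPt G) (normOne p G) =
    (normZMod p Q).F.map (tr (toUnique _ ((fix q hq).obj (coindPt G)))) (normOne p Q) := by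
  refine Eq.trans ?_ (normOne_map _).symm
  refine (normFix_mk q hq (ringGreen (ZMod p)) (pt Unit) (𝟙 _) _).trans ?_
  rw [CategoryTheory.Functor.map_id, Category.comp_id]
  exact congrArg (fun t => lanMk (F := coind Q) (M := ringMackey (ZMod p)) (pt Unit) (tr t) _)
    (eq_toUnique (T := (fix q hq).obj (coindPt G)) _)

theorem boxFix_boxOne (f : (pi fun _ : I => coindPt G) ⟶ X) :
    boxFix q hq (ringGreen (ZMod p)) I X (boxOne p f) =
      boxOne p (tr (toUnique (pi fun _ : I => coindPt Q)
        ((fix q hq).obj (pi fun _ : I => coindPt G))) ≫ (fix q hq).map f) := by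
  unfold boxOne
  rw [boxFix_mk]
  simp only [normFix_normOne]
  refine (boxMk_map_normOne _ _).trans (congrArg (boxOne p) ?_)
  rw [piMap_tr, ← Category.assoc, tr_comp, eq_toUnique (MulActionHom.comp _ _)]

/-- The unit of the box power of the norm at the one-point set. -/
def boxUnit (p : ℕ) (G : Type) [CommGroup G] [Finite G] (I : Type) [Finite I] :
    (boxPow I (normZMod p G).F).obj (pt G) :=
  boxOne p (tr (toUnique _ _))

theorem map_boxFix_boxUnit :
    (boxPow I (normZMod p Q).F).map (tr (ptFix q hq))
      (boxFix q hq (ringGreen (ZMod p)) I (pt G) (boxUnit p G I)) = boxUnit p Q I := by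
  unfold boxUnit
  rw [boxFix_boxOne, boxOne_map, fix_tr]
  refine congrArg (boxOne p) ((congrArg (fun t => t ≫ _) (tr_comp (U := (fix q hq).obj (pt G))
    _ _)).trans ((tr_comp (T := (fix q hq).obj (pt G)) _ _).trans ?_))
  rw [eq_toUnique (MulActionHom.comp _ _)]

end GeometricUnit

/-! ### Normalized complexes of simplicial objects with invertible structure maps -/

section Moore

open Limits Opposite AlgebraicTopology
open scoped Simplicial

variable {C : Type*} [Category* C] [Abelian C] (X : SimplicialObject C)

/-- In positive degrees the normalized chains lie in the kernel of the face `d_1`, which is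
invertible, so their inclusion vanishes. -/
theorem isZero_normalizedMooreComplex_X
    (hX : ∀ {a b : SimplexCategoryᵒᵖ} (θ : a ⟶ b), IsIso (X.map θ))
    (k : ℕ) : IsZero (((normalizedMooreComplex C).obj X).X (k + 1)) := by
  have := hX (SimplexCategory.δ (Fin.succ (0 : Fin (k + 1)))).op
  have h : ((normalizedMooreComplex C).obj X).X (k + 1) =
    (NormalizedMooreComplex.objX X (k + 1) : C) := rfl
  rw [h]
  -- The normalized object is the intersection of the kernels of the faces other than `d_0`; only
  -- its containment in the kernel of `d_1` matters.
  have hd : (NormalizedMooreComplex.objX X (k + 1)).arrow ≫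
      X.δ (Fin.succ (0 : Fin (k + 1))) = 0 := by
    rw [NormalizedMooreComplex.objX_add_one,
      ← Subobject.factorThru_arrow _ _ (Subobject.finset_inf_arrow_factors Finset.univ
      (fun i : Fin (k + 1) => kernelSubobject (X.δ i.succ)) 0 (Finset.mem_univ _)), Category.assoc,
      kernelSubobject_arrow_comp, comp_zero]
  have h0 : (NormalizedMooreComplex.objX X (k + 1)).arrow = 0 := by
    have : Mono (X.δ (Fin.succ (0 : Fin (k + 1)))) :=
      inferInstanceAs (Mono (X.map (SimplexCategory.δ (Fin.succ (0 : Fin (k + 1)))).op))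
    exact zero_of_comp_mono _ hd
  refine (IsZero.iff_id_eq_zero _).2
    ((cancel_mono (NormalizedMooreComplex.objX X (k + 1)).arrow).1 ?_)
  rw [h0, comp_zero, comp_zero]

end Moore

/-! ### Homology of such simplicial abelian groups -/

section Homology

open Limits Opposite AlgebraicTopology
open scoped Simplicial

variable {X Y : SimplicialObject AddCommGrpCat.{1}}

theorem isZero_simplicialHomology (hX : ∀ {a b : SimplexCategoryᵒᵖ} (θ : a ⟶ b), IsIso (X.map θ))
    (k : ℕ) : IsZero ((simplicialHomology (k + 1)).obj X) :=
  HomologicalComplex.ExactAt.isZero_homology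
    (ShortComplex.exact_of_isZero_X₂ _ (isZero_normalizedMooreComplex_X X hX k))

/-- The homology in degree zero of a simplicial abelian group all of whose structure maps are
isomorphisms. -/
def simplicialHomologyZeroIso (X : SimplicialObject AddCommGrpCat.{1})
    (hX : ∀ {a b : SimplexCategoryᵒᵖ} (θ : a ⟶ b), IsIso (X.map θ)) :
    (simplicialHomology 0).obj X ≅ X.obj (op ⦋0⦌) :=
  (((normalizedMooreComplex _).obj X).isoHomologyπ 1 0 (by simp)
      ((isZero_normalizedMooreComplex_X X hX 0).eq_of_src _ _)).symm ≪≫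
    ((normalizedMooreComplex _).obj X).iCyclesIso 0 0 (by simp) (by simp) ≪≫
    @asIso _ _ _ _ (NormalizedMooreComplex.objX X 0).arrow (Subobject.isIso_top_arrow)

/-- Composed with the projection from cycles to homology, the comparison becomes the inclusion of
cycles followed by that of the Moore complex. Both inclusions are natural, and the projection can be
cancelled. -/
theorem simplicialHomologyZeroIso_naturality
    (hX : ∀ {a b : SimplexCategoryᵒᵖ} (θ : a ⟶ b), IsIso (X.map θ))
    (hY : ∀ {a b : SimplexCategoryᵒᵖ} (θ : a ⟶ b), IsIso (Y.map θ)) (f : X ⟶ Y) :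
    (simplicialHomology 0).map f ≫ (simplicialHomologyZeroIso Y hY).hom =
      (simplicialHomologyZeroIso X hX).hom ≫ f.app (op ⦋0⦌) := by
  have hπ := ((normalizedMooreComplex _).obj X).isIso_homologyπ 1 0 (by simp)
    ((isZero_normalizedMooreComplex_X X hX 0).eq_of_src _ _)
  refine (cancel_epi (((normalizedMooreComplex _).obj X).homologyπ 0)).1 ?_
  have h1 : ∀ (Z : SimplicialObject AddCommGrpCat.{1})
      (hZ : ∀ {a b : SimplexCategoryᵒᵖ} (θ : a ⟶ b), IsIso (Z.map θ)),
      ((normalizedMooreComplex _).obj Z).homologyπ 0 ≫ (simplicialHomologyZeroIso Z hZ).hom =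
        ((normalizedMooreComplex _).obj Z).iCycles 0 ≫ (inclusionOfMooreComplexMap Z).f 0 := by
    intro Z hZ
    rw [inclusionOfMooreComplexMap_f]
    exact HomologicalComplex.isoHomologyπ_hom_inv_id_assoc _ 1 0 (by simp)
      ((isZero_normalizedMooreComplex_X Z hZ 0).eq_of_src _ _) _
  have h2 := HomologicalComplex.homologyπ_naturality ((normalizedMooreComplex _).map f) 0
  have h3 := HomologicalComplex.cyclesMap_i ((normalizedMooreComplex _).map f) 0
  have h4 := HomologicalComplex.congr_hom
    ((inclusionOfMooreComplex AddCommGrpCat.{1}).naturality f) 0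
  change ((normalizedMooreComplex _).map f).f 0 ≫ (inclusionOfMooreComplexMap Y).f 0 =
    (inclusionOfMooreComplexMap X).f 0 ≫ f.app (op ⦋0⦌) at h4
  refine (Category.assoc _ _ _).symm.trans
    ((congrArg (fun t => t ≫ (simplicialHomologyZeroIso Y hY).hom) h2).trans
      ((Category.assoc _ _ _).trans ((congrArg (fun t => _ ≫ t) (h1 Y hY)).trans ?_)))
  rw [reassoc_of% h3, h4]
  exact (Category.assoc _ _ _).symm.trans
    ((congrArg (fun t => t ≫ f.app (op ⦋0⦌)) (h1 X hX)).symm.trans (Category.assoc _ _ _))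

end Homology

/-! ### The twisted cyclic nerve is constant up to isomorphism -/

section NerveConstant

open Limits Opposite
open scoped Simplicial

variable {p : ℕ} [NeZero p] {G : Type} [CommGroup G] [Finite G] (γ : G)

theorem isIso_twistedNerve_map {a b : SimplexCategoryᵒᵖ} (θ : a ⟶ b) :
    IsIso ((twistedNerve (normZMod p G) γ).map θ) :=
  isIso_push _ _

theorem isIso_evalNerve_map (X : Burnside G) {a b : SimplexCategoryᵒᵖ} (θ : a ⟶ b) :
    IsIso (((evalNerve (relativeNerve G γ (ZMod p))).obj X).map θ) := by
  have := isIso_twistedNerve_map (p := p) γ θ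
  exact inferInstanceAs (IsIso (((additivization G).map
    ((twistedNerve (normZMod p G) γ).map θ)).app X))

theorem isZero_HH (k : ℕ) (hk : 0 < k) : IsZero (HH G γ (ZMod p) k) := by
  obtain ⟨k, rfl⟩ := Nat.exists_eq_succ_of_ne_zero hk.ne'
  exact (Functor.isZero_iff _).2 fun X =>
    isZero_simplicialHomology (fun θ => isIso_evalNerve_map γ X θ) k

/-- The zeroth twisted Hochschild homology is the zeroth level of the nerve. -/
def HHZeroIsoNerve (p : ℕ) [NeZero p] (γ : G) : HH G γ (ZMod p) 0 ≅
    (additivization G).obj (boxPow (Fin 1) (normZMod p G).F) :=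
  NatIso.ofComponents (fun X => simplicialHomologyZeroIso _ fun θ => isIso_evalNerve_map γ X θ)
    fun f => simplicialHomologyZeroIso_naturality _ _
      ((evalNerve (relativeNerve G γ (ZMod p))).map f)

/-- The zeroth twisted Hochschild homology of the field with `p` elements is the norm. -/
def HHZeroIso (p : ℕ) [NeZero p] (γ : G) : HH G γ (ZMod p) 0 ≅ normMackey G (ZMod p) :=
  HHZeroIsoNerve p γ ≪≫ (additivization G).mapIso (boxMulIso p (Fin 1))

end NerveConstant

/-! ### Congruences for sums of products over orbits -/

section Counting

variable {p n : ℕ} {G : Type} [Group G]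

/-- Every fibre of `g ↦ g • y` over the orbit is a coset of the stabilizer, so each value occurs as
often as the stabilizer has elements. -/
theorem prod_smul_eq_pow {Y : Type*} [Fintype G] [MulAction G Y] [DecidableEq Y] (ν : Y → ℤ)
    (y : Y) : ∏ g : G, ν (g • y) =
      (∏ z ∈ Finset.univ.image fun g : G => g • y, ν z) ^ Nat.card (MulAction.stabilizer G y) := by
  rw [Finset.prod_comp ν fun g : G => g • y, ← Finset.prod_pow]
  refine Finset.prod_congr rfl fun z hz => congrArg (fun k => ν z ^ k) ?_
  obtain ⟨h, -, rfl⟩ := Finset.mem_image.1 hz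
  refine (Nat.subtype_card (p := fun g : G => g • y = h • y) _ (by simp)).symm.trans
    (Nat.card_congr ((Equiv.mulLeft h⁻¹).subtypeEquiv fun g => ?_))
  rw [MulAction.mem_stabilizer_iff, Equiv.coe_mulLeft, mul_smul, inv_smul_eq_iff]

theorem card_orbit_mul_card_stabilizer {Y : Type*} [MulAction G Y] (y : Y) :
    Nat.card (MulAction.orbit G y) * Nat.card (MulAction.stabilizer G y) = Nat.card G := by
  rw [← Nat.card_prod]
  exact Nat.card_congr (MulAction.orbitProdStabilizerEquivGroup G y)

variable [Fact p.Prime]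

/-- The orbit has length `p ^ a` and the stabilizer order `p ^ k` with `a + k = n`. Raising a
congruence modulo `p` to the power `p ^ k` makes it hold modulo `p ^ (k + 1)`, and the length of the
orbit supplies the missing factor `p ^ a`. -/
theorem pow_dvd_card_mul_sub {Y : Type*} [Fintype G] [MulAction G Y] [Finite Y]
    (hG : Nat.card G = p ^ n) (ν ν' : Y → ℤ) (h : ∀ y, (p : ℤ) ∣ ν y - ν' y) (y : Y) :
    (p : ℤ) ^ (n + 1) ∣ Nat.card (MulAction.orbit G y) * (∏ g : G, ν (g • y)) -
      Nat.card (MulAction.orbit G y) * (∏ g : G, ν' (g • y)) := by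
  classical
  have hc := (card_orbit_mul_card_stabilizer y).trans hG
  obtain ⟨a, -, ha⟩ := (Nat.dvd_prime_pow (Fact.out : p.Prime)).1 (Dvd.intro _ hc)
  obtain ⟨k, -, hk⟩ := (Nat.dvd_prime_pow (Fact.out : p.Prime)).1 (Dvd.intro_left _ hc)
  have hak : n + 1 = a + (k + 1) := by
    rw [ha, hk, ← pow_add] at hc
    have := Nat.pow_right_injective (Fact.out : p.Prime).two_le hc
    omega
  rw [prod_smul_eq_pow, prod_smul_eq_pow, hk, ha, ← mul_sub, hak, pow_add, Nat.cast_pow]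
  refine mul_dvd_mul_left _ (dvd_sub_pow_of_dvd_sub ?_ k)
  rw [← ZMod.intCast_zmod_eq_zero_iff_dvd, Int.cast_sub, sub_eq_zero, Int.cast_prod, Int.cast_prod]
  refine Finset.prod_congr rfl fun z _ => ?_
  rw [← sub_eq_zero, ← Int.cast_sub, ZMod.intCast_zmod_eq_zero_iff_dvd]
  exact h z

theorem sum_prod_smul_congr {Y : Type*} [Fintype G] [MulAction G Y] [Fintype Y]
    (hG : Nat.card G = p ^ n) (ν ν' : Y → ℤ) (h : ∀ y, (p : ℤ) ∣ ν y - ν' y) :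
    (p : ℤ) ^ (n + 1) ∣ ∑ y, ∏ g : G, ν (g • y) - ∑ y, ∏ g : G, ν' (g • y) := by
  classical
  -- The product over the group is constant on orbits, so each orbit contributes its length times
  -- the product at a representative.
  have key : ∀ μ : Y → ℤ, ∑ y, ∏ g : G, μ (g • y) =
      ∑ ω : MulAction.orbitRel.Quotient G Y,
        Nat.card (MulAction.orbit G ω.out) * ∏ g : G, μ (g • ω.out) := by
    intro μ
    refine (Fintype.sum_equiv (MulAction.selfEquivSigmaOrbits G Y) _
      (fun x => ∏ g : G, μ (g • x.2.1)) fun y => rfl).trans ?_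
    rw [← Finset.univ_sigma_univ, Finset.sum_sigma]
    refine Finset.sum_congr rfl fun ω _ => ?_
    rw [Finset.sum_congr rfl (g := fun _ => ∏ g : G, μ (g • ω.out)), Finset.sum_const,
      nsmul_eq_mul, Nat.card_eq_fintype_card, Finset.card_univ]
    rintro ⟨_, γ, rfl⟩ -
    exact Fintype.prod_equiv (Equiv.mulRight γ) _ _ fun g => by simp [mul_smul]
  rw [key, key, ← Finset.sum_sub_distrib]
  exact Finset.dvd_sum fun ω _ => pow_dvd_card_mul_sub hG ν ν' h _

theorem finsum_finprod_smul_congr [Finite G] {Y : Type*} [MulAction G Y] [Finite Y]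
    (hG : Nat.card G = p ^ n) (ν ν' : Y → ℕ) (h : ∀ y, (ν y : ZMod p) = ν' y) :
    ∑ᶠ y, ∏ᶠ g : G, (ν (g • y) : ZMod (p ^ (n + 1))) =
      ∑ᶠ y, ∏ᶠ g : G, (ν' (g • y) : ZMod (p ^ (n + 1))) := by
  have := Fintype.ofFinite Y
  have := Fintype.ofFinite G
  have key := sum_prod_smul_congr hG (fun y => (ν y : ℤ)) (fun y => (ν' y : ℤ)) fun y => by
    rw [← ZMod.intCast_zmod_eq_zero_iff_dvd]
    push_cast
    rw [h, sub_self]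
  rw [show (p : ℤ) ^ (n + 1) = ((p ^ (n + 1) : ℕ) : ℤ) by push_cast; rfl,
    ← ZMod.intCast_zmod_eq_zero_iff_dvd, Int.cast_sub, sub_eq_zero] at key
  simp only [finsum_eq_sum_of_fintype, finprod_eq_prod_of_fintype]
  push_cast at key
  exact key

end Counting

/-! ### The weighted cardinality on the norm -/

section NormCard

variable {p : ℕ} (n : ℕ) {G : Type} [CommGroup G] [Finite G] {X : Burnside G}

/-- The function underlying a point of `F(G, T)`. -/
def coindFun {T : Burnside Unit} (x : (coind G).obj T) : G → T := x

/-- The number of points of the apex of a span out of `F(G, T)`, weighted by the norms of the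
values of `m`, modulo `p ^ (n + 1)`. -/
def weightedCard {T : Burnside Unit} (m : T → ZMod p) (f : (coind G).obj T ⟶ X) :
    ZMod (p ^ (n + 1)) :=
  Quotient.lift (fun a : Span ((coind G).obj T) X =>
    ∑ᶠ y : a.apex, ∏ᶠ g : G, ((m (coindFun (a.fst y) g)).val : ZMod (p ^ (n + 1)))) (by
      rintro a b ⟨e, he, h1, -⟩
      exact finsum_eq_of_bijective e he fun y => by rw [h1]) f

theorem weightedCard_hom {T : Burnside Unit} (m : T → ZMod p) (a : Span ((coind G).obj T) X) :
    weightedCard n m a.hom = ∑ᶠ y : a.apex, ∏ᶠ g : G,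
      ((m (coindFun (a.fst y) g)).val : ZMod (p ^ (n + 1))) := rfl

theorem weightedCard_add {T : Burnside Unit} (m : T → ZMod p) (f f' : (coind G).obj T ⟶ X) :
    weightedCard n m (f + f') = weightedCard n m f + weightedCard n m f' := by
  obtain ⟨a, rfl⟩ := exists_span f
  obtain ⟨a', rfl⟩ := exists_span f'
  rw [hom_add]
  simp only [weightedCard_hom]
  have := Fintype.ofFinite a.apex
  have := Fintype.ofFinite a'.apex
  let : Fintype (a.add a').apex := inferInstanceAs (Fintype (a.apex ⊕ a'.apex))
  simp only [finsum_eq_sum_of_fintype]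
  exact Fintype.sum_sum_type fun y : a.apex ⊕ a'.apex => ∏ᶠ g : G,
    ((m (coindFun ((a.add a').fst y) g)).val : ZMod (p ^ (n + 1)))

variable [Fact p.Prime]

/-- Compatibility with the coend relation. Expanding the product of the fibre sums gives a sum over
the points of the pullback, but the coefficients on the left are least residues of the fibre sums
rather than these sums themselves. The two agree modulo `p`, which suffices by the orbit congruence.
-/
theorem weightedCard_map (hG : Nat.card G = p ^ n) {S T : Burnside Unit} (a : S ⟶ T)
    (m : S → ZMod p) (f : (coind G).obj T ⟶ X) :
    weightedCard n ((ringMackey (ZMod p)).map a m) f = weightedCard n m ((coind G).map a ≫ f) := by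
  classical
  obtain ⟨a, rfl⟩ := exists_span a
  obtain ⟨b, rfl⟩ := exists_span f
  refine (weightedCard_hom n _ b).trans
    (Eq.trans ?_ (weightedCard_hom n m (Span.comp (Span.coind G a) b)).symm)
  -- An equivariant map to `F(G, T)` is determined by its evaluation at 1. The weights thereby
  -- become products over `g` of a function of `g • y`, as the orbit congruence requires.
  let ev : b.apex → T := fun y => coindFun (b.fst y) 1
  have hev : ∀ (y : b.apex) (g : G), coindFun (b.fst y) g = ev (g • y) := by
    intro y g
    have : coindFun (b.fst (g • y)) = fun x => coindFun (b.fst y) (x * g) :=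
      b.fst.map_smul g y
    change _ = coindFun (b.fst (g • y)) 1
    rw [this]
    exact congrArg _ (one_mul g).symm
  have h1 := finsum_finprod_smul_congr (Y := b.apex) hG
    (fun y => ((ringMackey (ZMod p)).map a.hom m (ev y)).val)
    (fun y => ∑ᶠ u : {u : a.apex // a.snd u = ev y}, (m (a.fst u)).val) (by
      intro y
      rw [ZMod.natCast_zmod_val, ringMackey_hom]
      have := Fintype.ofFinite {u : a.apex // a.snd u = ev y}
      simp [finsum_eq_sum_of_fintype])
  simp only [hev]
  refine h1.trans ?_
  have := Fintype.ofFinite G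
  have := Fintype.ofFinite b.apex
  have : ∀ t, Fintype {u : a.apex // a.snd u = t} := fun t => Fintype.ofFinite _
  simp only [finsum_eq_sum_of_fintype, finprod_eq_prod_of_fintype]
  push_cast
  simp only [Fintype.prod_sum]
  rw [← Fintype.sum_sigma', ← finsum_eq_sum_of_fintype]
  symm
  -- A choice, for every `g`, of a point of the apex of `a` over `ev (g • y)` is a function on `G`
  -- that lies over `b.fst y`, so together with `y` it is a point of the pullback.
  refine finsum_eq_of_bijective (fun w : (Span.comp (Span.coind G a) b).apex => ⟨w.1.2, fun g =>
    ⟨(show G → a.apex from w.1.1) g, (congrFun w.2 g).trans (hev _ _)⟩⟩) ⟨?_, ?_⟩ fun _ => rfl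
  · rintro ⟨⟨w, y⟩, h⟩ ⟨⟨w', y'⟩, h'⟩ e
    have e1 : y = y' := congrArg Sigma.fst e
    subst e1
    have e2 := eq_of_heq (Sigma.mk.inj e).2
    have e3 : w = w' := funext fun g => congrArg Subtype.val (congrFun e2 g)
    subst e3
    rfl
  · rintro ⟨y, w⟩
    exact ⟨⟨(fun g => (w g).1, y), funext fun g => (w g).2.trans (hev _ _).symm⟩, rfl⟩

/-- The weighted cardinality of classes in the norm. -/
def normCard (hG : Nat.card G = p ^ n) (X : Burnside G) :
    (normZMod p G).F.obj X → ZMod (p ^ (n + 1)) :=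
  Quot.lift (fun x => weightedCard n x.val x.hom) (by
    rintro _ _ ⟨a, f, m⟩
    exact weightedCard_map n hG a m f)

theorem normCard_mk (hG : Nat.card G = p ^ n) (T : Burnside Unit) (f : (coind G).obj T ⟶ X)
    (m : T → ZMod p) : normCard n hG X (lanMk (F := coind G) (M := ringMackey (ZMod p)) T f m) =
      weightedCard n m f := rfl

/-- The weighted cardinality as a homomorphism on the values of the norm Mackey functor. -/
def normCardHom (hG : Nat.card G = p ^ n) (X : Burnside G) :
    addObj (normZMod p G).F X →+ ZMod (p ^ (n + 1)) :=
  QuotientAddGroup.lift _ (FreeAbelianGroup.lift (normCard n hG X)) (by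
    rw [addRel, AddSubgroup.closure_le]
    rintro _ ⟨Z, s, t, z, rfl⟩
    change FreeAbelianGroup.lift (normCard n hG X) _ = 0
    rw [map_sub, map_add, FreeAbelianGroup.lift_apply_of, FreeAbelianGroup.lift_apply_of,
      FreeAbelianGroup.lift_apply_of, sub_eq_zero]
    induction z using lan_ind with | h T f m =>
    change weightedCard n m (f ≫ (s + t)) = weightedCard n m (f ≫ s) + weightedCard n m (f ≫ t)
    rw [comp_add]
    exact weightedCard_add n m _ _)

theorem normCardHom_mk (hG : Nat.card G = p ^ n) (x : (normZMod p G).F.obj X) :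
    normCardHom n hG X (QuotientAddGroup.mk (FreeAbelianGroup.of x)) = normCard n hG X x :=
  FreeAbelianGroup.lift_apply_of _ _

end NormCard

/-! ### Constructions with finite `G`-sets, and subgroups of cyclic groups -/

namespace Burnside

variable {G : Type} [Group G]

/-- An invariant subset of a finite `G`-set. -/
def sub (Y : Burnside G) (P : Y → Prop) (hP : ∀ (g : G) y, P (g • y) ↔ P y) : Burnside G where
  carrier := {y : Y // P y}
  action :=
    { smul := fun g y => ⟨g • y.1, (hP g y.1).2 y.2⟩
      one_smul := fun y => Subtype.ext (one_smul G y.1)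
      mul_smul := fun g h y => Subtype.ext (mul_smul g h y.1) }

/-- The inclusion of an invariant subset. -/
def subHom (Y : Burnside G) (P : Y → Prop) (hP : ∀ (g : G) y, P (g • y) ↔ P y) :
    sub Y P hP →[G] Y :=
  ⟨fun y => y.1, fun _ _ => rfl⟩

/-- The disjoint union of two finite `G`-sets. -/
def sum (Y Z : Burnside G) : Burnside G where
  carrier := Y ⊕ Z

/-- The product of a finite `G`-set with a finite set with trivial action. -/
def prodFin (Y : Burnside G) (k : ℕ) : Burnside G where
  carrier := Y × Fin k
  action :=
    { smul := fun g y => (g • y.1, y.2)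
      one_smul := fun y => Prod.ext (one_smul G y.1) rfl
      mul_smul := fun g h y => Prod.ext (mul_smul g h y.1) rfl }

theorem card_orbit_map {Y Z : Burnside G} (f : Y →[G] Z) (hf : Function.Injective f) (y : Y) :
    Nat.card (MulAction.orbit G (f y)) = Nat.card (MulAction.orbit G y) := by
  have : MulAction.orbit G (f y) = f '' MulAction.orbit G y := by
    ext z
    constructor
    · rintro ⟨g, rfl⟩
      exact ⟨g • y, ⟨g, rfl⟩, f.map_smul g y⟩
    · rintro ⟨_, ⟨g, rfl⟩, rfl⟩
      exact ⟨g, (f.map_smul g y).symm⟩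
  rw [this]
  exact Nat.card_image_of_injective hf _

theorem card_orbit_of_isPretransitive {Y : Type} [MulAction G Y] [MulAction.IsPretransitive G Y]
    (y : Y) : Nat.card (MulAction.orbit G y) = Nat.card Y := by
  rw [MulAction.orbit_eq_univ, Nat.card_univ]

end Burnside

/-- Each of the two subgroups consists of solutions of `x ^ d = 1` for the common order `d`, and a
cyclic group has at most `d` such solutions. -/
theorem subgroup_eq_of_card_eq {G : Type} [Group G] [Finite G] [IsCyclic G] {H K : Subgroup G}
    (h : Nat.card H = Nat.card K) : H = K := by
  classical
  have := Fintype.ofFinite G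
  have key : ∀ L : Subgroup G, Nat.card L = Nat.card H →
      (L : Set G) = (Finset.univ.filter fun x : G => x ^ Nat.card H = 1) := by
    intro L hL
    refine Set.eq_of_subset_of_ncard_le (fun x hx => ?_) ?_ (Set.toFinite _)
    · have := pow_card_eq_one' (x := (⟨x, hx⟩ : L))
      rw [hL] at this
      simpa using congrArg Subtype.val this
    · rw [Set.ncard_coe_finset]
      refine (IsCyclic.card_pow_eq_one_le Nat.card_pos).trans ?_
      rw [← hL]
      exact (Nat.card_coe_set_eq (L : Set G)).le
  exact SetLike.coe_injective ((key H rfl).trans (key K h.symm).symm)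

/-! ### Classes of finite `G`-sets in the norm -/

section GSetClass

variable {p : ℕ} {G : Type} [CommGroup G] [Finite G]

/-- A finite `G`-set as a morphism of the Burnside category between one-point sets. -/
def gsetHom (Y : Burnside G) : coindPt G ⟶ pt G :=
  Span.hom ⟨Y, toUnique _ _, toUnique _ _⟩

/-- The class of a finite `G`-set in the value of the norm Mackey functor at the one-point set. -/
def gsetClass (p : ℕ) (Y : Burnside G) : addObj (normZMod p G).F (pt G) :=
  QuotientAddGroup.mk (FreeAbelianGroup.of ((normZMod p G).F.map (gsetHom Y) (normOne p G)))

theorem gsetHom_congr {Y Z : Burnside G} (e : Y →[G] Z) (he : Function.Bijective e) :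
    gsetHom Y = gsetHom Z :=
  hom_eq e he (fun _ => Subsingleton.elim (α := coindPt G) _ _) fun _ => rfl

theorem gsetClass_congr {Y Z : Burnside G} (e : Y →[G] Z) (he : Function.Bijective e) :
    gsetClass p Y = gsetClass p Z := by
  unfold gsetClass
  rw [gsetHom_congr e he]

theorem hom_eq_gsetHom (a : Span (coindPt G) (pt G)) : a.hom = gsetHom a.apex :=
  hom_eq (MulActionHom.id G) Function.bijective_id
    (fun _ => Subsingleton.elim (α := coindPt G) _ _) fun _ => rfl

theorem gsetClass_sum (Y Z : Burnside G) :
    gsetClass p (sum Y Z) = gsetClass p Y + gsetClass p Z := by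
  have h : gsetHom (sum Y Z) = gsetHom Y + gsetHom Z := (hom_eq_gsetHom
    (Span.add ⟨Y, toUnique _ _, toUnique _ _⟩ ⟨Z, toUnique _ _, toUnique _ _⟩)).symm
  unfold gsetClass
  rw [h, ← QuotientAddGroup.mk_add, ← sub_eq_zero, ← QuotientAddGroup.mk_sub]
  exact (QuotientAddGroup.eq_zero_iff _).2 (AddSubgroup.subset_closure ⟨_, _, _, _, rfl⟩)

theorem gsetClass_of_isEmpty (Y : Burnside G) [IsEmpty Y] : gsetClass p Y = 0 := by
  have : IsEmpty (sum Y Y) := inferInstanceAs (IsEmpty (Y ⊕ Y))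
  have h := gsetClass_sum (p := p) Y Y
  rw [gsetClass_congr (Y := sum Y Y) (Z := Y) ⟨fun x => isEmptyElim x, fun _ x => isEmptyElim x⟩
    ⟨fun x => isEmptyElim x, fun x => isEmptyElim x⟩] at h
  exact left_eq_add.1 h

theorem gsetClass_split (Y : Burnside G) (P : Y → Prop) (hP : ∀ (g : G) y, P (g • y) ↔ P y) :
    gsetClass p Y = gsetClass p (sub Y P hP) +
      gsetClass p (sub Y (fun y => ¬ P y) fun g y => not_congr (hP g y)) := by
  classical
  rw [← gsetClass_sum]
  symm
  refine gsetClass_congr ⟨Sum.elim (fun y => y.1) fun y => y.1, ?_⟩ (Equiv.sumCompl P).bijective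
  rintro g (y | y) <;> rfl

theorem gsetClass_prodFin (Y : Burnside G) (k : ℕ) :
    gsetClass p (prodFin Y k) = k • gsetClass p Y := by
  induction k with
  | zero =>
    have : IsEmpty (prodFin Y 0) := inferInstanceAs (IsEmpty (Y × Fin 0))
    rw [gsetClass_of_isEmpty, zero_smul]
  | succ k ih =>
    rw [succ_nsmul, ← ih, ← gsetClass_sum]
    symm
    refine gsetClass_congr ⟨Sum.elim (fun y => (y.1, y.2.castSucc)) fun y => (y, Fin.last k), ?_⟩
      ⟨?_, ?_⟩
    · rintro g (y | y) <;> rfl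
    · rintro (⟨y, i⟩ | y) (⟨y', i'⟩ | y') h
      · obtain ⟨rfl, h⟩ := Prod.ext_iff.1 h
        obtain rfl := Fin.castSucc_injective _ h
        rfl
      · exact absurd (Prod.ext_iff.1 h).2 (Fin.castSucc_lt_last i).ne
      · exact absurd (Prod.ext_iff.1 h).2 (Fin.castSucc_lt_last i').ne'
      · obtain ⟨rfl, h⟩ := Prod.ext_iff.1 h
        rfl
    · rintro ⟨y, i⟩
      induction i using Fin.lastCases with
      | last => exact ⟨Sum.inr y, rfl⟩
      | cast i => exact ⟨Sum.inl (y, i), rfl⟩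

/-- The sections over orbits of a finite cover of the set underlying a finite `G`-set. -/
def orbitSections (Y : Burnside G) {U : Type} [Finite U] (π : U → Y) : Burnside G where
  carrier := {x : (G → U) × Y // ∀ g, π (x.1 g) = g • x.2}
  action :=
    { smul := fun γ x => ⟨(fun g => x.1.1 (g * γ), γ • x.1.2), fun g => by
        rw [x.2, mul_smul]⟩
      one_smul := fun x => Subtype.ext (Prod.ext (funext fun g => congrArg x.1.1 (mul_one g))
        (one_smul G x.1.2))
      mul_smul := fun γ δ x => Subtype.ext (Prod.ext
        (funext fun g => congrArg x.1.1 (mul_assoc g γ δ).symm) (mul_smul γ δ x.1.2)) }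

/-- The set underlying a finite `G`-set. -/
def underlying (Y : Burnside G) : Burnside Unit where
  carrier := Y
  action := { smul := fun _ y => y, one_smul := fun _ => rfl, mul_smul := fun _ _ _ => rfl }

/-- The span `F(G, Y) ← Y → pt`, whose first map is adjoint to the identity. -/
def underlyingSpan (Y : Burnside G) : Span ((coind G).obj (underlying Y)) (pt G) where
  apex := Y
  fst := ⟨fun y (g : G) => g • y, fun γ y => funext fun g => smul_smul g γ y⟩
  snd := toUnique _ _

/-- The pullback consists of functions `G → U` that lie over an orbit map `g ↦ g • y`, which are the
sections over orbits. -/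
theorem coind_coverHom_comp (Y : Burnside G) {U : Type} [Finite U] (π : U → Y) :
    (coind G).map (coverHom (underlying Y) U π) ≫ (underlyingSpan Y).hom =
      gsetHom (orbitSections Y π) := by
  refine (hom_eq_gsetHom (Span.comp (Span.coind G _) (underlyingSpan Y))).trans ?_
  refine gsetHom_congr ⟨fun x => ⟨x.1, fun g => congrFun x.2 g⟩, fun _ _ => rfl⟩ ⟨?_, ?_⟩
  · intro x y h
    exact Subtype.ext (congrArg (fun t : orbitSections Y π => t.1) h)
  · rintro ⟨x, h⟩
    exact ⟨⟨x, funext h⟩, rfl⟩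

/-- The source of the relations used between classes of `G`-sets: by the coend relation, the class
of the sections depends on the cover only through the function that counts its fibres modulo `p`. -/
theorem gsetClass_orbitSections (Y : Burnside G) {U V : Type} [Finite U] [Finite V] (π : U → Y)
    (ρ : V → Y) (h : ∀ y, (Nat.card {u // π u = y} : ZMod p) = Nat.card {v // ρ v = y}) :
    gsetClass p (orbitSections Y π) = gsetClass p (orbitSections Y ρ) := by
  have key : ∀ (W : Type) [Finite W] (σ : W → Y),
      (normZMod p G).F.map (gsetHom (orbitSections Y σ)) (normOne p G) =
        lanMk (F := coind G) (M := ringMackey (ZMod p)) (underlying Y) (underlyingSpan Y).hom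
          ((ringMackey (ZMod p)).map (coverHom (underlying Y) W σ) fun _ => 1) := by
    intro W _ σ
    refine Eq.trans ?_ (lanMk_glue (F := coind G) (M := ringMackey (ZMod p)) _ _ _).symm
    rw [normOne_map]
    exact congrArg (fun t => lanMk (F := coind G) (M := ringMackey (ZMod p)) (pt Unit) t _)
      (coind_coverHom_comp Y σ).symm
  unfold gsetClass
  rw [key, key]
  refine congrArg (fun m => (QuotientAddGroup.mk (FreeAbelianGroup.of
    (lanMk (F := coind G) (M := ringMackey (ZMod p)) (underlying Y) (underlyingSpan Y).hom m)) :
      addObj (normZMod p G).F (pt G))) (funext fun y => ?_)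
  exact (ringMackey_coverHom _ (underlying Y) U π y).trans
    ((h y).trans (ringMackey_coverHom _ (underlying Y) V ρ y).symm)

/-- The stabilizers of points of `Y` and `Z` have equal orders, hence coincide as `G` is cyclic, so
the two sets are isomorphic. -/
theorem gsetClass_eq_of_isPretransitive [IsCyclic G] (Y Z : Burnside G) [Nonempty Y]
    [MulAction.IsPretransitive G Y] [MulAction.IsPretransitive G Z]
    (h : Nat.card Y = Nat.card Z) : gsetClass p Y = gsetClass p Z := by
  obtain ⟨y⟩ := ‹Nonempty Y›
  have : Nonempty Z := (Nat.card_pos_iff.1 (h ▸ Nat.card_pos_iff.2 ⟨⟨y⟩, inferInstance⟩)).1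
  obtain ⟨z⟩ := this
  have hyz : MulAction.stabilizer G y = MulAction.stabilizer G z := by
    refine subgroup_eq_of_card_eq ?_
    have h1 := card_orbit_mul_card_stabilizer (G := G) y
    have h2 := card_orbit_mul_card_stabilizer (G := G) z
    rw [card_orbit_of_isPretransitive] at h1 h2
    rw [← h2, h] at h1
    exact Nat.eq_of_mul_eq_mul_left (Nat.card_pos_iff.2 ⟨⟨z⟩, inferInstance⟩) h1
  choose γ hγ using fun w : Y => MulAction.exists_smul_eq G y w
  have hf : ∀ (g : G) (w : Y), g • y = w → g • z = γ w • z := by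
    intro g w hw
    have : (γ w)⁻¹ * g ∈ MulAction.stabilizer G y := by
      rw [MulAction.mem_stabilizer_iff, mul_smul, hw, inv_smul_eq_iff, hγ]
    rw [hyz, MulAction.mem_stabilizer_iff, mul_smul, inv_smul_eq_iff] at this
    exact this
  refine gsetClass_congr ⟨fun w => γ w • z, fun g w => ?_⟩ ?_
  · rw [id, smul_smul]
    exact (hf _ _ (by rw [mul_smul, hγ])).symm
  · refine (Nat.bijective_iff_surjective_and_card _).2 ⟨fun w => ?_, h⟩
    obtain ⟨g, rfl⟩ := MulAction.exists_smul_eq G z w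
    exact ⟨g • y, (hf g _ rfl).symm⟩

end GSetClass

/-! ### The norm at the one-point set: the orbit filtration -/

section Injectivity

variable {p n : ℕ} {G : Type} [CommGroup G] [Finite G]

theorem normCardHom_gsetClass [Fact p.Prime] (hG : Nat.card G = p ^ n) (Y : Burnside G) :
    normCardHom n hG (pt G) (gsetClass p Y) = Nat.card Y := by
  have := Fintype.ofFinite Y
  unfold gsetClass
  rw [normCardHom_mk, normOne_map]
  refine (normCard_mk n hG _ _ _).trans ?_
  refine (weightedCard_hom n _ _).trans ?_
  -- Ensures that the least residue of 1 is 1, so that all weights are 1.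
  have : Fact (1 < p) := ⟨(Fact.out : p.Prime).one_lt⟩
  simp only [ZMod.val_one, Nat.cast_one, finprod_one]
  change (∑ᶠ _ : Y, (1 : ZMod (p ^ (n + 1)))) = _
  simp [finsum_eq_sum_of_fintype, Nat.card_eq_fintype_card]

/-- The subgroup generated by the classes of transitive `G`-sets of cardinality divisible
by `p ^ j`. -/
def orbitFiltration (p : ℕ) (G : Type) [CommGroup G] [Finite G] (j : ℕ) :
    AddSubgroup (addObj (normZMod p G).F (pt G)) :=
  AddSubgroup.closure {x | ∃ Y : Burnside G, Nonempty Y ∧ MulAction.IsPretransitive G Y ∧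
    p ^ j ∣ Nat.card Y ∧ x = gsetClass p Y}

/-- Induction on the cardinality, splitting off one orbit at a time. -/
theorem gsetClass_mem_orbitFiltration (j : ℕ) (Y : Burnside G)
    (hY : ∀ y : Y, p ^ j ∣ Nat.card (MulAction.orbit G y)) :
    gsetClass p Y ∈ orbitFiltration p G j := by
  induction hk : Nat.card Y using Nat.strong_induction_on generalizing Y with | _ k ih =>
  subst hk
  rcases isEmpty_or_nonempty Y with h | ⟨⟨y⟩⟩
  · rw [gsetClass_of_isEmpty]
    exact zero_mem _
  have hP : ∀ (g : G) (z : Y), g • z ∈ MulAction.orbit G y ↔ z ∈ MulAction.orbit G y :=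
    fun g z => by rw [← MulAction.orbit_eq_iff, MulAction.orbit_smul, MulAction.orbit_eq_iff]
  rw [gsetClass_split Y (fun z => z ∈ MulAction.orbit G y) hP]
  refine add_mem ?_ (ih _ ?_ _ (fun z => ?_) rfl)
  · refine AddSubgroup.subset_closure ⟨sub Y _ hP, ⟨⟨y, MulAction.mem_orbit_self y⟩⟩, ⟨?_⟩,
      hY y, rfl⟩
    rintro ⟨_, g, rfl⟩ ⟨_, h, rfl⟩
    exact ⟨h * g⁻¹, Subtype.ext (by
      change (h * g⁻¹) • g • y = h • y
      rw [smul_smul, inv_mul_cancel_right])⟩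
  · exact Finite.card_subtype_lt (x := y) (fun h => h (MulAction.mem_orbit_self y))
  · rw [← card_orbit_map (subHom Y _ _) Subtype.val_injective]
    exact hY _

variable [Fact p.Prime]

theorem orbitFiltration_zero : orbitFiltration p G 0 = ⊤ := by
  refine top_le_iff.1 fun z hz => ?_
  clear hz
  induction z using QuotientAddGroup.induction_on with | H z =>
  induction z using FreeAbelianGroup.induction_on with
  | zero => exact zero_mem _
  | of x =>
    obtain ⟨f, rfl⟩ := exists_normOne_map x
    obtain ⟨a, rfl⟩ := exists_span f
    rw [hom_eq_gsetHom]
    exact gsetClass_mem_orbitFiltration 0 a.apex fun y => by simp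
  | neg x hx => exact neg_mem hx
  | add x y hx hy => exact add_mem hx hy

theorem dvd_normCardHom (hG : Nat.card G = p ^ n) (j : ℕ) {z : addObj (normZMod p G).F (pt G)}
    (hz : z ∈ orbitFiltration p G j) :
    ∃ t : ℤ, normCardHom n hG (pt G) z = ((p ^ j * t : ℤ) : ZMod (p ^ (n + 1))) := by
  induction hz using AddSubgroup.closure_induction with
  | mem x hx =>
    obtain ⟨Y, -, -, ⟨t, ht⟩, rfl⟩ := hx
    exact ⟨t, by rw [normCardHom_gsetClass, ht]; push_cast; rfl⟩
  | zero => exact ⟨0, by simp⟩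
  | add x y _ _ hx hy =>
    obtain ⟨s, hs⟩ := hx
    obtain ⟨t, ht⟩ := hy
    exact ⟨s + t, by rw [map_add, hs, ht]; push_cast; ring⟩
  | neg x _ hx =>
    obtain ⟨s, hs⟩ := hx
    exact ⟨-s, by rw [map_neg, hs]; push_cast; ring⟩

/-- A nonempty transitive set has at most `p ^ n` elements, so there are no generators. -/
theorem orbitFiltration_eq_bot (hG : Nat.card G = p ^ n) : orbitFiltration p G (n + 1) = ⊥ := by
  rw [orbitFiltration, AddSubgroup.closure_eq_bot_iff]
  rintro _ ⟨Y, ⟨y⟩, hY, hd, rfl⟩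
  have h := card_orbit_mul_card_stabilizer (G := G) y
  rw [card_orbit_of_isPretransitive, hG] at h
  have := Nat.le_of_dvd (pow_pos (Fact.out : p.Prime).pos n) (hd.trans (Dvd.intro _ h))
  exact absurd this (not_le.2 (Nat.pow_lt_pow_right (Fact.out : p.Prime).one_lt n.lt_succ_self))

/-- The cover of the set underlying `Y` which has `p` points over `y₀` and one point over all
other points. -/
abbrev PointCover (p : ℕ) {Y : Type} (y₀ : Y) : Type :=
  {x : Y × ZMod p // x.1 ≠ y₀ → x.2 = 0}

/-- Modulo `p` the fibre over `y₀` may be replaced by the empty one. By transitivity every orbit map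
then meets the empty fibre, so no section exists. -/
theorem gsetClass_orbitSections_pointCover (Y : Burnside G) [MulAction.IsPretransitive G Y]
    (y₀ : Y) : gsetClass p (orbitSections Y fun x : PointCover p y₀ => x.1.1) = 0 := by
  have hE : IsEmpty (orbitSections Y fun x : {y : Y // y ≠ y₀} => x.1) := ⟨fun x => by
    obtain ⟨g, hg⟩ := MulAction.exists_smul_eq G x.1.2 y₀
    exact (x.1.1 g).2 ((x.2 g).trans hg)⟩
  rw [← gsetClass_of_isEmpty (p := p) (orbitSections Y fun x : {y : Y // y ≠ y₀} => x.1)]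
  refine gsetClass_orbitSections Y _ _ fun y => ?_
  by_cases hy : y = y₀
  · subst hy
    have h1 : Nat.card {u : PointCover p y // u.1.1 = y} = p := by
      refine (Nat.card_congr ⟨fun u => u.1.1.2, fun i => ⟨⟨(y, i), fun h => absurd rfl h⟩, rfl⟩, by
        rintro ⟨⟨⟨z, i⟩, h⟩, h'⟩
        exact Subtype.ext (Subtype.ext (Prod.ext h'.symm rfl)), fun i => rfl⟩).trans
          (Nat.card_zmod p)
    have : IsEmpty {v : {z : Y // z ≠ y} // v.1 = y} := ⟨fun v => v.1.2 v.2⟩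
    rw [h1, Nat.card_of_isEmpty]
    simp
  · have h1 : Nat.card {u : PointCover p y₀ // u.1.1 = y} = 1 := by
      refine Nat.card_eq_one_iff_unique.2 ⟨⟨?_⟩, ⟨⟨(y, 0), fun _ => rfl⟩, rfl⟩⟩
      rintro ⟨⟨⟨z, i⟩, h⟩, rfl⟩ ⟨⟨⟨z', i'⟩, h'⟩, h''⟩
      change z' = z at h''
      subst h''
      obtain rfl : i = 0 := h hy
      obtain rfl : i' = 0 := h' hy
      rfl
    have h2 : Nat.card {v : {z : Y // z ≠ y₀} // v.1 = y} = 1 := by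
      refine Nat.card_eq_one_iff_unique.2 ⟨⟨?_⟩, ⟨⟨y, hy⟩, rfl⟩⟩
      rintro ⟨⟨z, h⟩, rfl⟩ ⟨⟨z', h'⟩, h''⟩
      change z' = z at h''
      subst h''
      rfl
    rw [h1, h2]

/-- The sections which are constant on the elements of the group that move the base point to
`y₀`. -/
def IsConstantSection {Y : Burnside G} {y₀ : Y}
    (x : orbitSections Y fun x : PointCover p y₀ => x.1.1) : Prop :=
  ∃ i : ZMod p, ∀ g : G, g • x.1.2 = y₀ → (x.1.1 g).1.2 = i

theorem isConstantSection_smul {Y : Burnside G} {y₀ : Y} (γ : G)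
    (x : orbitSections Y fun x : PointCover p y₀ => x.1.1) :
    IsConstantSection (γ • x) ↔ IsConstantSection x := by
  have key : ∀ (γ : G) (x : orbitSections Y fun x : PointCover p y₀ => x.1.1),
      IsConstantSection x → IsConstantSection (γ • x) := by
    rintro γ x ⟨i, hi⟩
    exact ⟨i, fun g hg => hi (g * γ) ((mul_smul g γ x.1.2).trans hg)⟩
  refine ⟨fun h => ?_, key γ x⟩
  have := key γ⁻¹ _ h
  rwa [inv_smul_smul] at this

/-- A constant section is determined by its base point and its value over `y₀`, and `G` fixes this
value. Transitivity makes the value unique, since every base point can be moved to `y₀`. -/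
theorem gsetClass_constantSections (Y : Burnside G) [MulAction.IsPretransitive G Y] (y₀ : Y) :
    gsetClass p (sub (orbitSections Y fun x : PointCover p y₀ => x.1.1) IsConstantSection
      isConstantSection_smul) = p • gsetClass p Y := by
  classical
  rw [← gsetClass_prodFin]
  symm
  -- Any bijection will do, because `ZMod p` only serves as a set of labels for the points over
  -- `y₀`.
  have e : Fin p ≃ ZMod p := Fintype.equivOfCardEq (by simp [ZMod.card])
  refine gsetClass_congr ⟨fun x => ⟨⟨(fun g => ⟨(g • x.1, if g • x.1 = y₀ then e x.2 else 0),
    fun h => if_neg h⟩, x.1), fun _ => rfl⟩, e x.2, fun g hg => if_pos hg⟩, fun γ x => ?_⟩ ⟨?_, ?_⟩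
  · refine Subtype.ext (Subtype.ext (Prod.ext (funext fun g => Subtype.ext ?_) rfl))
    change (g • γ • x.1, if g • γ • x.1 = y₀ then e x.2 else 0) =
      ((g * γ) • x.1, if (g * γ) • x.1 = y₀ then e x.2 else 0)
    rw [mul_smul]
  · rintro ⟨y, i⟩ ⟨y', i'⟩ h
    have h1 := congrArg (fun t => t.1.1.2) h
    change y = y' at h1
    subst h1
    obtain ⟨g, hg⟩ := MulAction.exists_smul_eq G y y₀
    have h2 := congrArg (fun t => (t.1.1.1 g).1.2) h
    change (if g • y = y₀ then e i else 0) = if g • y = y₀ then e i' else 0 at h2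
    rw [if_pos hg, if_pos hg] at h2
    exact Prod.ext rfl (e.injective h2)
  · rintro ⟨⟨⟨u, y⟩, hu⟩, i, hi⟩
    refine ⟨(y, e.symm i), Subtype.ext (Subtype.ext (Prod.ext (funext fun g => Subtype.ext
      (Prod.ext (hu g).symm ?_)) rfl))⟩
    change (if g • y = y₀ then e (e.symm i) else 0) = (u g).1.2
    split_ifs with hg
    · rw [e.apply_symm_apply]
      exact (hi g hg).symm
    · exact ((u g).2 fun h => hg ((hu g).symm.trans h)).symm

/-- The stabilizer of a nonconstant section is strictly smaller than that of its base point. Both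
orders are powers of `p`, so the orbit of the section is longer than `Y` by at least a factor `p`.
-/
theorem dvd_card_orbit_of_not_isConstantSection (hG : Nat.card G = p ^ n) {j : ℕ} (Y : Burnside G)
    [MulAction.IsPretransitive G Y] (hj : Nat.card Y = p ^ j) (y₀ : Y)
    (x : orbitSections Y fun x : PointCover p y₀ => x.1.1) (hx : ¬ IsConstantSection x) :
    p ^ (j + 1) ∣ Nat.card (MulAction.orbit G x) := by
  have h1 := (card_orbit_mul_card_stabilizer (G := G) x).trans hG
  have h2 := (card_orbit_mul_card_stabilizer (G := G) x.1.2).trans hG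
  rw [card_orbit_of_isPretransitive, hj] at h2
  have hle : MulAction.stabilizer G x ≤ MulAction.stabilizer G x.1.2 := fun g hg =>
    congrArg (fun t : orbitSections Y _ => t.1.2) hg
  have hne : MulAction.stabilizer G x ≠ MulAction.stabilizer G x.1.2 := by
    -- The elements that move the base point to `y₀` form a coset of its stabilizer. If this
    -- stabilizer fixes the section, then the section is constant on the coset.
    intro heq
    obtain ⟨g, hg⟩ := MulAction.exists_smul_eq G x.1.2 y₀
    refine hx ⟨(x.1.1 g).1.2, fun g' hg' => ?_⟩
    have hs : g⁻¹ * g' ∈ MulAction.stabilizer G x := by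
      rw [heq, MulAction.mem_stabilizer_iff, mul_smul, hg', inv_smul_eq_iff, hg]
    have := congrArg (fun t : orbitSections Y _ => (t.1.1 g).1.2) hs
    change (x.1.1 (g * (g⁻¹ * g'))).1.2 = (x.1.1 g).1.2 at this
    rwa [mul_inv_cancel_left] at this
  have hp := (Fact.out : p.Prime)
  obtain ⟨a, -, ha⟩ := (Nat.dvd_prime_pow hp).1 (Dvd.intro _ h1)
  obtain ⟨b, -, hb⟩ := (Nat.dvd_prime_pow hp).1 (Dvd.intro_left _ h1)
  obtain ⟨c, -, hc⟩ := (Nat.dvd_prime_pow hp).1 (Dvd.intro_left _ h2)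
  rw [ha, hb, ← pow_add] at h1
  rw [hc, ← pow_add] at h2
  have h1 := Nat.pow_right_injective hp.two_le h1
  have h2 := Nat.pow_right_injective hp.two_le h2
  have hbc : b < c := by
    by_contra hcb
    refine hne (Subgroup.eq_of_le_of_card_ge hle ?_)
    rw [hb, hc]
    exact Nat.pow_le_pow_right hp.pos (not_lt.1 hcb)
  rw [ha]
  exact pow_dvd_pow p (by omega)

/-- Splitting the sections of the point cover, whose class is zero, shows that `p` times the class
of `Y` is minus the class of the nonconstant sections. -/
theorem smul_gsetClass_mem_orbitFiltration (hG : Nat.card G = p ^ n) {j : ℕ} (Y : Burnside G)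
    [Nonempty Y] [MulAction.IsPretransitive G Y] (hj : Nat.card Y = p ^ j) :
    p • gsetClass p Y ∈ orbitFiltration p G (j + 1) := by
  obtain ⟨y₀⟩ := ‹Nonempty Y›
  have h := gsetClass_split (p := p) (orbitSections Y fun x : PointCover p y₀ => x.1.1)
    IsConstantSection isConstantSection_smul
  rw [gsetClass_orbitSections_pointCover, gsetClass_constantSections, eq_comm,
    add_eq_zero_iff_eq_neg] at h
  rw [h]
  refine neg_mem (gsetClass_mem_orbitFiltration _ _ fun x => ?_)
  rw [← card_orbit_map (subHom _ _ _) Subtype.val_injective]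
  exact dvd_card_orbit_of_not_isConstantSection hG Y hj y₀ _ x.2

/-- Cardinalities of nonempty transitive sets are powers of `p`, and those of cardinality exactly `p
^ j` all have the same class. So the graded piece of the filtration is generated by at most one
class. -/
theorem exists_orbitFiltration_decomposition [IsCyclic G] (hG : Nat.card G = p ^ n) (j : ℕ)
    {z : addObj (normZMod p G).F (pt G)} (hz : z ∈ orbitFiltration p G j) :
    z ∈ orbitFiltration p G (j + 1) ∨ ∃ Y : Burnside G, Nonempty Y ∧
      MulAction.IsPretransitive G Y ∧ Nat.card Y = p ^ j ∧
      ∃ (k : ℤ) (w : _), w ∈ orbitFiltration p G (j + 1) ∧ z = w + k • gsetClass p Y := by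
  have hp := (Fact.out : p.Prime)
  have key : ∀ Y : Burnside G, Nonempty Y → MulAction.IsPretransitive G Y → p ^ j ∣ Nat.card Y →
      Nat.card Y = p ^ j ∨ gsetClass p Y ∈ orbitFiltration p G (j + 1) := by
    rintro Y ⟨y⟩ hY hd
    have h := card_orbit_mul_card_stabilizer (G := G) y
    rw [card_orbit_of_isPretransitive, hG] at h
    obtain ⟨a, -, ha⟩ := (Nat.dvd_prime_pow hp).1 (Dvd.intro _ h)
    rw [ha] at hd
    rcases ((Nat.pow_dvd_pow_iff_le_right hp.one_lt).1 hd).eq_or_lt with rfl | hlt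
    · exact Or.inl ha
    · exact Or.inr (AddSubgroup.subset_closure ⟨Y, ⟨y⟩, hY, ha ▸ pow_dvd_pow p hlt, rfl⟩)
  by_cases hex : ∃ Y : Burnside G, Nonempty Y ∧ MulAction.IsPretransitive G Y ∧ Nat.card Y = p ^ j
  · obtain ⟨Y, hY0, hY1, hY2⟩ := hex
    refine Or.inr ⟨Y, hY0, hY1, hY2, ?_⟩
    have hle : orbitFiltration p G j ≤
        orbitFiltration p G (j + 1) ⊔ AddSubgroup.zmultiples (gsetClass p Y) := by
      conv_lhs => rw [orbitFiltration]
      rw [AddSubgroup.closure_le]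
      rintro _ ⟨Z, hZ0, hZ1, hZ2, rfl⟩
      rcases key Z hZ0 hZ1 hZ2 with h | h
      · rw [gsetClass_eq_of_isPretransitive Z Y (h.trans hY2.symm)]
        exact AddSubgroup.mem_sup_right (AddSubgroup.mem_zmultiples _)
      · exact AddSubgroup.mem_sup_left h
    obtain ⟨w, hw, v, hv, rfl⟩ := AddSubgroup.mem_sup.1 (hle hz)
    obtain ⟨k, rfl⟩ := AddSubgroup.mem_zmultiples_iff.1 hv
    exact ⟨k, w, hw, rfl⟩
  · refine Or.inl ?_
    have hle : orbitFiltration p G j ≤ orbitFiltration p G (j + 1) := by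
      conv_lhs => rw [orbitFiltration]
      rw [AddSubgroup.closure_le]
      rintro _ ⟨Z, hZ0, hZ1, hZ2, rfl⟩
      exact (key Z hZ0 hZ1 hZ2).resolve_left fun h => hex ⟨Z, hZ0, hZ1, h⟩
    exact hle hz

/-- Induction on the number `i` of steps left until the filtration vanishes. Modulo the next step
the element is a multiple of one class of cardinality `p ^ j`; vanishing of its cardinality makes
the multiplicity divisible by `p`, and `p` times that class lies in the next step. -/
theorem eq_zero_of_normCardHom_eq_zero [IsCyclic G] (hG : Nat.card G = p ^ n) (i j : ℕ)
    (hij : i + j = n + 1) {z : addObj (normZMod p G).F (pt G)} (hz : z ∈ orbitFiltration p G j)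
    (h0 : normCardHom n hG (pt G) z = 0) : z = 0 := by
  induction i generalizing j z with
  | zero =>
    obtain rfl : j = n + 1 := by omega
    rwa [orbitFiltration_eq_bot hG, AddSubgroup.mem_bot] at hz
  | succ i ih =>
    refine ih (j + 1) (by omega) ?_ h0
    rcases exists_orbitFiltration_decomposition hG j hz with h | ⟨Y, hY0, hY1, hY2, k, w, hw, rfl⟩
    · exact h
    refine add_mem hw ?_
    obtain ⟨t, ht⟩ := dvd_normCardHom hG (j + 1) hw
    rw [map_add, map_zsmul, ht, normCardHom_gsetClass, hY2, zsmul_eq_mul] at h0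
    have h1 : (((p : ℤ) ^ (j + 1) * t + k * (p : ℤ) ^ j : ℤ) : ZMod (p ^ (n + 1))) = 0 := by
      rw [← h0]; push_cast; ring
    rw [ZMod.intCast_zmod_eq_zero_iff_dvd, Nat.cast_pow] at h1
    -- Modulo `p ^ (j + 1)` only `k * p ^ j` survives; cancelling `p ^ j` leaves `p ∣ k`.
    have h2 := (pow_dvd_pow (p : ℤ) (show j + 1 ≤ n + 1 by omega)).trans h1
    rw [dvd_add_right (dvd_mul_right _ _), pow_succ', mul_dvd_mul_iff_right
      (pow_ne_zero _ (Int.natCast_ne_zero.2 (Fact.out : p.Prime).ne_zero))] at h2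
    obtain ⟨k, rfl⟩ := h2
    rw [mul_comm, mul_smul, natCast_zsmul]
    exact zsmul_mem (smul_gsetClass_mem_orbitFiltration hG Y hY2) k

theorem normCardHom_bijective [IsCyclic G] (hG : Nat.card G = p ^ n) :
    Function.Bijective (normCardHom (p := p) n hG (pt G)) := by
  refine ⟨(injective_iff_map_eq_zero _).2 fun z hz => ?_, fun a => ?_⟩
  · exact eq_zero_of_normCardHom_eq_zero hG (n + 1) 0 rfl
      (by rw [orbitFiltration_zero]; exact AddSubgroup.mem_top z) hz
  · obtain ⟨k, rfl⟩ := ZMod.intCast_surjective a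
    -- The class of the one-point set has cardinality 1, hence generates the target.
    refine ⟨k • gsetClass p (pt G), ?_⟩
    rw [map_zsmul, normCardHom_gsetClass]
    simp

/-- The value of the norm Mackey functor of the field with `p` elements at the one-point set. -/
def normCardEquiv [IsCyclic G] (hG : Nat.card G = p ^ n) :
    addObj (normZMod p G).F (pt G) ≃+ ZMod (p ^ (n + 1)) :=
  AddEquiv.ofBijective _ (normCardHom_bijective hG)

end Injectivity

/-! ### The geometric fixed point maps in degree zero -/

section ZerothHomology

open Opposite
open scoped Simplicial

variable {p n : ℕ} [Fact p.Prime] {G : Type} [CommGroup G] [Finite G] [IsCyclic G]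

/-- The box power of the norm with one factor, at the one-point set. -/
def boxCardEquiv (hG : Nat.card G = p ^ n) :
    addObj (boxPow (Fin 1) (normZMod p G).F) (pt G) ≃+ ZMod (p ^ (n + 1)) :=
  (((additivization G).mapIso (boxMulIso p (Fin 1))).app (pt G)).addCommGroupIsoToAddEquiv.trans
    (normCardEquiv hG)

theorem boxCardEquiv_boxUnit (hG : Nat.card G = p ^ n) :
    boxCardEquiv hG (QuotientAddGroup.mk (FreeAbelianGroup.of (boxUnit p G (Fin 1)))) = 1 := by
  change normCardHom n hG (pt G) (QuotientAddGroup.mk (FreeAbelianGroup.of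
    ((boxMul (Fin 1) (normZMod p G)).app (pt G) (boxUnit p G (Fin 1))))) = 1
  unfold boxUnit
  rw [boxMul_boxOne, tr_comp]
  refine (congrArg (fun f => normCardHom n hG (pt G) (QuotientAddGroup.mk (FreeAbelianGroup.of
    ((normZMod p G).F.map f (normOne p G))))) (hom_eq_gsetHom _)).trans ?_
  refine (normCardHom_gsetClass hG _).trans ?_
  change ((Nat.card (coindPt G) : ℕ) : ZMod (p ^ (n + 1))) = 1
  rw [Nat.card_unique, Nat.cast_one]

/-- The zeroth twisted Hochschild homology of the field with `p` elements at the one-point set. -/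
def HHZeroEquiv (hG : Nat.card G = p ^ n) (γ : G) :
    (HH G γ (ZMod p) 0).obj (pt G) ≃+ ZMod (p ^ (n + 1)) :=
  ((HHZeroIsoNerve p γ).app (pt G)).addCommGroupIsoToAddEquiv.trans (boxCardEquiv hG)

variable {Q : Type} [CommGroup Q] [Finite Q] [IsCyclic Q] (q : G →* Q)
  (hq : Function.Surjective q)

/-- The group is generated by the class of the unit, and both sides are additive and send it to 1.
-/
theorem boxCardEquiv_geomFixApp {m : ℕ} (hG : Nat.card G = p ^ n) (hQ : Nat.card Q = p ^ m)
    (φ : ZMod (p ^ (n + 1)) →+* ZMod (p ^ (m + 1)))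
    (x : addObj (boxPow (Fin 1) (normZMod p G).F) (pt G)) :
    boxCardEquiv hQ (geomFixApp q hq (ZMod p) (op ⦋0⦌) x) = φ (boxCardEquiv hG x) := by
  obtain ⟨k, hk⟩ := ZMod.intCast_surjective (boxCardEquiv hG x)
  have hx : x = k • (QuotientAddGroup.mk (FreeAbelianGroup.of (boxUnit p G (Fin 1))) :
      addObj (boxPow (Fin 1) (normZMod p G).F) (pt G)) := by
    apply (boxCardEquiv hG).injective
    rw [map_zsmul, boxCardEquiv_boxUnit, ← hk, zsmul_one]
  have hu : geomFixApp q hq (ZMod p) (op ⦋0⦌)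
      (QuotientAddGroup.mk (FreeAbelianGroup.of (boxUnit p G (Fin 1)))) =
      (QuotientAddGroup.mk (FreeAbelianGroup.of (boxUnit p Q (Fin 1))) :
        addObj (boxPow (Fin 1) (normZMod p Q).F) (pt Q)) :=
    congrArg (fun t => (QuotientAddGroup.mk (FreeAbelianGroup.of t) :
      addObj (boxPow (Fin 1) (normZMod p Q).F) (pt Q))) (map_boxFix_boxUnit q hq)
  rw [← hk, map_intCast, hx, map_zsmul]
  refine (congrArg (fun t => boxCardEquiv hQ (k • t)) hu).trans ?_
  rw [map_zsmul, boxCardEquiv_boxUnit, zsmul_one]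

theorem HHZeroEquiv_geomFixHH {m : ℕ} (hG : Nat.card G = p ^ n) (hQ : Nat.card Q = p ^ m)
    (φ : ZMod (p ^ (n + 1)) →+* ZMod (p ^ (m + 1))) (γ : G) (γ' : Q) (hγ : q γ = γ')
    (x : (HH G γ (ZMod p) 0).obj (pt G)) :
    HHZeroEquiv hQ γ' (geomFixHH q hq (ZMod p) γ γ' hγ 0 x) = φ (HHZeroEquiv hG γ x) := by
  refine Eq.trans ?_ (boxCardEquiv_geomFixApp q hq hG hQ φ _)
  refine congrArg (boxCardEquiv hQ) ?_
  exact ConcreteCategory.congr_hom (simplicialHomologyZeroIso_naturality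
    (fun θ => isIso_evalNerve_map γ (pt G) θ) (fun θ => isIso_evalNerve_map γ' (pt Q) θ)
    (geomFix q hq (ZMod p) γ γ' hγ)) x

end ZerothHomology

/-! ### The limit and the `p`-adic integers -/

section Limit

theorem card_cyc (p n : ℕ) : Nat.card (Cyc p n) = p ^ n :=
  Nat.card_zmod _

variable (p : ℕ) [Fact p.Prime]

/-- The compatible sequences of residue classes modulo powers of `p`. -/
def compatibleSequences : Subring (∀ n, ZMod (p ^ n)) where
  carrier := {x | ∀ i j (h : i ≤ j), ZMod.castHom (pow_dvd_pow p h) (ZMod (p ^ i)) (x j) = x i}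
  zero_mem' _ _ _ := map_zero _
  one_mem' _ _ _ := map_one _
  add_mem' hx hy i j h := (map_add _ _ _).trans (congrArg₂ _ (hx i j h) (hy i j h))
  mul_mem' hx hy i j h := (map_mul _ _ _).trans (congrArg₂ _ (hx i j h) (hy i j h))
  neg_mem' hx i j h := (map_neg _ _).trans (congrArg _ (hx i j h))

variable {p}

/-- The universal property of the `p`-adic integers is applied to the ring of all compatible
sequences and its coordinate projections, then evaluated at the given sequence. -/
theorem exists_toZModPow_eq (x : ∀ n, ZMod (p ^ n))
    (hx : ∀ n, ZMod.castHom (pow_dvd_pow p n.le_succ) (ZMod (p ^ n)) (x (n + 1)) = x n) :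
    ∃ z : ℤ_[p], ∀ n, PadicInt.toZModPow n z = x n := by
  have hx' : x ∈ compatibleSequences p := by
    intro i j h
    -- Compatibility for neighbouring indices implies it for all pairs, as a ring homomorphism
    -- between these quotients of the integers is unique.
    induction j, h using Nat.le_induction with
    | base =>
      exact congrArg (fun f : ZMod (p ^ i) →+* ZMod (p ^ i) => f (x i))
        (Subsingleton.elim _ (RingHom.id _))
    | succ j h ih =>
      rw [← ih, ← hx j, ← RingHom.comp_apply]
      exact congrArg (fun f : ZMod (p ^ (j + 1)) →+* ZMod (p ^ i) => f (x (j + 1)))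
        (Subsingleton.elim _ _)
  have hf : ∀ i j (h : i ≤ j), (ZMod.castHom (pow_dvd_pow p h) (ZMod (p ^ i))).comp
      ((Pi.evalRingHom _ j).comp (compatibleSequences p).subtype) =
        (Pi.evalRingHom _ i).comp (compatibleSequences p).subtype := fun i j h =>
    RingHom.ext fun y => y.2 i j h
  exact ⟨PadicInt.lift hf ⟨x, hx'⟩, fun n =>
    congrArg (fun f => f ⟨x, hx'⟩) (PadicInt.lift_spec hf n)⟩

/-- The zeroth algebraic `TR` group of the field with `p` elements is the group of `p`-adic
integers. -/
theorem nonempty_algTR_zero_equiv : Nonempty (algTR p (ZMod p) 0 ≃+ ℤ_[p]) := by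
  let E : ∀ n, (HHCyc p (ZMod p) 0 n).obj (pt (Cyc p n)) ≃+ ZMod (p ^ (n + 1)) := fun n =>
    HHZeroEquiv (card_cyc p n) (gen p n)
  have hE : ∀ n x, E n (trMap p (ZMod p) 0 n x) =
      ZMod.castHom (pow_dvd_pow p (n + 1).le_succ) (ZMod (p ^ (n + 1))) (E (n + 1) x) := fun n x =>
    HHZeroEquiv_geomFixHH (proj p n) (proj_surjective p n) (card_cyc p (n + 1)) (card_cyc p n) _ _ _
      (proj_gen p n) x
  let F : ℤ_[p] →+ algTR p (ZMod p) 0 :=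
    { toFun z := ⟨fun n => (E n).symm (PadicInt.toZModPow (n + 1) z), fun n => (E n).injective (by
        rw [hE, AddEquiv.apply_symm_apply, AddEquiv.apply_symm_apply]
        exact congrArg (fun f => f z)
          (PadicInt.zmod_cast_comp_toZModPow (n + 1) (n + 2) (n + 1).le_succ))⟩
      map_zero' := Subtype.ext (funext fun n => by simp)
      map_add' z w := Subtype.ext (funext fun n => by simp) }
  refine ⟨(AddEquiv.ofBijective F ⟨fun z w h => ?_, fun y => ?_⟩).symm⟩
  -- The sequence records residues modulo `p ^ (n + 1)` only, and the residue modulo `p ^ n` is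
  -- recovered by reduction.
  · refine PadicInt.ext_of_toZModPow.1 fun n => ?_
    have h1 : PadicInt.toZModPow (n + 1) z = PadicInt.toZModPow (n + 1) w :=
      (E n).symm.injective (congrFun (congrArg Subtype.val h) n)
    rw [← PadicInt.zmod_cast_comp_toZModPow n (n + 1) n.le_succ, RingHom.comp_apply, h1,
      RingHom.comp_apply]
  · obtain ⟨z, hz⟩ := exists_toZModPow_eq (p := p)
      -- Level `n` of the tower carries a residue modulo `p ^ (n + 1)`. The sequence is therefore
      -- shifted by one and completed by the only element of the trivial ring `ZMod (p ^ 0)`.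
      (fun n => match n with
        | 0 => 0
        | n + 1 => E n (y.1 n)) (by
      rintro (_ | n)
      · have : Subsingleton (ZMod (p ^ 0)) := by rw [pow_zero]; infer_instance
        exact Subsingleton.elim _ _
      · exact (hE n _).symm.trans (congrArg (E n) (y.2 n)))
    refine ⟨z, Subtype.ext (funext fun n => ?_)⟩
    change (E n).symm (PadicInt.toZModPow (n + 1) z) = y.1 n
    rw [hz, AddEquiv.symm_apply_apply]

theorem subsingleton_algTR (k : ℕ) (hk : 0 < k) : Subsingleton (algTR p (ZMod p) k) := by
  have : ∀ n, Subsingleton ((HHCyc p (ZMod p) k n).obj (pt (Cyc p n))) := fun n =>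
    AddCommGrpCat.subsingleton_of_isZero
      ((Functor.isZero_iff _).1 (isZero_HH (p := p) (gen p n) k hk) (pt _))
  infer_instance

end Limit

end AlgebraicTR

end

theorem mainTheorem12 (p : ℕ) [Fact p.Prime] :
    (∀ n : ℕ,
      Nonempty (AlgebraicTR.HHCyc p (ZMod p) 0 n ≅
        AlgebraicTR.normMackey (AlgebraicTR.Cyc p n) (ZMod p)) ∧
      ∀ k : ℕ, 0 < k → CategoryTheory.Limits.IsZero (AlgebraicTR.HHCyc p (ZMod p) k n)) ∧
    Nonempty (AlgebraicTR.algTR p (ZMod p) 0 ≃+ ℤ_[p]) ∧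
    ∀ k : ℕ, 0 < k → Subsingleton (AlgebraicTR.algTR p (ZMod p) k) :=
  ⟨fun n => ⟨⟨AlgebraicTR.HHZeroIso p (AlgebraicTR.gen p n)⟩,
      AlgebraicTR.isZero_HH (AlgebraicTR.gen p n)⟩,
    AlgebraicTR.nonempty_algTR_zero_equiv, AlgebraicTR.subsingleton_algTR⟩
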